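/- A data set consists of $n$ examples $e_1,\dots,e_n\in\mathbb R^d$, each labeled with one of two classes, such that examples with identical coordinates have the same class. For a feature $i\in\{1,\dots,d\}$ let $\mathrm{Thr}(i)$ be the smallest set of thresholds that consists of all values $e_a[i]$ except the largest one (so whenever $e_a[i]<e_b[i]$ there is $t\in\mathrm{Thr}(i)$ with $e_a[i]\le t<e_b[i]$). A decision tree is a rooted ordered binary tree in which each inner vertex carries a cut $(i,t)$ with $t\in\mathrm{Thr}(i)$, sending an example $e$ to its left child if $e[i]\le t$ and to its right child if $e[i]>t$, and each leaf carries a class. Its size is its number of inner vertices, and it classifies the data set if every example has the class of the leaf that it reaches. Minimum-Size Decision Tree asks, given a data set, for a decision tree of smallest size that classifies it. Let $s$ be this smallest size, $\delta$ the largest number of features in which two examples differ, $D$ the largest number of distinct values that the examples take in one feature, and $c$ the number of features that are constant on all examples. Theorem. There is an algorithm that solves Minimum-Size Decision Tree on every data set in time $$\mathcal O\Big(\big(\delta\cdot D\cdot \max\{1,\log_2 s\}\big)^{s}\cdot s\cdot n \;+\; c\cdot n+n+1\Big).$$ The constant hidden in $\mathcal O$ is absolute. Time is measured on a real RAM with uniform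 costs: a single program with registers, arrays of natural numbers and arrays of real numbers, initially zero, with indirect addressing and random access to the input, which adds, subtracts and compares natural numbers and copies and compares real numbers, at unit cost per operation. The program halts with an explicit encoding of the tree in its memory. In particular, if $s\ge 1$ and no feature is constant on all examples, the running time is $\mathcal O((\delta\cdot D\cdot \max\{1,\log_2 s\})^{s}\cdot s\cdot n)$. -/

import Mathlib

noncomputable section

namespace MSDT

/-! ### Data sets and decision trees -/

/-- A data set with `n` examples in `ℝ^d` and two classes (`false` is blue, `true` is red).
Examples with identical coordinates have the same class; an example may be listed repeatedly, so
that sets of examples are the case where `ex` is injective. -/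
structure DataSet (n d : ℕ) where
  ex : Fin n → Fin d → ℝ
  label : Fin n → Bool
  consistent : ∀ a b, ex a = ex b → label a = label b

/-- Decision trees with axis-parallel cuts. An inner vertex with cut `(i, t)` sends `x` to its
left child `l` if `x i ≤ t` and to its right child `r` if `x i > t`. -/
inductive DecisionTree (d : ℕ) where
  | leaf (c : Bool) : DecisionTree d
  | node (i : Fin d) (t : ℝ) (l r : DecisionTree d) : DecisionTree d

namespace DecisionTree

variable {d : ℕ}

/-- The size is the number of inner vertices. -/
def size : DecisionTree d → ℕ
  | leaf _ => 0
  | node _ _ l r => l.size + r.size + 1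

/-- The class of the leaf to which `x` is assigned. -/
def classOf : DecisionTree d → (Fin d → ℝ) → Bool
  | leaf c, _ => c
  | node i t l r, x => if x i ≤ t then l.classOf x else r.classOf x

/-- Every inner vertex carries a cut `(i, t)` with `t ∈ Thr i`. -/
def CutsIn (Thr : Fin d → Finset ℝ) : DecisionTree d → Prop
  | leaf _ => True
  | node i t l r => t ∈ Thr i ∧ l.CutsIn Thr ∧ r.CutsIn Thr

end DecisionTree

namespace DataSet

variable {n d : ℕ}

/-- The domain of feature `i`: the values that it takes on the examples. -/
def dom (E : DataSet n d) (i : Fin d) : Finset ℝ :=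
  Finset.univ.image fun a => E.ex a i

/-- `T` is a set of thresholds for feature `i`: it separates all examples that differ there. -/
def Separates (E : DataSet n d) (i : Fin d) (T : Finset ℝ) : Prop :=
  ∀ a b, E.ex a i < E.ex b i → ∃ t ∈ T, E.ex a i ≤ t ∧ t < E.ex b i

/-- The thresholds of feature `i`: all its values except the largest one. By
`separates_thresholds` and `card_thresholds_le` this is a smallest separating set. -/
def thresholds (E : DataSet n d) (i : Fin d) : Finset ℝ :=
  (E.dom i).filter fun t => ∃ b, t < E.ex b i

theorem separates_thresholds (E : DataSet n d) (i : Fin d) : E.Separates i (E.thresholds i) := by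
  intro a b h
  refine ⟨E.ex a i, ?_, le_rfl, h⟩
  simp only [thresholds, dom, Finset.mem_filter, Finset.mem_image, Finset.mem_univ, true_and]
  exact ⟨⟨a, rfl⟩, b, h⟩

theorem card_thresholds_le (E : DataSet n d) (i : Fin d) (T : Finset ℝ) (hT : E.Separates i T) :
    (E.thresholds i).card ≤ T.card := by
  have key : ∀ v ∈ E.thresholds i, ∃ t ∈ T, v ≤ t ∧ ∀ b, v < E.ex b i → t < E.ex b i := by
    intro v hv
    simp only [thresholds, dom, Finset.mem_filter, Finset.mem_image, Finset.mem_univ,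
      true_and] at hv
    obtain ⟨⟨a, rfl⟩, b, hb⟩ := hv
    obtain ⟨m, hm, hmin⟩ := Finset.exists_min_image
      (Finset.univ.filter fun c => E.ex a i < E.ex c i) (fun c => E.ex c i) ⟨b, by simpa using hb⟩
    obtain ⟨t, ht, h1, h2⟩ := hT a m (by simpa using hm)
    exact ⟨t, ht, h1, fun c hc => h2.trans_le (hmin c (by simpa using hc))⟩
  choose! f hf using key
  refine Finset.card_le_card_of_injOn f (fun v hv => (hf v hv).1) ?_
  have lt : ∀ v ∈ E.thresholds i, ∀ w ∈ E.thresholds i, v < w → f v < f w := by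
    intro v hv w hw hvw
    have hw' := hw
    simp only [thresholds, dom, Finset.mem_filter, Finset.mem_image, Finset.mem_univ,
      true_and] at hw'
    obtain ⟨⟨a, rfl⟩, -⟩ := hw'
    exact ((hf v hv).2.2 a hvw).trans_le (hf _ hw).2.1
  intro v hv w hw h
  rcases lt_trichotomy v w with h' | h' | h'
  · exact absurd h (lt v hv w hw h').ne
  · exact h'
  · exact absurd h (lt w hw v hv h').ne'

/-- `T` is a decision tree for `E` that is perfect, that is, classifies every example correctly. -/
def Classifies (E : DataSet n d) (T : DecisionTree d) : Prop :=
  T.CutsIn E.thresholds ∧ ∀ a, T.classOf (E.ex a) = E.label a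

/-- `T` is a solution of Minimum-Size Decision Tree on the instance `E`. -/
def IsMinimumTree (E : DataSet n d) (T : DecisionTree d) : Prop :=
  E.Classifies T ∧ ∀ T' : DecisionTree d, E.Classifies T' → T.size ≤ T'.size

/-- `δ`: the largest number of features in which two examples differ. -/
def maxDiff (E : DataSet n d) : ℕ :=
  Finset.univ.sup fun p : Fin n × Fin n =>
    (Finset.univ.filter fun i => E.ex p.1 i ≠ E.ex p.2 i).card

/-- `D`: the largest number of values that a feature takes. -/
def maxDom (E : DataSet n d) : ℕ :=
  Finset.univ.sup fun i => (E.dom i).card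

/-- The number of features that are constant on the examples. -/
def numConst (E : DataSet n d) : ℕ :=
  (Finset.univ.filter fun i : Fin d => ∀ a b, E.ex a i = E.ex b i).card

end DataSet

/-! ### A real RAM

The memory consists of natural-number registers and of finitely many (per program) unbounded arrays
of natural numbers and of real numbers, with indirect addressing. The input is read-only. Natural
numbers can be added, subtracted and compared; real numbers can only be copied and compared. Every
elementary operation takes one unit of time. -/

/-- Contents of the memory: registers `var x`, arrays `nat a` and `real a`. -/
structure State where
  var : ℕ → ℕ
  nat : ℕ → ℕ → ℕ
  real : ℕ → ℕ → ℝ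

/-- The memory before the start of a program. -/
def State.init : State := ⟨fun _ => 0, fun _ _ => 0, fun _ _ => 0⟩

/-- Natural-number expressions. -/
inductive NExpr where
  | const (k : ℕ)
  | numExamples
  | numFeatures
  | label (e : NExpr)
  | var (x : ℕ)
  | get (a : ℕ) (e : NExpr)
  | add (e f : NExpr)
  | sub (e f : NExpr)

/-- Real-number expressions: a coordinate of an example, or a cell of an array. -/
inductive RExpr where
  | input (e i : NExpr)
  | get (a : ℕ) (e : NExpr)

/-- Tests. -/
inductive Test where
  | le (e f : NExpr)
  | rle (p q : RExpr)
  | not (b : Test)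

/-- Programs. -/
inductive Prog where
  | setVar (x : ℕ) (e : NExpr)
  | setNat (a : ℕ) (k e : NExpr)
  | setReal (a : ℕ) (k : NExpr) (p : RExpr)
  | seq (P Q : Prog)
  | ite (b : Test) (P Q : Prog)
  | while (b : Test) (P : Prog)

section Semantics

variable {n d : ℕ}

/-- Value of an expression (labels are read as `0` and `1`; reading outside the input gives `0`,
and subtraction is truncated). -/
def NExpr.value (E : DataSet n d) (σ : State) : NExpr → ℕ
  | const k => k
  | numExamples => n
  | numFeatures => d
  | label e => if h : e.value E σ < n then (if E.label ⟨e.value E σ, h⟩ then 1 else 0) else 0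
  | var x => σ.var x
  | get a e => σ.nat a (e.value E σ)
  | add e f => e.value E σ + f.value E σ
  | sub e f => e.value E σ - f.value E σ

def RExpr.value (E : DataSet n d) (σ : State) : RExpr → ℝ
  | input e i =>
      if h : e.value E σ < n ∧ i.value E σ < d then
        E.ex ⟨e.value E σ, h.1⟩ ⟨i.value E σ, h.2⟩
      else 0
  | get a e => σ.real a (e.value E σ)

def Test.Holds (E : DataSet n d) (σ : State) : Test → Prop
  | le e f => e.value E σ ≤ f.value E σ
  | rle p q => p.value E σ ≤ q.value E σ
  | not b => ¬ b.Holds E σ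

/-- Time to evaluate an expression: the number of its operations. -/
def NExpr.cost : NExpr → ℕ
  | const _ => 1
  | numExamples => 1
  | numFeatures => 1
  | label e => e.cost + 1
  | var _ => 1
  | get _ e => e.cost + 1
  | add e f => e.cost + f.cost + 1
  | sub e f => e.cost + f.cost + 1

def RExpr.cost : RExpr → ℕ
  | input e i => e.cost + i.cost + 1
  | get _ e => e.cost + 1

def Test.cost : Test → ℕ
  | le e f => e.cost + f.cost + 1
  | rle p q => p.cost + q.cost + 1
  | not b => b.cost + 1

/-- `Runs E P σ t τ`: on input `E`, the program `P` started with memory `σ` halts after exactly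
`t` units of time with memory `τ`. -/
inductive Runs (E : DataSet n d) : Prog → State → ℕ → State → Prop where
  | setVar (x : ℕ) (e : NExpr) (σ : State) :
      Runs E (.setVar x e) σ (e.cost + 1)
        { σ with var := Function.update σ.var x (e.value E σ) }
  | setNat (a : ℕ) (k e : NExpr) (σ : State) :
      Runs E (.setNat a k e) σ (k.cost + e.cost + 1)
        { σ with nat :=
            Function.update σ.nat a (Function.update (σ.nat a) (k.value E σ) (e.value E σ)) }
  | setReal (a : ℕ) (k : NExpr) (p : RExpr) (σ : State) :
      Runs E (.setReal a k p) σ (k.cost + p.cost + 1)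
        { σ with real :=
            Function.update σ.real a (Function.update (σ.real a) (k.value E σ) (p.value E σ)) }
  | seq {P Q : Prog} {σ τ υ : State} {t u : ℕ} :
      Runs E P σ t τ → Runs E Q τ u υ → Runs E (.seq P Q) σ (t + u) υ
  | iteTrue {b : Test} {P Q : Prog} {σ τ : State} {t : ℕ} :
      b.Holds E σ → Runs E P σ t τ → Runs E (.ite b P Q) σ (b.cost + t + 1) τ
  | iteFalse {b : Test} {P Q : Prog} {σ τ : State} {t : ℕ} :
      ¬ b.Holds E σ → Runs E Q σ t τ → Runs E (.ite b P Q) σ (b.cost + t + 1) τ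
  | whileTrue {b : Test} {P : Prog} {σ τ υ : State} {t u : ℕ} :
      b.Holds E σ → Runs E P σ t τ → Runs E (.while b P) τ u υ →
        Runs E (.while b P) σ (b.cost + t + u + 1) υ
  | whileFalse {b : Test} {P : Prog} {σ : State} :
      ¬ b.Holds E σ → Runs E (.while b P) σ (b.cost + 1) σ

/-- Programs are deterministic. -/
theorem Runs.deterministic {E : DataSet n d} {P : Prog} {σ τ : State} {t : ℕ}
    (h : Runs E P σ t τ) : ∀ {t' : ℕ} {τ' : State}, Runs E P σ t' τ' → t = t' ∧ τ = τ' := by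
  induction h with
  | setVar | setNat | setReal => intro t' τ' h'; cases h'; exact ⟨rfl, rfl⟩
  | seq _ _ ih1 ih2 =>
    intro t' τ' h'
    cases h' with
    | seq g1 g2 =>
      obtain ⟨rfl, rfl⟩ := ih1 g1
      obtain ⟨rfl, rfl⟩ := ih2 g2
      exact ⟨rfl, rfl⟩
  | iteTrue hb _ ih =>
    intro t' τ' h'
    cases h' with
    | iteTrue _ g => obtain ⟨rfl, rfl⟩ := ih g; exact ⟨rfl, rfl⟩
    | iteFalse hb' _ => exact absurd hb hb'
  | iteFalse hb _ ih =>
    intro t' τ' h'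
    cases h' with
    | iteTrue hb' _ => exact absurd hb' hb
    | iteFalse _ g => obtain ⟨rfl, rfl⟩ := ih g; exact ⟨rfl, rfl⟩
  | whileTrue hb _ _ ih1 ih2 =>
    intro t' τ' h'
    cases h' with
    | whileTrue _ g1 g2 =>
      obtain ⟨rfl, rfl⟩ := ih1 g1
      obtain ⟨rfl, rfl⟩ := ih2 g2
      exact ⟨rfl, rfl⟩
    | whileFalse hb' => exact absurd hb hb'
  | whileFalse hb =>
    intro t' τ' h'
    cases h' with
    | whileTrue hb' _ _ => exact absurd hb' hb
    | whileFalse _ => exact ⟨rfl, rfl⟩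

/-- The subtree at address `v` of the memory is `T`. Array `nat 0` tells leaves (`0`) from inner
vertices (`1`); `nat 1` holds the class of a leaf and the feature of an inner vertex; `real 0` holds
the threshold, and `nat 2` and `nat 3` the addresses of the children, of an inner vertex. -/
def State.StoresAt (σ : State) : ℕ → DecisionTree d → Prop
  | v, .leaf c => σ.nat 0 v = 0 ∧ σ.nat 1 v = (if c then 1 else 0)
  | v, .node i t l r =>
      σ.nat 0 v = 1 ∧ σ.nat 1 v = i ∧ σ.real 0 v = t ∧
        σ.StoresAt (σ.nat 2 v) l ∧ σ.StoresAt (σ.nat 3 v) r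

/-- The output is the tree whose root has its address in register `0`. -/
def State.Outputs (σ : State) (T : DecisionTree d) : Prop :=
  σ.StoresAt (σ.var 0) T

end Semantics

end MSDT

end

/-! A tree is grown one vertex at a time. Every leaf carries a witness, an example that has to stay
there. Let `T` be a solution that refines the current tree `R`, and let `e` be a dirty example: its
class differs from that of the witness `w` of the leaf of `R` that it reaches. Follow `e` through
`T`. Somewhere it parts from the witnesses of a subtree of `R` on its path, and the cut of `T` at
this point can be inserted into `R` above that subtree, with `e` as the witness of a new leaf. The
result has one more inner vertex and is again refined by a solution that is no larger. The cut
separates `e` from `w`, so there are at most `δ` features and `D` thresholds to try.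

It remains to bound the number of places on the path of `e`. No cut is needed directly above a
vertex whose child off the path contains no dirty example. That child already classifies its
examples, so in `T` it can replace whatever refines it, while the cuts inserted above are pushed
into the child on the path (`WTree.Ref.absorb_left`, `WTree.Ref.absorb_right`, `WTree.ref_extends`).
The dirty example is chosen by a descent that takes the smaller child whenever both contain dirty
examples. Each place that remains, apart from the leaf, then halves the subtree, so a tree of size
`m` has at most `1 + log₂ (m + 1)` places (`wp_descend`).

Hence there are at most `(δD)^j ∏_{m<j} (1 + log₂ (m + 1))` trees of size `j`. By Stirling's bound
the product up to `s` is smaller than `(log₂ s)^s` by a factor exponential in `s / log s`, which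
pays for all polynomial factors (`exists_prod_one_add_log_le`).

The search is breadth first, and an entry of the queue is expanded only when all entries have been
checked. So no tree of size `s` is ever expanded, every tree in the queue has size at most `s`, and
the first tree without dirty examples is a solution (`Search.expand`, `Searching.isMinimumTree`).

An expansion must not read all `d` features. The program therefore keeps a list of the features in
which some dirty example picked so far differs from the first example. All witnesses are the first
example or such examples, so the list contains each feature in which `e` and `w` differ. Its length
is at most `n * δ`, and each example is scanned only once, so that constant features contribute `c *
n` in total. The factor `δ` paid per expansion is absorbed by the gap between level `j < s` and
level `s` of the search (`DataSet.timeBound_le`). -/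

namespace MSDT

-- Program logic: memory updates, frames and weakest preconditions with time

infixr:35 " ;; " => Prog.seq

namespace State

/-- Write a register. -/
def setV (σ : State) (x k : ℕ) : State := { σ with var := Function.update σ.var x k }

/-- Write a cell of an array of natural numbers. -/
def setN (σ : State) (a i k : ℕ) : State :=
  { σ with nat := Function.update σ.nat a (Function.update (σ.nat a) i k) }

/-- Write a cell of an array of real numbers. -/
def setR (σ : State) (a i : ℕ) (x : ℝ) : State :=
  { σ with real := Function.update σ.real a (Function.update (σ.real a) i x) }

variable (σ : State)

@[simp] theorem setV_var (x k y : ℕ) : (σ.setV x k).var y = if y = x then k else σ.var y := by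
  simp [setV, Function.update_apply]

@[simp] theorem setV_nat (x k : ℕ) : (σ.setV x k).nat = σ.nat := rfl

@[simp] theorem setV_real (x k : ℕ) : (σ.setV x k).real = σ.real := rfl

@[simp] theorem setN_var (a i k : ℕ) : (σ.setN a i k).var = σ.var := rfl

@[simp] theorem setN_nat (a i k b j : ℕ) :
    (σ.setN a i k).nat b j = if b = a then if j = i then k else σ.nat b j else σ.nat b j := by
  by_cases h : b = a
  · subst h; simp [setN, Function.update_apply]
  · simp [setN, h]

@[simp] theorem setN_real (a i k : ℕ) : (σ.setN a i k).real = σ.real := rfl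

@[simp] theorem setR_var (a i : ℕ) (x : ℝ) : (σ.setR a i x).var = σ.var := rfl

@[simp] theorem setR_nat (a i : ℕ) (x : ℝ) : (σ.setR a i x).nat = σ.nat := rfl

@[simp] theorem setR_real (a i : ℕ) (x : ℝ) (b j : ℕ) :
    (σ.setR a i x).real b j =
      if b = a then if j = i then x else σ.real b j else σ.real b j := by
  by_cases h : b = a
  · subst h; simp [setR, Function.update_apply]
  · simp [setR, h]

end State

namespace Prog

/-- Registers that a program may write. -/
def vars : Prog → List ℕ
  | setVar x _ => [x]
  | setNat _ _ _ => []
  | setReal _ _ _ => []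
  | seq P Q => P.vars ++ Q.vars
  | ite _ P Q => P.vars ++ Q.vars
  | .while _ P => P.vars

/-- Arrays of natural numbers that a program may write. -/
def nats : Prog → List ℕ
  | setVar _ _ => []
  | setNat a _ _ => [a]
  | setReal _ _ _ => []
  | seq P Q => P.nats ++ Q.nats
  | ite _ P Q => P.nats ++ Q.nats
  | .while _ P => P.nats

/-- Arrays of real numbers that a program may write. -/
def reals : Prog → List ℕ
  | setVar _ _ => []
  | setNat _ _ _ => []
  | setReal a _ _ => [a]
  | seq P Q => P.reals ++ Q.reals
  | ite _ P Q => P.reals ++ Q.reals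
  | .while _ P => P.reals

/-- `σ` and `τ` differ only in memory that `P` may write. -/
structure Frame (P : Prog) (σ τ : State) : Prop where
  var : ∀ x, x ∉ P.vars → τ.var x = σ.var x
  nat : ∀ a, a ∉ P.nats → τ.nat a = σ.nat a
  real : ∀ a, a ∉ P.reals → τ.real a = σ.real a

end Prog

section

variable {n d : ℕ} {E : DataSet n d}

/-- The written registers and arrays are read off the syntax, so for a concrete program the side
conditions of a frame argument are closed by `decide`. -/
theorem Runs.frame {P : Prog} {σ τ : State} {t : ℕ} (h : Runs E P σ t τ) : P.Frame σ τ := by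
  induction h with
  | setVar x e σ =>
    refine ⟨fun y hy => ?_, fun _ _ => rfl, fun _ _ => rfl⟩
    simp only [Prog.vars, List.mem_singleton] at hy
    simp [hy]
  | setNat a k e σ =>
    refine ⟨fun _ _ => rfl, fun y hy => ?_, fun _ _ => rfl⟩
    simp only [Prog.nats, List.mem_singleton] at hy
    simp [hy]
  | setReal a k p σ =>
    refine ⟨fun _ _ => rfl, fun _ _ => rfl, fun y hy => ?_⟩
    simp only [Prog.reals, List.mem_singleton] at hy
    simp [hy]
  | seq _ _ f g =>
    constructor <;> intro x hx <;>
      simp only [Prog.vars, Prog.nats, Prog.reals, List.mem_append, not_or] at hx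
    · rw [g.var x hx.2, f.var x hx.1]
    · rw [g.nat x hx.2, f.nat x hx.1]
    · rw [g.real x hx.2, f.real x hx.1]
  | iteTrue _ _ f =>
    constructor <;> intro x hx <;>
      simp only [Prog.vars, Prog.nats, Prog.reals, List.mem_append, not_or] at hx
    exacts [f.var x hx.1, f.nat x hx.1, f.real x hx.1]
  | iteFalse _ _ f =>
    constructor <;> intro x hx <;>
      simp only [Prog.vars, Prog.nats, Prog.reals, List.mem_append, not_or] at hx
    exacts [f.var x hx.2, f.nat x hx.2, f.real x hx.2]
  | whileTrue _ _ _ f g =>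
    constructor <;> intro x hx
    · rw [g.var x hx, f.var x hx]
    · rw [g.nat x hx, f.nat x hx]
    · rw [g.real x hx, f.real x hx]
  | whileFalse _ => exact ⟨fun _ _ => rfl, fun _ _ => rfl, fun _ _ => rfl⟩

theorem Prog.Frame.refl (P : Prog) (σ : State) : P.Frame σ σ :=
  ⟨fun _ _ => rfl, fun _ _ => rfl, fun _ _ => rfl⟩

theorem Prog.Frame.trans {P : Prog} {σ τ υ : State} (f : P.Frame σ τ) (g : P.Frame τ υ) :
    P.Frame σ υ :=
  ⟨fun x hx => (g.var x hx).trans (f.var x hx), fun x hx => (g.nat x hx).trans (f.nat x hx),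
    fun x hx => (g.real x hx).trans (f.real x hx)⟩

/-- Started in `σ`, the program halts after some time and with some memory that satisfy `Q`. -/
def wp (E : DataSet n d) (P : Prog) (Q : ℕ → State → Prop) (σ : State) : Prop :=
  ∃ t τ, Runs E P σ t τ ∧ Q t τ

/-- The frame is handed to the new postcondition. Specifications thus need not mention the memory
that a program leaves alone. -/
theorem wp_mono {P : Prog} {Q Q' : ℕ → State → Prop} {σ : State} (h : wp E P Q σ)
    (hQ : ∀ t τ, Q t τ → P.Frame σ τ → Q' t τ) : wp E P Q' σ := by
  obtain ⟨t, τ, hr, hq⟩ := h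
  exact ⟨t, τ, hr, hQ t τ hq hr.frame⟩

theorem wp_setVar {x : ℕ} {e : NExpr} {Q : ℕ → State → Prop} {σ : State} :
    wp E (.setVar x e) Q σ ↔ Q (e.cost + 1) (σ.setV x (e.value E σ)) := by
  constructor
  · rintro ⟨t, τ, h, hq⟩; cases h; exact hq
  · exact fun h => ⟨_, _, .setVar x e σ, h⟩

theorem wp_setNat {a : ℕ} {k e : NExpr} {Q : ℕ → State → Prop} {σ : State} :
    wp E (.setNat a k e) Q σ ↔
      Q (k.cost + e.cost + 1) (σ.setN a (k.value E σ) (e.value E σ)) := by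
  constructor
  · rintro ⟨t, τ, h, hq⟩; cases h; exact hq
  · exact fun h => ⟨_, _, .setNat a k e σ, h⟩

theorem wp_setReal {a : ℕ} {k : NExpr} {p : RExpr} {Q : ℕ → State → Prop} {σ : State} :
    wp E (.setReal a k p) Q σ ↔
      Q (k.cost + p.cost + 1) (σ.setR a (k.value E σ) (p.value E σ)) := by
  constructor
  · rintro ⟨t, τ, h, hq⟩; cases h; exact hq
  · exact fun h => ⟨_, _, .setReal a k p σ, h⟩

theorem wp_seq {P P' : Prog} {Q : ℕ → State → Prop} {σ : State} :
    wp E (P ;; P') Q σ ↔ wp E P (fun t τ => wp E P' (fun t' υ => Q (t + t') υ) τ) σ := by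
  constructor
  · rintro ⟨t, τ, h, hq⟩
    cases h with
    | seq h1 h2 => exact ⟨_, _, h1, _, _, h2, hq⟩
  · rintro ⟨t, τ, h1, t', υ, h2, hq⟩
    exact ⟨_, _, .seq h1 h2, hq⟩

theorem wp_ite {b : Test} {P P' : Prog} {Q : ℕ → State → Prop} {σ : State} :
    wp E (.ite b P P') Q σ ↔
      (b.Holds E σ → wp E P (fun t τ => Q (b.cost + t + 1) τ) σ) ∧
        (¬ b.Holds E σ → wp E P' (fun t τ => Q (b.cost + t + 1) τ) σ) := by
  constructor
  · rintro ⟨t, τ, h, hq⟩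
    cases h with
    | iteTrue hb h => exact ⟨fun _ => ⟨_, _, h, hq⟩, fun h' => absurd hb h'⟩
    | iteFalse hb h => exact ⟨fun h' => absurd h' hb, fun _ => ⟨_, _, h, hq⟩⟩
  · rintro ⟨h1, h2⟩
    by_cases hb : b.Holds E σ
    · obtain ⟨t, τ, h, hq⟩ := h1 hb
      exact ⟨_, _, .iteTrue hb h, hq⟩
    · obtain ⟨t, τ, h, hq⟩ := h2 hb
      exact ⟨_, _, .iteFalse hb h, hq⟩

/-- Peels off a single iteration, for the induction on the depth in `wp_build`, where no loop
invariant is convenient. -/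
theorem wp_while_unfold {b : Test} {P : Prog} {Q : ℕ → State → Prop} {σ : State} :
    wp E (.while b P) Q σ ↔
      (b.Holds E σ → wp E P (fun t τ =>
        wp E (.while b P) (fun t' υ => Q (b.cost + t + t' + 1) υ) τ) σ) ∧
      (¬ b.Holds E σ → Q (b.cost + 1) σ) := by
  constructor
  · rintro ⟨t, τ, h, hq⟩
    cases h with
    | whileTrue hb h1 h2 => exact ⟨fun _ => ⟨_, _, h1, _, _, h2, hq⟩, fun h' => absurd hb h'⟩
    | whileFalse hb => exact ⟨fun h' => absurd h' hb, fun _ => hq⟩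
  · rintro ⟨h1, h2⟩
    by_cases hb : b.Holds E σ
    · obtain ⟨t, τ, h, t', υ, h', hq⟩ := h1 hb
      exact ⟨_, _, .whileTrue hb h h', hq⟩
    · exact ⟨_, _, .whileFalse hb, h2 hb⟩

/-- Rule for loops. The invariant `I` also speaks about the time spent so far; `μ` decreases. -/
theorem wp_while {b : Test} {P : Prog} {Q : ℕ → State → Prop} {σ : State}
    (I : ℕ → State → Prop) (μ : State → ℕ) (h0 : I 0 σ)
    (hstep : ∀ T τ, P.Frame σ τ → I T τ → b.Holds E τ →
      wp E P (fun t υ => I (T + (b.cost + t + 1)) υ ∧ μ υ < μ τ) τ)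
    (hend : ∀ T τ, P.Frame σ τ → I T τ → ¬ b.Holds E τ → Q (T + (b.cost + 1)) τ) :
    wp E (.while b P) Q σ := by
  suffices H : ∀ (m T : ℕ) (τ : State), P.Frame σ τ → μ τ = m → I T τ →
      wp E (.while b P) (fun t υ => Q (T + t) υ) τ by
    simpa using H _ 0 σ (.refl P σ) rfl h0
  intro m
  induction m using Nat.strong_induction_on with
  | _ m ih =>
    intro T τ hf hm hI
    by_cases hb : b.Holds E τ
    · obtain ⟨t, υ, h, hI', hμ⟩ := hstep T τ hf hI hb
      obtain ⟨t', υ', h', hq⟩ := ih _ (hm ▸ hμ) _ υ (hf.trans h.frame) rfl hI'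
      refine ⟨_, _, .whileTrue hb h h', ?_⟩
      convert hq using 1
      omega
    · exact ⟨_, _, .whileFalse hb, hend T τ hf hI hb⟩

/-- Rule for loops that make exactly `N` iterations of time at most `c`. -/
theorem wp_for {b : Test} {P : Prog} {σ : State} (I : ℕ → State → Prop) (N c : ℕ) (h0 : I 0 σ)
    (hstep : ∀ k τ, k < N → P.Frame σ τ → I k τ →
      b.Holds E τ ∧ wp E P (fun t υ => t ≤ c ∧ I (k + 1) υ) τ)
    (hend : ∀ τ, P.Frame σ τ → I N τ → ¬ b.Holds E τ) :
    wp E (.while b P) (fun t τ => t ≤ N * (c + b.cost + 1) + b.cost + 1 ∧ I N τ) σ := by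
  suffices H : ∀ (m k : ℕ) (τ : State), k + m = N → P.Frame σ τ → I k τ →
      wp E (.while b P) (fun t τ => t ≤ m * (c + b.cost + 1) + b.cost + 1 ∧ I N τ) τ by
    exact H N 0 σ (by omega) (.refl P σ) h0
  intro m
  induction m with
  | zero =>
    intro k τ hk hf hI
    obtain rfl : k = N := by omega
    exact ⟨_, _, .whileFalse (hend τ hf hI), by omega, hI⟩
  | succ m ih =>
    intro k τ hk hf hI
    obtain ⟨hb, t, υ, h, ht, hI'⟩ := hstep k τ (by omega) hf hI
    obtain ⟨t', υ', h', ht', hq⟩ := ih (k + 1) υ (by omega) (hf.trans h.frame) hI'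
    refine ⟨_, _, .whileTrue hb h h', ?_, hq⟩
    rw [Nat.succ_mul]
    omega

theorem value_label {σ : State} {e : NExpr} {a : Fin n} (h : e.value E σ = a) :
    (NExpr.label e).value E σ = if E.label a then 1 else 0 := by
  simp only [NExpr.value, h, a.isLt, dif_pos]

theorem value_input {σ : State} {e i : NExpr} {a : Fin n} {j : Fin d} (he : e.value E σ = a)
    (hi : i.value E σ = j) : (RExpr.input e i).value E σ = E.ex a j := by
  simp only [RExpr.value, he, hi, a.isLt, j.isLt, and_self, dif_pos]

end

/-! ### Witness trees, refinement and the insertion of cuts -/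

/-- Decision trees whose leaves carry an example, the witness, instead of a class. -/
inductive WTree (n d : ℕ) where
  | leaf (w : Fin n) : WTree n d
  | node (i : Fin d) (t : ℝ) (l r : WTree n d) : WTree n d

namespace WTree

variable {n d : ℕ} (E : DataSet n d)

/-- The number of inner vertices. -/
def size : WTree n d → ℕ
  | leaf _ => 0
  | node _ _ l r => l.size + r.size + 1

/-- The decision tree in which each leaf has the class of its witness. -/
def toTree : WTree n d → DecisionTree d
  | leaf w => .leaf (E.label w)
  | node i t l r => .node i t l.toTree r.toTree

/-- The witness of the leaf that `x` reaches. -/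
noncomputable def leafOf : WTree n d → (Fin d → ℝ) → Fin n
  | leaf w, _ => w
  | node i t l r, x => if x i ≤ t then l.leafOf x else r.leafOf x

/-- `w` is the witness of some leaf. -/
def HasWit : WTree n d → Fin n → Prop
  | leaf w, v => v = w
  | node _ _ l r, v => l.HasWit v ∨ r.HasWit v

/-- Every witness reaches its own leaf. -/
def Consistent : WTree n d → Prop
  | leaf _ => True
  | node i t l r => (∀ w, l.HasWit w → E.ex w i ≤ t) ∧ (∀ w, r.HasWit w → t < E.ex w i) ∧
      l.Consistent ∧ r.Consistent

/-- `Ref E R T`: the tree `T` arises from `R` by inserting vertices that have all witnesses of the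
subtree below them on the same side, and by replacing leaves with arbitrary trees. -/
inductive Ref : WTree n d → DecisionTree d → Prop
  | leaf (w : Fin n) (T : DecisionTree d) : Ref (.leaf w) T
  | node {i : Fin d} {t : ℝ} {l r : WTree n d} {l' r' : DecisionTree d} :
      Ref l l' → Ref r r' → Ref (.node i t l r) (.node i t l' r')
  | left {R : WTree n d} {j : Fin d} {u : ℝ} {l' r' : DecisionTree d} :
      Ref R l' → (∀ w, R.HasWit w → E.ex w j ≤ u) → Ref R (.node j u l' r')
  | right {R : WTree n d} {j : Fin d} {u : ℝ} {l' r' : DecisionTree d} :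
      Ref R r' → (∀ w, R.HasWit w → u < E.ex w j) → Ref R (.node j u l' r')

/-- Insert the cut `(i, t)` above the vertex of depth `p` on the path of the example `e`. The
example `e` becomes the witness of a new leaf. -/
noncomputable def insAt (i : Fin d) (t : ℝ) (e : Fin n) : ℕ → WTree n d → WTree n d
  | 0, R => if E.ex e i ≤ t then .node i t (.leaf e) R else .node i t R (.leaf e)
  -- A default value: the depths in `cand` never point below the leaf.
  | _ + 1, leaf w => .leaf w
  | p + 1, node j u l r =>
      if E.ex e j ≤ u then .node j u (insAt i t e p l) r else .node j u l (insAt i t e p r)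

/-- The depths on the path of `e` above which a new vertex may be inserted: that of the leaf, and
those of the inner vertices whose child off the path contains an example of `D`. -/
noncomputable def cand : WTree n d → Finset (Fin n) → Fin n → List ℕ
  | leaf _, _, _ => [0]
  | node j u l r, D, e =>
      if E.ex e j ≤ u then
        (if ∃ a ∈ D, u < E.ex a j then [0] else []) ++
          (cand l (D.filter fun a => E.ex a j ≤ u) e).map (· + 1)
      else
        (if ∃ a ∈ D, E.ex a j ≤ u then [0] else []) ++
          (cand r (D.filter fun a => u < E.ex a j) e).map (· + 1)

/-- The cut `(i, t)` separates the examples `e` and `w`. -/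
def SepCut (e w : Fin n) (i : Fin d) (t : ℝ) : Prop :=
  (E.ex e i ≤ t ∧ t < E.ex w i) ∨ (E.ex w i ≤ t ∧ t < E.ex e i)

variable {E}

theorem classOf_toTree (R : WTree n d) (x : Fin d → ℝ) :
    (R.toTree E).classOf x = E.label (R.leafOf x) := by
  induction R with
  | leaf w => rfl
  | node i t l r ihl ihr =>
    simp only [toTree, DecisionTree.classOf, leafOf]
    split_ifs <;> assumption

theorem size_toTree (R : WTree n d) : (R.toTree E).size = R.size := by
  induction R with
  | leaf w => rfl
  | node i t l r ihl ihr => simp only [toTree, DecisionTree.size, size, ihl, ihr]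

theorem hasWit_leafOf (R : WTree n d) (x : Fin d → ℝ) : R.HasWit (R.leafOf x) := by
  induction R with
  | leaf w => rfl
  | node i t l r ihl ihr =>
    simp only [leafOf, HasWit]
    split_ifs
    exacts [.inl ihl, .inr ihr]

theorem ref_toTree (R : WTree n d) : Ref E R (R.toTree E) := by
  induction R with
  | leaf w => exact .leaf _ _
  | node i t l r ihl ihr => exact .node ihl ihr

/-- Every inner vertex of `R` survives in `T`. This bounds the size of a tree from which solutions
can still be reached, and makes it harmless to put a subtree of `R` in place of what refines it. -/
theorem Ref.size_le {R : WTree n d} {T : DecisionTree d} (h : Ref E R T) : R.size ≤ T.size := by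
  induction h <;> simp only [WTree.size, DecisionTree.size] <;> omega

/-- The inner vertices of `R` occur in `T` with their cuts, so `R` inherits admissible thresholds
from `T`. -/
theorem Ref.cutsIn {Thr : Fin d → Finset ℝ} {R : WTree n d} {T : DecisionTree d}
    (h : Ref E R T) (hT : T.CutsIn Thr) : (R.toTree E).CutsIn Thr := by
  induction h with
  | leaf => trivial
  | node _ _ ihl ihr => exact ⟨hT.1, ihl hT.2.1, ihr hT.2.2⟩
  | left _ _ ih => exact ih hT.2.1
  | right _ _ ih => exact ih hT.2.2

theorem hasWit_insAt {i : Fin d} {t : ℝ} {e v : Fin n} {p : ℕ} {R : WTree n d}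
    (h : (R.insAt E i t e p).HasWit v) : R.HasWit v ∨ v = e := by
  induction R generalizing p with
  | leaf w =>
    cases p with
    | zero => simp only [insAt] at h; split_ifs at h <;> (simp only [HasWit] at h ⊢; tauto)
    | succ p => exact .inl h
  | node j u l r ihl ihr =>
    cases p with
    | zero => simp only [insAt] at h; split_ifs at h <;> (simp only [HasWit] at h ⊢; tauto)
    | succ p =>
      simp only [insAt] at h
      split_ifs at h <;> simp only [HasWit] at h ⊢
      · rcases h with h | h
        · rcases ihl h with h | h <;> tauto
        · tauto
      · rcases h with h | h
        · tauto
        · rcases ihr h with h | h <;> tauto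

/-- The membership excludes depths below the leaf, where `insAt` does nothing. -/
theorem size_insAt {i : Fin d} {t : ℝ} {e : Fin n} {p : ℕ} {R : WTree n d} {D : Finset (Fin n)}
    (h : p ∈ R.cand E D e) : (R.insAt E i t e p).size = R.size + 1 := by
  induction R generalizing p D with
  | leaf w =>
    simp only [cand, List.mem_singleton] at h
    subst h
    simp only [insAt]
    split_ifs <;> rfl
  | node j u l r ihl ihr =>
    cases p with
    | zero =>
      simp only [insAt]
      split_ifs <;> grind [size]
    | succ p =>
      simp only [cand] at h
      simp only [insAt]
      by_cases hj : E.ex e j ≤ u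
      · rw [if_pos hj] at h ⊢
        have : p ∈ l.cand E (D.filter fun a => E.ex a j ≤ u) e := by
          split_ifs at h <;> simpa using h
        simp only [size, ihl this]
        omega
      · rw [if_neg hj] at h ⊢
        have : p ∈ r.cand E (D.filter fun a => u < E.ex a j) e := by
          split_ifs at h <;> simpa using h
        simp only [size, ihr this]
        omega

/-- The left child of a refined inner vertex absorbs the vertices inserted above. -/
theorem Ref.absorb_left {Thr : Fin d → Finset ℝ} {i : Fin d} {t : ℝ} {l r : WTree n d}
    {T : DecisionTree d} (h : Ref E (.node i t l r) T) (hT : T.CutsIn Thr) :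
    ∃ T', Ref E l T' ∧ T'.size + r.size + 1 ≤ T.size ∧ T'.CutsIn Thr ∧
      ∀ x, x i ≤ t → T'.classOf x = T.classOf x := by
  induction T with
  | leaf => cases h
  | node j u l' r' ihl ihr =>
    cases h with
    | node hl hr =>
      refine ⟨l', hl, ?_, hT.2.1, fun x hx => ?_⟩
      · have := hr.size_le
        simp only [DecisionTree.size]
        omega
      · simp only [DecisionTree.classOf, if_pos hx]
    | left hR hw =>
      obtain ⟨T', h1, h2, h3, h4⟩ := ihl hR hT.2.1
      refine ⟨.node j u T' r', .left h1 fun w hw' => hw w (.inl hw'), ?_, ⟨hT.1, h3, hT.2.2⟩,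
        fun x hx => ?_⟩
      · simp only [DecisionTree.size]; omega
      · simp only [DecisionTree.classOf, h4 x hx]
    | right hR hw =>
      obtain ⟨T', h1, h2, h3, h4⟩ := ihr hR hT.2.2
      refine ⟨.node j u l' T', .right h1 fun w hw' => hw w (.inl hw'), ?_, ⟨hT.1, hT.2.1, h3⟩,
        fun x hx => ?_⟩
      · simp only [DecisionTree.size]; omega
      · simp only [DecisionTree.classOf, h4 x hx]

/-- The right child of a refined inner vertex absorbs the vertices inserted above. -/
theorem Ref.absorb_right {Thr : Fin d → Finset ℝ} {i : Fin d} {t : ℝ} {l r : WTree n d}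
    {T : DecisionTree d} (h : Ref E (.node i t l r) T) (hT : T.CutsIn Thr) :
    ∃ T', Ref E r T' ∧ T'.size + l.size + 1 ≤ T.size ∧ T'.CutsIn Thr ∧
      ∀ x, ¬ x i ≤ t → T'.classOf x = T.classOf x := by
  induction T with
  | leaf => cases h
  | node j u l' r' ihl ihr =>
    cases h with
    | node hl hr =>
      refine ⟨r', hr, ?_, hT.2.2, fun x hx => ?_⟩
      · have := hl.size_le
        simp only [DecisionTree.size]
        omega
      · simp only [DecisionTree.classOf, if_neg hx]
    | left hR hw =>
      obtain ⟨T', h1, h2, h3, h4⟩ := ihl hR hT.2.1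
      refine ⟨.node j u T' r', .left h1 fun w hw' => hw w (.inr hw'), ?_, ⟨hT.1, h3, hT.2.2⟩,
        fun x hx => ?_⟩
      · simp only [DecisionTree.size]; omega
      · simp only [DecisionTree.classOf, h4 x hx]
    | right hR hw =>
      obtain ⟨T', h1, h2, h3, h4⟩ := ihr hR hT.2.2
      refine ⟨.node j u l' T', .right h1 fun w hw' => hw w (.inr hw'), ?_, ⟨hT.1, hT.2.1, h3⟩,
        fun x hx => ?_⟩
      · simp only [DecisionTree.size]; omega
      · simp only [DecisionTree.classOf, h4 x hx]

/-- `T` classifies the examples in `S` and only uses thresholds of `E`. -/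
def Fits (E : DataSet n d) (S : Set (Fin n)) (T : DecisionTree d) : Prop :=
  T.CutsIn E.thresholds ∧ ∀ a ∈ S, T.classOf (E.ex a) = E.label a

/-- Some tree that classifies `S` and has size at most `s` refines the result of inserting a
vertex above one of the candidates. -/
def Extends (E : DataSet n d) (R : WTree n d) (D : Finset (Fin n)) (e : Fin n) (S : Set (Fin n))
    (s : ℕ) : Prop :=
  ∃ (i : Fin d) (t : ℝ) (p : ℕ) (T : DecisionTree d), p ∈ R.cand E D e ∧
    SepCut E e (R.leafOf (E.ex e)) i t ∧ (R.insAt E i t e p).Consistent E ∧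
    Ref E (R.insAt E i t e p) T ∧ T.size ≤ s ∧ Fits E S T

theorem Fits.left {S : Set (Fin n)} {j : Fin d} {u : ℝ} {l r : DecisionTree d}
    (h : Fits E S (.node j u l r)) : Fits E {a ∈ S | E.ex a j ≤ u} l :=
  ⟨h.1.2.1, fun a ha => by simpa only [DecisionTree.classOf, if_pos ha.2] using h.2 a ha.1⟩

theorem Fits.right {S : Set (Fin n)} {j : Fin d} {u : ℝ} {l r : DecisionTree d}
    (h : Fits E S (.node j u l r)) : Fits E {a ∈ S | u < E.ex a j} r :=
  ⟨h.1.2.2, fun a ha => by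
    simpa only [DecisionTree.classOf, if_neg (not_le.2 ha.2)] using h.2 a ha.1⟩

theorem Fits.node {S : Set (Fin n)} {j : Fin d} {u : ℝ} {l r : DecisionTree d}
    (hu : u ∈ E.thresholds j) (hl : Fits E {a ∈ S | E.ex a j ≤ u} l)
    (hr : Fits E {a ∈ S | u < E.ex a j} r) : Fits E S (.node j u l r) := by
  refine ⟨⟨hu, hl.1, hr.1⟩, fun a ha => ?_⟩
  simp only [DecisionTree.classOf]
  split_ifs with h
  exacts [hl.2 a ⟨ha, h⟩, hr.2 a ⟨ha, not_le.1 h⟩]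

/-- If the root of `T` sends `e` and all witnesses to the same side, an insertion found in that
subtree of `T` serves for `T` too: the root is put back as an inserted vertex, which leaves the
depth in `R` as it is. -/
theorem Extends.of_left {R : WTree n d} {D : Finset (Fin n)} {e : Fin n} {S : Set (Fin n)}
    {j : Fin d} {u : ℝ} {l r : DecisionTree d} (hT : Fits E S (.node j u l r))
    (hw : ∀ w, R.HasWit w → E.ex w j ≤ u) (he : E.ex e j ≤ u)
    (h : Extends E R D e {a ∈ S | E.ex a j ≤ u} l.size) :
    Extends E R D e S (DecisionTree.node j u l r).size := by
  obtain ⟨i, t, p, T, h1, h2, h3, h4, h5, h6⟩ := h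
  refine ⟨i, t, p, .node j u T r, h1, h2, h3, .left h4 fun v hv => ?_, ?_,
    .node hT.1.1 h6 hT.right⟩
  · rcases hasWit_insAt hv with hv | rfl
    exacts [hw v hv, he]
  · simp only [DecisionTree.size]; omega

theorem Extends.of_right {R : WTree n d} {D : Finset (Fin n)} {e : Fin n} {S : Set (Fin n)}
    {j : Fin d} {u : ℝ} {l r : DecisionTree d} (hT : Fits E S (.node j u l r))
    (hw : ∀ w, R.HasWit w → u < E.ex w j) (he : u < E.ex e j)
    (h : Extends E R D e {a ∈ S | u < E.ex a j} r.size) :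
    Extends E R D e S (DecisionTree.node j u l r).size := by
  obtain ⟨i, t, p, T, h1, h2, h3, h4, h5, h6⟩ := h
  refine ⟨i, t, p, .node j u l T, h1, h2, h3, .right h4 fun v hv => ?_, ?_,
    .node hT.1.1 hT.left h6⟩
  · rcases hasWit_insAt hv with hv | rfl
    exacts [hw v hv, he]
  · simp only [DecisionTree.size]; omega

/-- If `e` leaves the witnesses at the root of `T`, the cut of the root is inserted. -/
theorem Extends.of_separated {R : WTree n d} (hR : R.Consistent E) {D : Finset (Fin n)}
    {e : Fin n} {S : Set (Fin n)} {j : Fin d} {u : ℝ} {l r : DecisionTree d}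
    (hT : Fits E S (.node j u l r)) (h0 : 0 ∈ R.cand E D e)
    (h : (Ref E R l ∧ (∀ w, R.HasWit w → E.ex w j ≤ u) ∧ u < E.ex e j) ∨
      (Ref E R r ∧ (∀ w, R.HasWit w → u < E.ex w j) ∧ E.ex e j ≤ u)) :
    Extends E R D e S (DecisionTree.node j u l r).size := by
  refine ⟨j, u, 0, _, h0, ?_, ?_, ?_, le_rfl, hT⟩
  · rcases h with ⟨-, h1, h2⟩ | ⟨-, h1, h2⟩
    · exact .inr ⟨h1 _ (hasWit_leafOf _ _), h2⟩
    · exact .inl ⟨h2, h1 _ (hasWit_leafOf _ _)⟩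
  · rcases h with ⟨-, h1, h2⟩ | ⟨-, h1, h2⟩
    · simp only [insAt, if_neg (not_le.2 h2)]
      exact ⟨h1, fun w hw => by rw [show w = e from hw]; exact h2, hR, trivial⟩
    · simp only [insAt, if_pos h2]
      exact ⟨fun w hw => by rw [show w = e from hw]; exact h2, h1, trivial, hR⟩
  · rcases h with ⟨h0, h1, h2⟩ | ⟨h0, h1, h2⟩
    · simp only [insAt, if_neg (not_le.2 h2)]
      exact .node h0 (.leaf _ _)
    · simp only [insAt, if_pos h2]
      exact .node (.leaf _ _) h0

/-- If an example of `S` reaches a leaf of `R` of the other class, then each tree that refines `R`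
and classifies `S` yields one that refines an insertion above a candidate. Here the examples of
`S` outside `D` have the class of the leaf of `R` that they reach. -/
theorem ref_extends {R : WTree n d} (hR : R.Consistent E) {D : Finset (Fin n)} {S : Set (Fin n)}
    {T : DecisionTree d} (href : Ref E R T) (hT : Fits E S T)
    (hD : ∀ a ∈ S, a ∉ D → E.label (R.leafOf (E.ex a)) = E.label a) {e : Fin n} (he : e ∈ S)
    (hw : R.leafOf (E.ex e) ∈ S) (hne : E.label (R.leafOf (E.ex e)) ≠ E.label e) :
    Extends E R D e S T.size := by
  induction R generalizing D S T with
  | leaf w =>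
    -- Any tree refines a leaf, so only `T` matters. Descend in `T` as long as `e` and the witness
    -- go together; they part before a leaf because their classes differ.
    clear hD href
    simp only [leafOf] at hw hne
    induction T generalizing S with
    | leaf c =>
      refine absurd ?_ hne
      rw [← hT.2 w hw, ← hT.2 e he]
      rfl
    | node j u l r ihl ihr =>
      have h0 : 0 ∈ (leaf w : WTree n d).cand E D e := by simp [cand]
      by_cases hwj : E.ex w j ≤ u <;> by_cases hej : E.ex e j ≤ u
      · exact .of_left hT (fun v hv => by rw [show v = w from hv]; exact hwj) hej
          (ihl hT.left ⟨he, hej⟩ ⟨hw, hwj⟩)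
      · exact .of_separated hR hT h0 (.inl ⟨.leaf _ _,
          fun v hv => by rw [show v = w from hv]; exact hwj, not_le.1 hej⟩)
      · exact .of_separated hR hT h0 (.inr ⟨.leaf _ _,
          fun v hv => by rw [show v = w from hv]; exact not_le.1 hwj, hej⟩)
      · exact .of_right hT (fun v hv => by rw [show v = w from hv]; exact not_le.1 hwj)
          (not_le.1 hej) (ihr hT.right ⟨he, not_le.1 hej⟩ ⟨hw, not_le.1 hwj⟩)
  | node i t l r ihl ihr =>
    by_cases hei : E.ex e i ≤ t
    · have hleaf : (node i t l r).leafOf (E.ex e) = l.leafOf (E.ex e) := by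
        simp only [leafOf, if_pos hei]
      have hwi : E.ex (l.leafOf (E.ex e)) i ≤ t := hR.1 _ (hasWit_leafOf _ _)
      -- The root of `R` is the root of the refining tree: recurse into the child that `e` enters,
      -- which shifts the depth by one. The set `S'` is kept general because the inner induction
      -- below restricts `S` each time it passes a cut.
      have matched : ∀ {S' : Set (Fin n)} {l' r' : DecisionTree d}, S' ⊆ S → e ∈ S' →
          (node i t l r).leafOf (E.ex e) ∈ S' → Ref E l l' → Ref E r r' →
          Fits E S' (.node i t l' r') →
          Extends E (.node i t l r) D e S' (DecisionTree.node i t l' r').size := by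
        intro S' l' r' hS' he' hw' hl hr hT'
        obtain ⟨j, u, p, T', h1, h2, h3, h4, h5, h6⟩ :=
          ihl hR.2.2.1 (D := D.filter fun a => E.ex a i ≤ t) hl hT'.left
            (fun a ha hna => by
              have := hD a (hS' ha.1) (fun h => hna (Finset.mem_filter.2 ⟨h, ha.2⟩))
              simpa only [leafOf, if_pos ha.2] using this)
            ⟨he', hei⟩ ⟨hleaf ▸ hw', hwi⟩ (hleaf ▸ hne)
        refine ⟨j, u, p + 1, .node i t T' r', ?_, ?_, ?_, ?_, ?_, ?_⟩
        · simp only [cand, if_pos hei, List.mem_append, List.mem_map]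
          exact .inr ⟨p, h1, rfl⟩
        · rwa [hleaf]
        · simp only [insAt, if_pos hei]
          refine ⟨fun v hv => ?_, hR.2.1, h3, hR.2.2.2⟩
          rcases hasWit_insAt hv with hv | rfl
          exacts [hR.1 v hv, hei]
        · simp only [insAt, if_pos hei]
          exact .node h4 hr
        · simp only [DecisionTree.size]; omega
        · exact .node hT'.1.1 h6 hT'.right
      -- If some example of `D` goes to the other child, depth `0` is a candidate. Pass the cuts
      -- that `T` has above the root of `R` until one separates `e` from all witnesses, to be
      -- inserted at depth `0`, or until the root is matched.
      by_cases hd : ∃ a ∈ D, t < E.ex a i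
      · have h0 : 0 ∈ (node i t l r).cand E D e := by simp [cand, if_pos hei, if_pos hd]
        suffices H : ∀ T S', S' ⊆ S → e ∈ S' → (node i t l r).leafOf (E.ex e) ∈ S' →
            Ref E (.node i t l r) T → Fits E S' T → Extends E (.node i t l r) D e S' T.size from
          H T S subset_rfl he hw href hT
        clear href hT T
        intro T
        induction T with
        | leaf => intro S' _ _ _ href; cases href
        | node j u l' r' ihl' ihr' =>
          intro S' hS' he' hw' href hT'
          cases href with
          | node hl hr => exact matched hS' he' hw' hl hr hT'
          | left hRef hwit =>
            by_cases hej : E.ex e j ≤ u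
            · exact .of_left hT' hwit hej (ihl' _ (fun a ha => hS' ha.1) ⟨he', hej⟩
                ⟨hw', hwit _ (hasWit_leafOf _ _)⟩ hRef hT'.left)
            · exact .of_separated hR hT' h0 (.inl ⟨hRef, hwit, not_le.1 hej⟩)
          | right hRef hwit =>
            by_cases hej : E.ex e j ≤ u
            · exact .of_separated hR hT' h0 (.inr ⟨hRef, hwit, hej⟩)
            · exact .of_right hT' hwit (not_le.1 hej) (ihr' _ (fun a ha => hS' ha.1)
                ⟨he', not_le.1 hej⟩ ⟨hw', hwit _ (hasWit_leafOf _ _)⟩ hRef hT'.right)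
      -- Depth `0` is not a candidate here. Change `T` instead: its cuts above the root move into
      -- the left subtree `T'`, and `r.toTree E` becomes the right subtree. By `hD` it is correct on
      -- all examples of `S` there, and the size does not grow.
      · obtain ⟨T', g1, g2, g3, g4⟩ := href.absorb_left hT.1
        have hr := (href.cutsIn hT.1)
        have := matched (S' := S) (l' := T') (r' := r.toTree E) subset_rfl he hw g1 (ref_toTree r)
          (.node hr.1 ⟨g3, fun a ha => by rw [g4 _ ha.2, hT.2 a ha.1]⟩
            ⟨hr.2.2, fun a ha => by
              rw [classOf_toTree]
              have h := hD a ha.1 (fun h => hd ⟨a, h, ha.2⟩)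
              simpa only [leafOf, if_neg (not_le.2 ha.2)] using h⟩)
        obtain ⟨j, u, p, T', h1, h2, h3, h4, h5, h6⟩ := this
        refine ⟨j, u, p, T', h1, h2, h3, h4, h5.trans ?_, h6⟩
        simp only [DecisionTree.size, size_toTree]
        omega
    -- The mirror image, with `e` going to the right.
    · have hei' := not_le.1 hei
      have hleaf : (node i t l r).leafOf (E.ex e) = r.leafOf (E.ex e) := by
        simp only [leafOf, if_neg hei]
      have hwi : t < E.ex (r.leafOf (E.ex e)) i := hR.2.1 _ (hasWit_leafOf _ _)
      have matched : ∀ {S' : Set (Fin n)} {l' r' : DecisionTree d}, S' ⊆ S → e ∈ S' →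
          (node i t l r).leafOf (E.ex e) ∈ S' → Ref E l l' → Ref E r r' →
          Fits E S' (.node i t l' r') →
          Extends E (.node i t l r) D e S' (DecisionTree.node i t l' r').size := by
        intro S' l' r' hS' he' hw' hl hr hT'
        obtain ⟨j, u, p, T', h1, h2, h3, h4, h5, h6⟩ :=
          ihr hR.2.2.2 (D := D.filter fun a => t < E.ex a i) hr hT'.right
            (fun a ha hna => by
              have := hD a (hS' ha.1) (fun h => hna (Finset.mem_filter.2 ⟨h, ha.2⟩))
              simpa only [leafOf, if_neg (not_le.2 ha.2)] using this)
            ⟨he', hei'⟩ ⟨hleaf ▸ hw', hwi⟩ (hleaf ▸ hne)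
        refine ⟨j, u, p + 1, .node i t l' T', ?_, ?_, ?_, ?_, ?_, ?_⟩
        · simp only [cand, if_neg hei, List.mem_append, List.mem_map]
          exact .inr ⟨p, h1, rfl⟩
        · rwa [hleaf]
        · simp only [insAt, if_neg hei]
          refine ⟨hR.1, fun v hv => ?_, hR.2.2.1, h3⟩
          rcases hasWit_insAt hv with hv | rfl
          exacts [hR.2.1 v hv, hei']
        · simp only [insAt, if_neg hei]
          exact .node hl h4
        · simp only [DecisionTree.size]; omega
        · exact .node hT'.1.1 hT'.left h6
      by_cases hd : ∃ a ∈ D, E.ex a i ≤ t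
      · have h0 : 0 ∈ (node i t l r).cand E D e := by simp [cand, if_neg hei, if_pos hd]
        suffices H : ∀ T S', S' ⊆ S → e ∈ S' → (node i t l r).leafOf (E.ex e) ∈ S' →
            Ref E (.node i t l r) T → Fits E S' T → Extends E (.node i t l r) D e S' T.size from
          H T S subset_rfl he hw href hT
        clear href hT T
        intro T
        induction T with
        | leaf => intro S' _ _ _ href; cases href
        | node j u l' r' ihl' ihr' =>
          intro S' hS' he' hw' href hT'
          cases href with
          | node hl hr => exact matched hS' he' hw' hl hr hT'
          | left hRef hwit =>
            by_cases hej : E.ex e j ≤ u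
            · exact .of_left hT' hwit hej (ihl' _ (fun a ha => hS' ha.1) ⟨he', hej⟩
                ⟨hw', hwit _ (hasWit_leafOf _ _)⟩ hRef hT'.left)
            · exact .of_separated hR hT' h0 (.inl ⟨hRef, hwit, not_le.1 hej⟩)
          | right hRef hwit =>
            by_cases hej : E.ex e j ≤ u
            · exact .of_separated hR hT' h0 (.inr ⟨hRef, hwit, hej⟩)
            · exact .of_right hT' hwit (not_le.1 hej) (ihr' _ (fun a ha => hS' ha.1)
                ⟨he', not_le.1 hej⟩ ⟨hw', hwit _ (hasWit_leafOf _ _)⟩ hRef hT'.right)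
      · obtain ⟨T', g1, g2, g3, g4⟩ := href.absorb_right hT.1
        have hl := (href.cutsIn hT.1)
        have := matched (S' := S) (l' := l.toTree E) (r' := T') subset_rfl he hw (ref_toTree l) g1
          (.node hl.1 ⟨hl.2.1, fun a ha => by
              rw [classOf_toTree]
              have h := hD a ha.1 (fun h => hd ⟨a, h, ha.2⟩)
              simpa only [leafOf, if_pos ha.2] using h⟩
            ⟨g3, fun a ha => by rw [g4 _ (not_le.2 ha.2), hT.2 a ha.1]⟩)
        obtain ⟨j, u, p, T', h1, h2, h3, h4, h5, h6⟩ := this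
        refine ⟨j, u, p, T', h1, h2, h3, h4, h5.trans ?_, h6⟩
        simp only [DecisionTree.size, size_toTree]
        omega

/-- One of the two separated examples lies strictly above `t`, so `t` is not the largest value. -/
theorem mem_thresholds_of_sepCut {e w : Fin n} {i : Fin d} {t : ℝ} (h : SepCut E e w i t)
    (ht : t ∈ E.dom i) : t ∈ E.thresholds i := by
  refine Finset.mem_filter.2 ⟨ht, ?_⟩
  rcases h with h | h
  exacts [⟨w, h.2⟩, ⟨e, h.2⟩]

theorem cutsIn_insAt {Thr : Fin d → Finset ℝ} {i : Fin d} {t : ℝ} (ht : t ∈ Thr i) {e : Fin n}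
    {p : ℕ} {R : WTree n d} (hR : (R.toTree E).CutsIn Thr) :
    ((R.insAt E i t e p).toTree E).CutsIn Thr := by
  induction R generalizing p with
  | leaf w =>
    cases p with
    | zero =>
      simp only [insAt]
      split_ifs <;> exact ⟨ht, trivial, trivial⟩
    | succ p => trivial
  | node j u l r ihl ihr =>
    cases p with
    | zero =>
      simp only [insAt]
      split_ifs
      exacts [⟨ht, trivial, hR⟩, ⟨ht, hR, trivial⟩]
    | succ p =>
      simp only [insAt]
      split_ifs
      exacts [⟨hR.1, ihl hR.2.1, hR.2.2⟩, ⟨hR.1, hR.2.1, ihr hR.2.2⟩]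

end WTree

/-! ### Existence of a solution, and asymptotics of the product of branching factors -/

/-- Every set of examples is classified by some tree. -/
theorem DataSet.exists_fits {n d : ℕ} (E : DataSet n d) (S : Finset (Fin n)) :
    ∃ T : DecisionTree d, WTree.Fits E S T := by
  induction S using Finset.strongInduction with
  | H S ih =>
    by_cases h : ∃ a ∈ S, ∃ b ∈ S, E.label a ≠ E.label b
    · obtain ⟨a, ha, b, hb, hab⟩ := h
      obtain ⟨i, hi⟩ : ∃ i, E.ex a i ≠ E.ex b i := by
        by_contra! h
        exact hab (E.consistent a b (funext h))
      wlog hlt : E.ex a i < E.ex b i generalizing a b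
      · exact this b hb a ha hab.symm hi.symm (lt_of_le_of_ne (not_lt.1 hlt) hi.symm)
      obtain ⟨l, hl⟩ := ih (S.filter fun c => E.ex c i ≤ E.ex a i)
        (Finset.filter_ssubset.2 ⟨b, hb, not_le.2 hlt⟩)
      obtain ⟨r, hr⟩ := ih (S.filter fun c => E.ex a i < E.ex c i)
        (Finset.filter_ssubset.2 ⟨a, ha, lt_irrefl _⟩)
      refine ⟨.node i (E.ex a i) l r, .node ?_ ?_ ?_⟩
      · exact Finset.mem_filter.2 ⟨Finset.mem_image.2 ⟨a, Finset.mem_univ _, rfl⟩, b, hlt⟩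
      · exact ⟨hl.1, fun c hc => hl.2 c (by simpa using hc)⟩
      · exact ⟨hr.1, fun c hc => hr.2 c (by simpa using hc)⟩
    · push Not at h
      rcases S.eq_empty_or_nonempty with rfl | ⟨a, ha⟩
      · exact ⟨.leaf true, trivial, by simp⟩
      · exact ⟨.leaf (E.label a), trivial, fun b hb => h a ha b hb⟩

theorem DataSet.exists_isMinimumTree {n d : ℕ} (E : DataSet n d) :
    ∃ T : DecisionTree d, E.IsMinimumTree T := by
  obtain ⟨T, hT⟩ := E.exists_fits Finset.univ
  have hT' : E.Classifies T := ⟨hT.1, fun a => hT.2 a (by simp)⟩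
  have hne : {T | E.Classifies T}.Nonempty := ⟨T, hT'⟩
  have hwf := (measure (DecisionTree.size (d := d))).wf
  exact ⟨hwf.min _ hne, hwf.min_mem _ hne, fun T' h => not_lt.1 (hwf.not_lt_min _ h)⟩

/-- The upper half of Stirling's formula in the weak form `s! ≤ e * s * (s / e) ^ s`. -/
theorem log_factorial_le {s : ℕ} (hs : 1 ≤ s) :
    Real.log (s.factorial : ℝ) ≤ 1 + Real.log s + s * Real.log s - s := by
  induction s, hs using Nat.le_induction with
  | base => simp
  | succ s hs ih =>
    have hs0 : (0 : ℝ) < s := by exact_mod_cast hs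
    -- This is `1 - 1/x ≤ log x` at `x = (s + 1) / s`.
    have h1 : (1 : ℝ) ≤ (s + 1) * (Real.log (s + 1) - Real.log s) := by
      rw [← Real.log_div (by positivity) (by positivity)]
      have h := Real.one_sub_inv_le_log_of_pos (x := (s + 1 : ℝ) / s) (by positivity)
      calc (1 : ℝ) = (s + 1) * (1 - ((s + 1 : ℝ) / s)⁻¹) := by field_simp; ring
        _ ≤ _ := by gcongr
    rw [Nat.factorial_succ, Nat.cast_mul, Real.log_mul (by positivity) (by positivity)]
    push_cast
    nlinarith

/-- Most factors are smaller than `log₂ s` by a constant amount on average, since the mean of `log₂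
m` over `m ≤ s` is about `log₂ s - log₂ e`, while the summand `1` gives back less than `log₂ e`.
Relative to `log₂ s` this saves a factor exponential in `s / log s`. -/
theorem prod_one_add_log_le {s : ℕ} (hs : 2 ≤ s) :
    (∏ m ∈ Finset.range s, (1 + Nat.log 2 (m + 1) : ℝ)) ≤
      Real.logb 2 s ^ s * Real.exp (3 - 1 / 4 * (s / Real.log s)) := by
  have hs2 : (2 : ℝ) ≤ s := by exact_mod_cast hs
  have hl2 : 0 < Real.log 2 := Real.log_pos (by norm_num)
  have hls : Real.log 2 ≤ Real.log s := Real.log_le_log (by norm_num) hs2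
  set L := Real.logb 2 s with hL
  have hLdef : L = Real.log s / Real.log 2 := rfl
  have hL0 : 0 < L := div_pos (hl2.trans_le hls) hl2
  -- Write the factor as `L * (1 + x)` and use `1 + x ≤ exp x`; the exponents then sum to an
  -- expression in `log s!`.
  have hterm : ∀ m ∈ Finset.range s, (1 + Nat.log 2 (m + 1) : ℝ) ≤
      L * Real.exp ((1 + Real.log (m + 1 : ℕ) / Real.log 2 - L) / L) := by
    intro m _
    have h1 : (Nat.log 2 (m + 1) : ℝ) ≤ Real.log (m + 1 : ℕ) / Real.log 2 :=
      Real.natLog_le_logb (m + 1) 2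
    have h2 := Real.add_one_le_exp ((1 + Real.log (m + 1 : ℕ) / Real.log 2 - L) / L)
    calc (1 + Nat.log 2 (m + 1) : ℝ) ≤ 1 + Real.log (m + 1 : ℕ) / Real.log 2 := by gcongr
      _ = L * ((1 + Real.log (m + 1 : ℕ) / Real.log 2 - L) / L + 1) := by field_simp; ring
      _ ≤ _ := by gcongr
  refine (Finset.prod_le_prod (fun m _ => by positivity) hterm).trans ?_
  rw [Finset.prod_mul_distrib, Finset.prod_const, Finset.card_range, ← Real.exp_sum]
  gcongr
  rw [← Finset.sum_div, Finset.sum_sub_distrib, Finset.sum_add_distrib, ← Finset.sum_div]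
  have hfac : ∑ m ∈ Finset.range s, Real.log ((m + 1 : ℕ) : ℝ) = Real.log (s.factorial : ℝ) := by
    rw [← Real.log_prod (fun m _ => by positivity), ← Finset.prod_range_add_one_eq_factorial]
    push_cast
    rfl
  rw [hfac]
  simp only [Finset.sum_const, Finset.card_range, nsmul_eq_mul, mul_one]
  -- By Stirling the numerator is at most `1 + log s - (1 - log 2) * s`. The constants work because
  -- `1 - log 2 > 1/4` and `1 ≤ 2 * log 2 ≤ 2 * log s`.
  have hf := log_factorial_le (s := s) (by omega)
  have e1 := Real.log_two_lt_d9
  have e2 := Real.log_two_gt_d9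
  rw [hLdef, div_le_iff₀ (div_pos (hl2.trans_le hls) hl2)]
  have hlog : 0 < Real.log s := hl2.trans_le hls
  have : (3 - 1 / 4 * (s / Real.log s)) * (Real.log s / Real.log 2) =
      (3 * Real.log s - s / 4) / Real.log 2 := by field_simp
  rw [this, show (s : ℝ) + Real.log (s.factorial : ℝ) / Real.log 2 - s * (Real.log s / Real.log 2) =
    (s * Real.log 2 + Real.log (s.factorial : ℝ) - s * Real.log s) / Real.log 2 by field_simp]
  refine div_le_div_of_nonneg_right ?_ hl2.le
  nlinarith

/-- The number of vertices of the search tree, up to the factors that do not depend on `s`, beats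
any bound of the form `(log s) ^ s`, even with a polynomial factor. -/
theorem exists_prod_one_add_log_le : ∃ C : ℝ, 0 ≤ C ∧ ∀ s : ℕ, 1 ≤ s →
    ((s : ℝ) + 1) ^ 3 * ∏ m ∈ Finset.range s, (1 + Nat.log 2 (m + 1) : ℝ) ≤
      C * max 1 (Real.logb 2 s) ^ s := by
  have hlo : ∀ᶠ s : ℕ in Filter.atTop, Real.log s ^ 2 ≤ 1 / 24 * s := by
    have h := (Real.isLittleO_pow_log_id_atTop (n := 2)).comp_tendsto
      (tendsto_natCast_atTop_atTop (R := ℝ))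
    filter_upwards [h.bound (show (0 : ℝ) < 1 / 24 by norm_num)] with s hs
    simpa using hs
  obtain ⟨N, hN⟩ := Filter.eventually_atTop.1 hlo
  set f : ℕ → ℝ := fun s => ((s : ℝ) + 1) ^ 3 * ∏ m ∈ Finset.range s, (1 + Nat.log 2 (m + 1) : ℝ)
    with hf
  have hf0 : ∀ s, 0 ≤ f s := fun s => by positivity
  have hmax : ∀ s : ℕ, 1 ≤ max 1 (Real.logb 2 s) ^ s := fun s => one_le_pow₀ (le_max_left _ _)
  -- The finite sum covers small `s`. Beyond `N`, the condition `(log s)² ≤ s / 24` lets the saving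
  -- `exp (-s / (4 log s))` cancel `(s + 1)³ ≤ s⁶ = exp (6 log s)`. The shift by `2` ensures `2 ≤ s`
  -- there.
  refine ⟨∑ s ∈ Finset.range (N + 2), f s + Real.exp 3,
    add_nonneg (Finset.sum_nonneg fun s _ => hf0 s) (Real.exp_pos _).le, fun s _ => ?_⟩
  change f s ≤ _
  have hsum : 0 ≤ ∑ s ∈ Finset.range (N + 2), f s := Finset.sum_nonneg fun s _ => hf0 s
  by_cases hsN : s < N + 2
  · calc f s ≤ ∑ s ∈ Finset.range (N + 2), f s :=
        Finset.single_le_sum (fun s _ => hf0 s) (Finset.mem_range.2 hsN)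
      _ ≤ (∑ s ∈ Finset.range (N + 2), f s + Real.exp 3) * 1 := by
        rw [mul_one]; exact le_add_of_nonneg_right (Real.exp_pos _).le
      _ ≤ _ := by gcongr; exact hmax s
  · have hs2 : 2 ≤ s := by omega
    have hs2' : (2 : ℝ) ≤ s := by exact_mod_cast hs2
    have hlog : 0 < Real.log s := Real.log_pos (by linarith)
    have h1 : ((s : ℝ) + 1) ^ 3 ≤ Real.exp (6 * Real.log s) := by
      calc ((s : ℝ) + 1) ^ 3 ≤ ((s : ℝ) ^ 2) ^ 3 := by gcongr; nlinarith
        _ = (s : ℝ) ^ 6 := by ring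
        _ = Real.exp (6 * Real.log s) := by
          rw [mul_comm, Real.exp_mul, Real.exp_log (by linarith)]
          norm_cast
    have h2 : 6 * Real.log s ≤ 1 / 4 * (s / Real.log s) := by
      rw [mul_div_assoc', le_div_iff₀ hlog]
      nlinarith [hN s (by omega)]
    calc f s ≤ Real.exp (6 * Real.log s) *
          (Real.logb 2 s ^ s * Real.exp (3 - 1 / 4 * (s / Real.log s))) :=
          mul_le_mul h1 (prod_one_add_log_le hs2) (by positivity) (by positivity)
      _ = Real.exp (6 * Real.log s + (3 - 1 / 4 * (s / Real.log s))) * Real.logb 2 s ^ s := by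
        rw [Real.exp_add]; ring
      _ ≤ Real.exp 3 * max 1 (Real.logb 2 s) ^ s := by
        have hl : 0 ≤ Real.logb 2 s := Real.logb_nonneg (by norm_num) (by linarith)
        gcongr
        · linarith
        · exact le_max_right _ _
      _ ≤ _ := by
        gcongr
        exact le_add_of_nonneg_left hsum

open NExpr RExpr Test Prog

/-! ### The program

Registers: `0` output, `1` length of the queue, `2` number of checked entries, `3` number of
expanded entries, `4` number of used cells, `5` number of listed features, `6` halting flag,
`7` root, `8` example, `9` vertex, `10` whether some example is dirty, `11` depth,
`12` number of candidates, `13` dirty example, `14` witness, `15` index of the feature,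
`16` feature, `17` and `18` whether dirty examples go left and right, `19` direction,
`20` index of the candidate, `21` remaining depth, `22` unused.

Arrays of natural numbers: `0` to `5` vertices (kind, class or feature, left and right child, size
of the subtree, witness), `6` roots in the queue, `7` set of dirty examples, `8` candidates,
`9` examples whose features are listed, `10` set of listed features, `11` list of features.

Arrays of real numbers: `0` thresholds of vertices; `1` current threshold, its upper bound and the
next threshold. -/

/-- Do nothing. -/
def skip : Prog := .setVar 22 (const 0)

/-- Increment a register. -/
def inc (x : ℕ) : Prog := .setVar x (add (var x) (const 1))

/-- Is `e` smaller than `f`? -/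
def ltT (e f : NExpr) : Test := le (add e (const 1)) f

/-- Does the current example go to the left at the current vertex? -/
def goesLeft : Test := rle (input (var 8) (get 1 (var 9))) (get 0 (var 9))

/-- Move from the current vertex to the leaf that the current example reaches. -/
def walk : Prog :=
  .while (le (const 1) (get 0 (var 9)))
    (.ite goesLeft (.setVar 9 (get 2 (var 9))) (.setVar 9 (get 3 (var 9))))

/-- Process one example in `eval`. -/
def evalBody : Prog :=
  .setVar 9 (var 7) ;; walk ;;
    -- An equality test: both truncated differences vanish.
    .ite (le (add (sub (get 1 (var 9)) (label (var 8))) (sub (label (var 8)) (get 1 (var 9))))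
        (const 0))
      (.setNat 7 (var 8) (const 0)) (.setNat 7 (var 8) (const 1) ;; .setVar 10 (const 1)) ;;
    inc 8

/-- Determine the dirty examples of the current tree. -/
def eval : Prog :=
  .setVar 10 (const 0) ;; .setVar 8 (const 0) ;; .while (ltT (var 8) numExamples) evalBody

/-! ### Trees in memory and the computation of dirty examples -/

section

variable {n d : ℕ} (E : DataSet n d)

/-- The tree `R` is stored at address `v`, in cells below `N`. -/
def Rep (σ : State) (N : ℕ) : ℕ → WTree n d → Prop
  | v, .leaf w => v < N ∧ σ.nat 0 v = 0 ∧ σ.nat 1 v = (if E.label w then 1 else 0) ∧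
      σ.nat 4 v = 0 ∧ σ.nat 5 v = w
  | v, .node i t l r => v < N ∧ σ.nat 0 v = 1 ∧ σ.nat 1 v = i ∧ σ.real 0 v = t ∧
      σ.nat 4 v = l.size + r.size + 1 ∧ Rep σ N (σ.nat 2 v) l ∧ Rep σ N (σ.nat 3 v) r

/-- The memory for vertices agrees below `N`. -/
def Agree (N : ℕ) (σ τ : State) : Prop :=
  ∀ v < N, (∀ a ≤ 5, τ.nat a v = σ.nat a v) ∧ τ.real 0 v = σ.real 0 v

/-- The examples that reach a leaf of `R` of the other class. -/
noncomputable def dirty (R : WTree n d) : Finset (Fin n) :=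
  Finset.univ.filter fun a => E.label (R.leafOf (E.ex a)) ≠ E.label a

/-- The set `D` of examples is stored. -/
def Flags (σ : State) (D : Finset (Fin n)) : Prop :=
  ∀ a : Fin n, σ.nat 7 a = if a ∈ D then 1 else 0

variable {E}

theorem Agree.trans {N M : ℕ} {σ τ υ : State} (h : Agree N σ τ) (h' : Agree M τ υ) (hNM : N ≤ M) :
    Agree N σ υ := fun v hv =>
  ⟨fun a ha => ((h' v (hv.trans_le hNM)).1 a ha).trans ((h v hv).1 a ha),
    (h' v (hv.trans_le hNM)).2.trans (h v hv).2⟩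

theorem Prog.Frame.agree {P : Prog} {σ τ : State} (h : P.Frame σ τ) (N : ℕ)
    (hn : ∀ a ≤ 5, a ∉ P.nats) (hr : 0 ∉ P.reals) : Agree N σ τ := fun _ _ =>
  ⟨fun a ha => by rw [h.nat a (hn a ha)], by rw [h.real 0 hr]⟩

/-- Cells are only ever added, never changed once in use. Hence stored trees stay valid, and
different trees may share subtrees. -/
theorem Rep.mono {N M : ℕ} {σ τ : State} (hNM : N ≤ M) (h : Agree N σ τ) {v : ℕ} {R : WTree n d}
    (hR : Rep E σ N v R) : Rep E τ M v R := by
  induction R generalizing v with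
  | leaf w =>
    obtain ⟨h0, h1, h2, h3, h4⟩ := hR
    obtain ⟨g, -⟩ := h v h0
    exact ⟨h0.trans_le hNM, by rw [g 0 (by norm_num), h1], by rw [g 1 (by norm_num), h2],
      by rw [g 4 (by norm_num), h3], by rw [g 5 (by norm_num), h4]⟩
  | node i t l r ihl ihr =>
    obtain ⟨h0, h1, h2, h3, h4, h5, h6⟩ := hR
    obtain ⟨g, g'⟩ := h v h0
    exact ⟨h0.trans_le hNM, by rw [g 0 (by norm_num), h1], by rw [g 1 (by norm_num), h2],
      by rw [g', h3], by rw [g 4 (by norm_num), h4], by rw [g 2 (by norm_num)]; exact ihl h5,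
      by rw [g 3 (by norm_num)]; exact ihr h6⟩

theorem Rep.size_eq {N : ℕ} {σ : State} {v : ℕ} {R : WTree n d} (h : Rep E σ N v R) :
    σ.nat 4 v = R.size := by
  cases R
  exacts [h.2.2.2.1, h.2.2.2.2.1]

theorem Rep.storesAt {N : ℕ} {σ : State} {v : ℕ} {R : WTree n d} (h : Rep E σ N v R) :
    σ.StoresAt v (R.toTree E) := by
  induction R generalizing v with
  | leaf w => exact ⟨h.2.1, h.2.2.1⟩
  | node i t l r ihl ihr =>
    exact ⟨h.2.1, h.2.2.1, h.2.2.2.1, ihl h.2.2.2.2.2.1, ihr h.2.2.2.2.2.2⟩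

theorem rep_setV {N : ℕ} {σ : State} {x k v : ℕ} {R : WTree n d} :
    Rep E (σ.setV x k) N v R ↔ Rep E σ N v R := by
  have h : Agree N σ (σ.setV x k) := fun _ _ => ⟨fun _ _ => rfl, rfl⟩
  have h' : Agree N (σ.setV x k) σ := fun _ _ => ⟨fun _ _ => rfl, rfl⟩
  exact ⟨Rep.mono le_rfl h', Rep.mono le_rfl h⟩

theorem goesLeft_holds {N : ℕ} {σ : State} {i : Fin d} {t : ℝ} {l r : WTree n d} {a : Fin n}
    (hR : Rep E σ N (σ.var 9) (.node i t l r)) (ha : σ.var 8 = a) :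
    goesLeft.Holds E σ ↔ E.ex a i ≤ t := by
  rw [goesLeft, Test.Holds, value_input (e := var 8) (i := get 1 (var 9)) (a := a) (j := i) ha hR.2.2.1]
  simp only [RExpr.value, NExpr.value, hR.2.2.2.1]

theorem cost_goesLeft : goesLeft.cost = 7 := rfl

/-- The stored subtree size strictly decreases along the walk, so it serves as termination measure
and pays for the time. -/
theorem wp_walk {N : ℕ} {σ : State} {R : WTree n d} {a : Fin n}
    (hR : Rep E σ N (σ.var 9) R) (ha : σ.var 8 = a) :
    wp E walk (fun t τ => t ≤ 20 * (R.size + 1) ∧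
      τ.nat 1 (τ.var 9) = if E.label (R.leafOf (E.ex a)) then 1 else 0) σ := by
  refine wp_while (fun T τ => ∃ R' : WTree n d, Rep E τ N (τ.var 9) R' ∧
    R'.leafOf (E.ex a) = R.leafOf (E.ex a) ∧ T + 20 * R'.size ≤ 20 * R.size)
    (fun τ => τ.nat 4 (τ.var 9)) ⟨R, hR, rfl, by omega⟩ ?_ ?_
  · rintro T τ fr ⟨R', h1, h2, h3⟩ hb
    have ha' : τ.var 8 = a := by rw [fr.var 8 (by decide), ha]
    cases R' with
    | leaf w => simp [Test.Holds, NExpr.value, h1.2.1] at hb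
    | node i t l r =>
      obtain ⟨g0, g1, g2, g3, g4, g5, g6⟩ := id h1
      simp only [wp_ite, wp_setVar, goesLeft_holds h1 ha', State.setV_var, State.setV_nat]
      simp only [WTree.leafOf, WTree.size] at h2 h3
      refine ⟨fun hl => ⟨⟨l, ?_, ?_, ?_⟩, ?_⟩, fun hl => ⟨⟨r, ?_, ?_, ?_⟩, ?_⟩⟩
      · simpa only [if_true, rep_setV, NExpr.value] using g5
      · rwa [if_pos hl] at h2
      · simp [Test.cost, NExpr.cost, RExpr.cost, goesLeft]; omega
      · simp only [NExpr.value, if_true, g5.size_eq, g4]; omega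
      · simpa only [if_true, rep_setV, NExpr.value] using g6
      · rwa [if_neg hl] at h2
      · simp [Test.cost, NExpr.cost, RExpr.cost, goesLeft]; omega
      · simp only [NExpr.value, if_true, g6.size_eq, g4]; omega
  · rintro T τ fr ⟨R', h1, h2, h3⟩ hb
    cases R' with
    | leaf w =>
      refine ⟨?_, ?_⟩
      · simp [Test.cost, NExpr.cost]; omega
      · rw [h1.2.2.1, ← h2]; rfl
    | node i t l r => simp [Test.Holds, NExpr.value, h1.2.1] at hb

theorem wp_eval {N : ℕ} {σ : State} {R : WTree n d} (hR : Rep E σ N (σ.var 7) R) :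
    wp E eval (fun t τ => t ≤ 100 * ((n + 1) * (R.size + 1)) ∧ Flags τ (dirty E R) ∧
      (τ.var 10 = 0 ↔ dirty E R = ∅)) σ := by
  simp only [eval, wp_seq, wp_setVar, NExpr.value]
  refine wp_mono (wp_for (fun k τ => τ.var 8 = k ∧
    (∀ a : Fin n, a.1 < k → τ.nat 7 a = if a ∈ dirty E R then 1 else 0) ∧
    (τ.var 10 = 0 ↔ ∀ a : Fin n, a.1 < k → a ∉ dirty E R)) n (20 * (R.size + 1) + 40) ?_ ?_ ?_) ?_
  · simp
  · rintro k τ hk fr ⟨h1, h2, h3⟩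
    refine ⟨by simp [ltT, Test.Holds, NExpr.value, h1]; omega, ?_⟩
    simp only [evalBody, wp_seq, wp_setVar]
    have hR' : Rep E (τ.setV 9 (NExpr.value E τ (var 7))) N
        ((τ.setV 9 (NExpr.value E τ (var 7))).var 9) R := by
      simp only [NExpr.value, State.setV_var, if_true, fr.var 7 (by decide), rep_setV]
      exact (rep_setV.2 (rep_setV.2 hR)).mono le_rfl (fr.agree N (by decide) (by decide))
    refine wp_mono (wp_walk (a := ⟨k, hk⟩) hR' (by simpa using h1)) ?_
    rintro t υ ⟨ht, hv⟩ fr'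
    have e8 : υ.var 8 = (⟨k, hk⟩ : Fin n) := by rw [fr'.var 8 (by decide)]; simpa using h1
    have e7 : υ.nat 7 = τ.nat 7 := by rw [fr'.nat 7 (by decide)]; rfl
    have e10 : υ.var 10 = τ.var 10 := by rw [fr'.var 10 (by decide)]; simp
    have hb : Test.Holds E υ (le (add (sub (get 1 (var 9)) (label (var 8)))
        (sub (label (var 8)) (get 1 (var 9)))) (const 0)) ↔ ⟨k, hk⟩ ∉ dirty E R := by
      simp only [Test.Holds, NExpr.value.eq_7, NExpr.value.eq_8, NExpr.value.eq_1,
        value_label (E := E) (σ := υ) (e := var 8) e8]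
      simp only [NExpr.value, hv, dirty, Finset.mem_filter, Finset.mem_univ, true_and, not_not]
      cases E.label (R.leafOf (E.ex ⟨k, hk⟩)) <;> cases E.label ⟨k, hk⟩ <;> simp
    simp only [wp_ite, hb, wp_setNat, wp_seq, wp_setVar, inc, Test.cost, NExpr.cost, NExpr.value]
    refine ⟨fun hd => ⟨by omega, by simp [e8], fun a ha => ?_, ?_⟩,
      fun hd => ⟨by omega, by simp [e8], fun a ha => ?_, ?_⟩⟩
    · simp only [State.setV_nat, State.setN_nat, if_true, e8, e7]
      split_ifs with h4 h5 h5
      · exact absurd ((show a = ⟨k, hk⟩ from Fin.ext h4) ▸ h5) hd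
      · rfl
      · rw [h2 a (by omega), if_pos h5]
      · rw [h2 a (by omega), if_neg h5]
    · simp only [State.setV_var, State.setN_var, e10]
      simp only [Nat.reduceEqDiff, if_false, h3]
      refine ⟨fun h a ha => ?_, fun h a ha => h a (by omega)⟩
      rcases Nat.lt_succ_iff_lt_or_eq.1 ha with h' | h'
      · exact h a h'
      · rwa [show a = ⟨k, hk⟩ from Fin.ext h']
    · simp only [State.setV_nat, State.setN_nat, if_true, e8, e7]
      split_ifs with h4 h5 h5
      · rfl
      · exact absurd ((show a = ⟨k, hk⟩ from Fin.ext h4) ▸ not_not.1 hd) h5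
      · rw [h2 a (by omega), if_pos h5]
      · rw [h2 a (by omega), if_neg h5]
    · simp only [State.setV_var, State.setN_var]
      simp only [Nat.reduceEqDiff, if_false, if_true, one_ne_zero,
        false_iff, not_forall]
      exact ⟨⟨k, hk⟩, by simp, hd⟩
  · rintro τ fr ⟨h1, -⟩
    simp [ltT, Test.Holds, NExpr.value, h1]
  · rintro t τ ⟨ht, h1, h2, h3⟩ fr
    refine ⟨?_, fun a => h2 a a.isLt, ?_⟩
    · simp only [ltT, Test.cost, NExpr.cost] at ht ⊢
      nlinarith
    · rw [h3, Finset.eq_empty_iff_forall_notMem]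
      exact ⟨fun h a => h a a.isLt, fun h a _ => h a⟩

end

/-! ### Programs for the dirty leaf and for the list of features -/

/-- Find out whether dirty examples go to the left and to the right at the current vertex. -/
def countSides : Prog :=
  .setVar 17 (const 0) ;; .setVar 18 (const 0) ;; .setVar 8 (const 0) ;;
    .while (ltT (var 8) numExamples)
      (.ite (le (const 1) (get 7 (var 8)))
        (.ite goesLeft (.setVar 17 (const 1)) (.setVar 18 (const 1))) skip ;; inc 8)

/-- Choose the child in which the search for a dirty leaf continues. -/
def chooseSide : Prog :=
  .ite (le (const 2) (add (var 17) (var 18)))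
    (.setNat 8 (var 12) (var 11) ;; inc 12 ;;
      -- Array `4` holds subtree sizes. Taking the smaller child is what makes the number of
      -- candidates logarithmic.
      .ite (le (get 4 (get 2 (var 9))) (get 4 (get 3 (var 9))))
        (.setVar 19 (const 1)) (.setVar 19 (const 0)))
    -- Only one side contains dirty examples, so the flag of the left side is the direction.
    (.setVar 19 (var 17))

/-- Keep the dirty examples that reach the chosen child. -/
def filterSide : Prog :=
  .setVar 8 (const 0) ;;
    .while (ltT (var 8) numExamples)
      (.ite goesLeft (.ite (le (const 1) (var 19)) skip (.setNat 7 (var 8) (const 0)))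
        (.ite (le (const 1) (var 19)) (.setNat 7 (var 8) (const 0)) skip) ;; inc 8)

/-- Move to the chosen child. -/
def moveSide : Prog :=
  .ite (le (const 1) (var 19)) (.setVar 9 (get 2 (var 9))) (.setVar 9 (get 3 (var 9))) ;; inc 11

/-- One step of the search for a dirty leaf. -/
def descendBody : Prog := countSides ;; chooseSide ;; filterSide ;; moveSide

/-- Find some dirty example. -/
def findDirty : Prog :=
  .setVar 8 (const 0) ;;
    .while (ltT (var 8) numExamples)
      (.ite (le (const 1) (get 7 (var 8))) (.setVar 13 (var 8)) skip ;; inc 8)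

/-- Find a dirty leaf, a dirty example that reaches it, and the candidates on its path. -/
def descend : Prog :=
  .setVar 9 (var 7) ;; .setVar 11 (const 0) ;; .setVar 12 (const 0) ;;
    .while (le (const 1) (get 0 (var 9))) descendBody ;;
    .setNat 8 (var 12) (var 11) ;; inc 12 ;; .setVar 14 (get 5 (var 9)) ;; findDirty

/-- Append the current feature to the list. -/
def listFeature : Prog :=
  .setNat 11 (var 5) (var 16) ;; inc 5 ;; .setNat 10 (var 16) (const 1)

/-- List the current feature if the dirty example differs there from the first example. -/
def scanBody : Prog :=
  .ite (le (get 10 (var 16)) (const 0))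
    (.ite (rle (input (var 13) (var 16)) (input (const 0) (var 16)))
      (.ite (rle (input (const 0) (var 16)) (input (var 13) (var 16))) skip listFeature)
      listFeature)
    skip ;; inc 16

/-- List the features in which the dirty example differs from the first example, unless this
has been done before. -/
def scan : Prog :=
  .ite (le (get 9 (var 13)) (const 0))
    (.setNat 9 (var 13) (const 1) ;; .setVar 16 (const 0) ;;
      .while (ltT (var 16) numFeatures) scanBody)
    skip

/-- The list `P` of depths is stored. -/
def Depths (σ : State) (P : List ℕ) : Prop :=
  σ.var 12 = P.length ∧ ∀ k p, P[k]? = some p → σ.nat 8 k = p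

theorem Depths.append {σ τ : State} {P : List ℕ} {p : ℕ} (h : Depths σ P)
    (h1 : τ.var 12 = σ.var 12 + 1)
    (h2 : ∀ k, τ.nat 8 k = if k = σ.var 12 then p else σ.nat 8 k) : Depths τ (P ++ [p]) := by
  refine ⟨by simp [h1, h.1], fun k q hk => ?_⟩
  rw [h2, h.1]
  rcases lt_trichotomy k P.length with hlt | rfl | hlt
  · rw [List.getElem?_append_left hlt] at hk
    rw [if_neg hlt.ne, h.2 k q hk]
  · simpa using hk
  · rw [List.getElem?_eq_none (by simp; omega)] at hk
    simp at hk

/-! ### Verification of the descent to a dirty leaf -/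

section

variable {n d : ℕ} {E : DataSet n d}

theorem ltT_holds {σ : State} {e f : NExpr} :
    (ltT e f).Holds E σ ↔ e.value E σ < f.value E σ := by
  simp only [ltT, Test.Holds, NExpr.value, Nat.succ_le_iff]

theorem wp_countSides {N : ℕ} {σ : State} {i : Fin d} {t : ℝ} {l r : WTree n d}
    {D : Finset (Fin n)} (hR : Rep E σ N (σ.var 9) (.node i t l r)) (hD : Flags σ D) :
    wp E countSides (fun T τ => T ≤ 100 * (n + 1) ∧
      (τ.var 17 = if ∃ a ∈ D, E.ex a i ≤ t then 1 else 0) ∧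
      τ.var 18 = if ∃ a ∈ D, t < E.ex a i then 1 else 0) σ := by
  simp only [countSides, wp_seq, wp_setVar, NExpr.value]
  refine wp_mono (wp_for (fun k τ => τ.var 8 = k ∧
    (τ.var 17 = if ∃ a ∈ D, a.1 < k ∧ E.ex a i ≤ t then 1 else 0) ∧
    (τ.var 18 = if ∃ a ∈ D, a.1 < k ∧ t < E.ex a i then 1 else 0)) n 40 ?_ ?_ ?_) ?_
  · simp
  · rintro k τ hk fr ⟨h1, h2, h3⟩
    refine ⟨by rw [ltT_holds]; simpa [NExpr.value, h1] using hk, ?_⟩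
    have hR' : Rep E τ N (τ.var 9) (.node i t l r) := by
      rw [fr.var 9 (by decide)]
      exact (rep_setV.2 (rep_setV.2 (rep_setV.2 hR))).mono le_rfl
        (fr.agree N (by decide) (by decide))
    have h8 : τ.var 8 = (⟨k, hk⟩ : Fin n) := h1
    have h7 : τ.nat 7 k = if (⟨k, hk⟩ : Fin n) ∈ D then 1 else 0 := by
      rw [fr.nat 7 (by decide)]; exact hD ⟨k, hk⟩
    have key : ∀ p : Fin n → Prop, (∃ a ∈ D, a.1 < k + 1 ∧ p a) ↔
        (∃ a ∈ D, a.1 < k ∧ p a) ∨ (⟨k, hk⟩ ∈ D ∧ p ⟨k, hk⟩) := by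
      intro p
      constructor
      · rintro ⟨a, ha, hak, hp⟩
        rcases Nat.lt_succ_iff_lt_or_eq.1 hak with h' | h'
        · exact .inl ⟨a, ha, h', hp⟩
        · obtain rfl : a = ⟨k, hk⟩ := Fin.ext h'
          exact .inr ⟨ha, hp⟩
      · rintro (⟨a, ha, hak, hp⟩ | ⟨h, hp⟩)
        exacts [⟨a, ha, by omega, hp⟩, ⟨_, h, by simp, hp⟩]
    simp only [wp_seq, wp_ite, wp_setVar, inc, skip, goesLeft_holds hR' h8, Test.Holds,
      NExpr.value, h7, key, cost_goesLeft, Test.cost, NExpr.cost, State.setV_var, h1, h2, h3]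
    by_cases hkD : (⟨k, hk⟩ : Fin n) ∈ D <;> by_cases hkt : E.ex ⟨k, hk⟩ i ≤ t
    · simp [hkD, hkt, not_lt.2 hkt]
    · simp [hkD, hkt, not_le.1 hkt]
    · simp [hkD]
    · simp [hkD]
  · rintro τ fr ⟨h1, -⟩
    rw [ltT_holds]
    simp [NExpr.value, h1]
  · rintro T τ ⟨hT, h1, h2, h3⟩ fr
    simp only [ltT, Test.cost, NExpr.cost] at hT ⊢
    refine ⟨by omega, ?_, ?_⟩
    · simpa using h2
    · simpa using h3

theorem wp_filterSide {N : ℕ} {σ : State} {i : Fin d} {t : ℝ} {l r : WTree n d}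
    {D : Finset (Fin n)} (hR : Rep E σ N (σ.var 9) (.node i t l r)) (hD : Flags σ D) :
    wp E filterSide (fun T τ => T ≤ 100 * (n + 1) ∧
      Flags τ (D.filter fun a => E.ex a i ≤ t ↔ 1 ≤ σ.var 19)) σ := by
  simp only [filterSide, wp_seq, wp_setVar, NExpr.value]
  refine wp_mono (wp_for (fun k τ => τ.var 8 = k ∧
    ∀ a : Fin n, τ.nat 7 a =
      if a ∈ D ∧ (a.1 < k → (E.ex a i ≤ t ↔ 1 ≤ σ.var 19)) then 1 else 0) n 40 ?_ ?_ ?_) ?_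
  · exact ⟨by simp, fun a => by simpa using hD a⟩
  · rintro k τ hk fr ⟨h1, h2⟩
    refine ⟨by rw [ltT_holds]; simpa [NExpr.value, h1] using hk, ?_⟩
    have hR' : Rep E τ N (τ.var 9) (.node i t l r) := by
      rw [fr.var 9 (by decide)]
      exact (rep_setV.2 hR).mono le_rfl (fr.agree N (by decide) (by decide))
    have h8 : τ.var 8 = (⟨k, hk⟩ : Fin n) := h1
    have h19 : τ.var 19 = σ.var 19 := by rw [fr.var 19 (by decide)]; simp
    have keep : (E.ex ⟨k, hk⟩ i ≤ t ↔ 1 ≤ σ.var 19) → ∀ a : Fin n, τ.nat 7 a =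
        if a ∈ D ∧ (a.1 < k + 1 → (E.ex a i ≤ t ↔ 1 ≤ σ.var 19)) then 1 else 0 := by
      intro h a
      rw [h2]
      refine if_congr (and_congr_right fun _ => ⟨fun h' hlt => ?_, fun h' hlt => h' (by omega)⟩)
        rfl rfl
      rcases Nat.lt_succ_iff_lt_or_eq.1 hlt with h'' | h''
      · exact h' h''
      · rwa [show a = ⟨k, hk⟩ from Fin.ext h'']
    have drop : ¬ (E.ex ⟨k, hk⟩ i ≤ t ↔ 1 ≤ σ.var 19) → ∀ a : Fin n,
        (if (a : ℕ) = k then 0 else τ.nat 7 a) =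
        if a ∈ D ∧ (a.1 < k + 1 → (E.ex a i ≤ t ↔ 1 ≤ σ.var 19)) then 1 else 0 := by
      intro h a
      by_cases hak : (a : ℕ) = k
      · obtain rfl : a = ⟨k, hk⟩ := Fin.ext hak
        simp [h]
      · rw [if_neg hak, h2]
        refine if_congr (and_congr_right fun _ => ⟨fun h' hlt => h' (by omega),
          fun h' hlt => h' (by omega)⟩) rfl rfl
    simp only [wp_seq, wp_ite, wp_setVar, wp_setNat, inc, skip, goesLeft_holds hR' h8, Test.Holds,
      NExpr.value, h19, cost_goesLeft, Test.cost, NExpr.cost, State.setV_var,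
      State.setN_nat, State.setV_nat, State.setN_var, h1]
    refine ⟨fun ha => ⟨fun hb => ⟨by omega, by simp, ?_⟩, fun hb => ⟨by omega, by simp, ?_⟩⟩,
      fun ha => ⟨fun hb => ⟨by omega, by simp, ?_⟩, fun hb => ⟨by omega, by simp, ?_⟩⟩⟩
    · exact keep (by tauto)
    · simpa using drop (by tauto)
    · simpa using drop (by tauto)
    · exact keep (by tauto)
  · rintro τ fr ⟨h1, -⟩
    rw [ltT_holds]
    simp [NExpr.value, h1]
  · rintro T τ ⟨hT, h1, h2⟩ fr
    simp only [ltT, Test.cost, NExpr.cost] at hT ⊢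
    refine ⟨by omega, fun a => ?_⟩
    rw [h2]
    simp

theorem wp_findDirty {σ : State} {D : Finset (Fin n)} (hD : Flags σ D) (hne : D.Nonempty) :
    wp E findDirty (fun T τ => T ≤ 100 * (n + 1) ∧ ∃ e ∈ D, τ.var 13 = e) σ := by
  simp only [findDirty, wp_seq, wp_setVar, NExpr.value]
  refine wp_mono (wp_for (fun k τ => τ.var 8 = k ∧
    ((∃ a ∈ D, a.1 < k) → ∃ e ∈ D, τ.var 13 = e)) n 40 ?_ ?_ ?_) ?_
  · simp
  · rintro k τ hk fr ⟨h1, h2⟩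
    refine ⟨by rw [ltT_holds]; simpa [NExpr.value, h1] using hk, ?_⟩
    have h7 : τ.nat 7 k = if (⟨k, hk⟩ : Fin n) ∈ D then 1 else 0 := by
      rw [fr.nat 7 (by decide)]; exact hD ⟨k, hk⟩
    simp only [wp_seq, wp_ite, wp_setVar, inc, skip, Test.Holds, NExpr.value, Test.cost,
      NExpr.cost, State.setV_var, h1, h7]
    refine ⟨fun ha => ⟨by omega, by simp, fun _ => ⟨⟨k, hk⟩, ?_, by simp⟩⟩,
      fun ha => ⟨by omega, by simp, ?_⟩⟩
    · by_contra h; simp [h] at ha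
    · rintro ⟨a, haD, hak⟩
      simp only [Nat.reduceEqDiff, if_false]
      refine h2 ⟨a, haD, ?_⟩
      rcases Nat.lt_succ_iff_lt_or_eq.1 hak with h' | h'
      · exact h'
      · rw [show a = ⟨k, hk⟩ from Fin.ext h'] at haD
        simp [haD] at ha
  · rintro τ fr ⟨h1, -⟩
    rw [ltT_holds]
    simp [NExpr.value, h1]
  · rintro T τ ⟨hT, h1, h2⟩ fr
    simp only [ltT, Test.cost, NExpr.cost] at hT ⊢
    obtain ⟨a, ha⟩ := hne
    exact ⟨by omega, h2 ⟨a, ha, a.isLt⟩⟩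

/-- What one step of the search for a dirty leaf does. -/
def Descends (E : DataSet n d) (R : WTree n d) (D : Finset (Fin n)) (P : List ℕ) (p : ℕ)
    (R' : WTree n d) (D' : Finset (Fin n)) (P' : List ℕ) : Prop :=
  D'.Nonempty ∧ D' ⊆ D ∧ R'.size < R.size ∧
    (∀ e ∈ D', P ++ (R.cand E D e).map (· + p) = P' ++ (R'.cand E D' e).map (· + (p + 1))) ∧
    (∀ e ∈ D', R.leafOf (E.ex e) = R'.leafOf (E.ex e)) ∧
    P'.length + Nat.log 2 (R'.size + 1) ≤ P.length + Nat.log 2 (R.size + 1)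

/-- The dirty example is still undetermined, so `Descends` speaks about all `e` in the remaining
set: they share the path so far and hence the candidates collected so far. The last field of
`Descends` is the potential behind the logarithmic bound. -/
theorem wp_descendBody {N p : ℕ} {σ : State} {i : Fin d} {t : ℝ} {l r : WTree n d}
    {D : Finset (Fin n)} {P : List ℕ} (hR : Rep E σ N (σ.var 9) (.node i t l r))
    (hD : Flags σ D) (hne : D.Nonempty) (hp : σ.var 11 = p) (hP : Depths σ P) :
    wp E descendBody (fun T τ => T ≤ 300 * (n + 1) ∧ τ.var 11 = p + 1 ∧ ∃ R' D' P',
      Rep E τ N (τ.var 9) R' ∧ Flags τ D' ∧ Depths τ P' ∧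
        Descends E (.node i t l r) D P p R' D' P') σ := by
  simp only [descendBody, wp_seq]
  refine wp_mono (wp_countSides hR hD) ?_
  rintro t₁ σ₁ ⟨ht₁, h17, h18⟩ fr₁
  have hR₁ : Rep E σ₁ N (σ₁.var 9) (.node i t l r) := by
    rw [fr₁.var 9 (by decide)]
    exact hR.mono le_rfl (fr₁.agree N (by decide) (by decide))
  -- The depth `p` is recorded exactly if both sides contain examples of `D`, and then the chosen
  -- child is not larger than the other one.
  have h2 : wp E chooseSide (fun T τ => T ≤ 40 ∧ ∃ P', Depths τ P' ∧
      (((∃ a ∈ D, E.ex a i ≤ t) ∧ 1 ≤ τ.var 19 ∧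
        (if ∃ a ∈ D, t < E.ex a i then P' = P ++ [p] ∧ l.size ≤ r.size else P' = P)) ∨
      ((∃ a ∈ D, t < E.ex a i) ∧ ¬ 1 ≤ τ.var 19 ∧
        (if ∃ a ∈ D, E.ex a i ≤ t then P' = P ++ [p] ∧ r.size ≤ l.size else P' = P)))) σ₁ := by
    have hP₁ : Depths σ₁ P := by
      simpa only [Depths, fr₁.var 12 (by decide), fr₁.nat 8 (by decide)] using hP
    have hp₁ : σ₁.var 11 = p := by rw [fr₁.var 11 (by decide), hp]
    obtain ⟨-, -, -, -, -, gl, gr⟩ := hR₁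
    simp only [chooseSide, wp_ite, wp_seq, wp_setNat, wp_setVar, inc, Test.Holds, NExpr.value,
      Test.cost, NExpr.cost]
    by_cases hl : ∃ a ∈ D, E.ex a i ≤ t <;> by_cases hr : ∃ a ∈ D, t < E.ex a i
    · have : (2 ≤ σ₁.var 17 + σ₁.var 18) := by rw [h17, h18, if_pos hl, if_pos hr]
      simp only [this, not_true, true_imp_iff, false_imp_iff, and_true, hl, hr, true_and, if_true]
      refine ⟨fun hle => ⟨by omega, P ++ [p], hP₁.append (by simp) (by simp [hp₁]), .inl ?_⟩,
        fun hle => ⟨by omega, P ++ [p], hP₁.append (by simp) (by simp [hp₁]), .inr ?_⟩⟩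
      · simpa [gl.size_eq, gr.size_eq] using hle
      · have : r.size < l.size := by simpa [gl.size_eq, gr.size_eq] using hle
        simpa using this.le
    · have : ¬ (2 ≤ σ₁.var 17 + σ₁.var 18) := by rw [h17, h18, if_pos hl, if_neg hr]; omega
      simp only [this, not_false_iff, true_imp_iff, false_imp_iff, true_and, hl, hr, if_false,
        false_and, or_false]
      exact ⟨by omega, P, ⟨by simpa using hP₁.1, hP₁.2⟩, by simp [h17, hl], rfl⟩
    · have : ¬ (2 ≤ σ₁.var 17 + σ₁.var 18) := by rw [h17, h18, if_neg hl, if_pos hr]; omega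
      simp only [this, not_false_iff, true_imp_iff, false_imp_iff, true_and, hl, hr, if_false,
        false_and, false_or]
      exact ⟨by omega, P, ⟨by simpa using hP₁.1, hP₁.2⟩, by simp [h17, hl], rfl⟩
    · obtain ⟨a, ha⟩ := hne
      rcases le_or_gt (E.ex a i) t with h | h
      exacts [absurd ⟨a, ha, h⟩ hl, absurd ⟨a, ha, h⟩ hr]
  refine wp_mono h2 ?_
  rintro t₂ σ₂ ⟨ht₂, P', hP', hcase⟩ fr₂
  have hR₂ : Rep E σ₂ N (σ₂.var 9) (.node i t l r) := by
    rw [fr₂.var 9 (by decide)]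
    exact hR₁.mono le_rfl (fr₂.agree N (by decide) (by decide))
  have hD₂ : Flags σ₂ D := by
    simpa only [Flags, fr₁.nat 7 (by decide), fr₂.nat 7 (by decide)] using hD
  refine wp_mono (wp_filterSide hR₂ hD₂) ?_
  rintro t₃ σ₃ ⟨ht₃, hD₃⟩ fr₃
  have hR₃ : Rep E σ₃ N (σ₃.var 9) (.node i t l r) := by
    rw [fr₃.var 9 (by decide)]
    exact hR₂.mono le_rfl (fr₃.agree N (by decide) (by decide))
  have hP₃ : Depths σ₃ P' := by
    simpa only [Depths, fr₃.var 12 (by decide), fr₃.nat 8 (by decide)] using hP'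
  have hp₃ : σ₃.var 11 = p := by
    rw [fr₃.var 11 (by decide), fr₂.var 11 (by decide), fr₁.var 11 (by decide), hp]
  have h19 : σ₃.var 19 = σ₂.var 19 := fr₃.var 19 (by decide)
  obtain ⟨-, -, -, -, -, gl, gr⟩ := hR₃
  have hmap : ∀ L : List ℕ, (L.map (· + 1)).map (· + p) = L.map (· + (p + 1)) := by
    intro L
    rw [List.map_map]
    exact List.map_congr_left fun a _ => by simp only [Function.comp]; omega
  -- A recorded depth is paid for by halving: if `l` is the smaller child, then `2 * (l.size + 1) ≤
  -- l.size + r.size + 2`.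
  have hlog : ∀ a b : ℕ, 2 * a ≤ b → 1 ≤ a → Nat.log 2 a + 1 ≤ Nat.log 2 b := by
    intro a b hab ha
    calc Nat.log 2 a + 1 = Nat.log 2 (a * 2) := (Nat.log_mul_base (by norm_num) (by omega)).symm
      _ ≤ _ := Nat.log_mono_right (by omega)
  simp only [moveSide, wp_seq, wp_ite, wp_setVar, inc, Test.Holds, NExpr.value, Test.cost,
    NExpr.cost, h19]
  rcases hcase with ⟨hl, hdir, hif⟩ | ⟨hr, hdir, hif⟩
  · refine ⟨fun _ => ⟨by omega, by simp [hp₃], l, _, P', ?_, hD₃, ?_, ?_⟩,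
      fun h => absurd hdir h⟩
    · simpa [rep_setV] using gl
    · exact ⟨by simpa using hP₃.1, hP₃.2⟩
    · simp only [hdir, iff_true]
      obtain ⟨a, ha, hat⟩ := hl
      refine ⟨⟨a, by simp [ha, hat]⟩, Finset.filter_subset _ _, ?_, fun e he => ?_, fun e he => ?_,
        ?_⟩
      · simp only [WTree.size]; omega
      · simp only [WTree.cand, if_pos (Finset.mem_filter.1 he).2]
        split_ifs at hif ⊢ with h
        · rw [hif.1, List.map_append, hmap]; simp
        · rw [hif, List.map_append, hmap]; simp
      · simp only [WTree.leafOf, if_pos (Finset.mem_filter.1 he).2]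
      · simp only [WTree.size]
        split_ifs at hif with h
        · rw [hif.1]
          have := hlog (l.size + 1) (l.size + r.size + 1 + 1) (by omega) (by omega)
          simp only [List.length_append, List.length_singleton]
          omega
        · rw [hif]
          gcongr
          omega
  · refine ⟨fun h => absurd h hdir, fun _ => ⟨by omega, by simp [hp₃], r, _, P', ?_, hD₃, ?_, ?_⟩⟩
    · simpa [rep_setV] using gr
    · exact ⟨by simpa using hP₃.1, hP₃.2⟩
    · simp only [hdir, iff_false, not_le]
      obtain ⟨a, ha, hat⟩ := hr
      refine ⟨⟨a, by simp [ha, hat]⟩, Finset.filter_subset _ _, ?_, fun e he => ?_, fun e he => ?_,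
        ?_⟩
      · simp only [WTree.size]; omega
      · simp only [WTree.cand, if_neg (not_le.2 (Finset.mem_filter.1 he).2)]
        split_ifs at hif ⊢ with h
        · rw [hif.1, List.map_append, hmap]; simp
        · rw [hif, List.map_append, hmap]; simp
      · simp only [WTree.leafOf, if_neg (not_le.2 (Finset.mem_filter.1 he).2)]
      · simp only [WTree.size]
        split_ifs at hif with h
        · rw [hif.1]
          have := hlog (r.size + 1) (l.size + r.size + 1 + 1) (by omega) (by omega)
          simp only [List.length_append, List.length_singleton]
          omega
        · rw [hif]
          gcongr
          omega

theorem wp_descend {N : ℕ} {σ : State} {R : WTree n d} {D : Finset (Fin n)}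
    (hR : Rep E σ N (σ.var 7) R) (hD : Flags σ D) (hne : D.Nonempty) :
    wp E descend (fun T τ => T ≤ 500 * ((n + 1) * (R.size + 1)) ∧ ∃ e ∈ D, τ.var 13 = e ∧
      τ.var 14 = R.leafOf (E.ex e) ∧ Depths τ (R.cand E D e) ∧
      (R.cand E D e).length ≤ 1 + Nat.log 2 (R.size + 1)) σ := by
  simp only [descend, wp_seq, wp_setVar, NExpr.value]
  -- Here `P` holds the candidates above the current vertex, at absolute depths. The candidates in
  -- the subtree `R'` have to be shifted by the current depth in register `11`.
  refine wp_while (fun T τ => ∃ R' D' P, Rep E τ N (τ.var 9) R' ∧ Flags τ D' ∧ D'.Nonempty ∧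
    D' ⊆ D ∧ Depths τ P ∧
    (∀ e ∈ D', R.cand E D e = P ++ (R'.cand E D' e).map (· + τ.var 11)) ∧
    (∀ e ∈ D', R.leafOf (E.ex e) = R'.leafOf (E.ex e)) ∧
    P.length + Nat.log 2 (R'.size + 1) ≤ Nat.log 2 (R.size + 1) ∧
    T + 310 * (n + 1) * R'.size ≤ 310 * (n + 1) * R.size) (fun τ => τ.nat 4 (τ.var 9))
    ⟨R, D, [], ?_, hD, hne, subset_rfl, ⟨by simp, by simp⟩, ?_, fun _ _ => rfl, by simp,
      by omega⟩ ?_ ?_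
  · simpa [rep_setV] using hR
  · simp
  · rintro T τ fr ⟨R', D', P, h1, h2, h3, h4, h5, h6, h7, h8, h9⟩ hb
    cases R' with
    | leaf w => simp [Test.Holds, NExpr.value, h1.2.1] at hb
    | node i t l r =>
      refine wp_mono (wp_descendBody h1 h2 h3 rfl h5) ?_
      rintro T' υ ⟨ht, g11, R'', D'', P'', k1, k2, k3, k4, k5, k6, k7, k8, k9⟩ fr'
      refine ⟨⟨R'', D'', P'', k1, k2, k4, k5.trans h4, k3, fun e he => ?_, fun e he => ?_,
        k9.trans h8, ?_⟩, ?_⟩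
      · rw [h6 e (k5 he), g11, k7 e he]
      · rw [h7 e (k5 he), k8 e he]
      · simp only [Test.cost, NExpr.cost]
        nlinarith
      · rw [k1.size_eq, h1.size_eq]
        exact k6
  · rintro T τ fr ⟨R', D', P, h1, h2, h3, h4, h5, h6, h7, h8, h9⟩ hb
    cases R' with
    | node i t l r => simp [Test.Holds, NExpr.value, h1.2.1] at hb
    | leaf w =>
      simp only [wp_setNat, inc, wp_setVar, NExpr.value]
      refine wp_mono (wp_findDirty (D := D') ?_ h3) ?_
      · exact fun a => by simpa using h2 a
      rintro T' υ ⟨ht, e, he, h13⟩ fr'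
      have hc := h6 e he
      simp only [WTree.cand, List.map_cons, zero_add, List.map_nil] at hc
      refine ⟨?_, e, h4 he, h13, ?_, ?_, ?_⟩
      · simp only [Test.cost, NExpr.cost]
        nlinarith
      · rw [fr'.var 14 (by decide), h7 e he]
        simpa [WTree.leafOf] using h1.2.2.2.2
      · rw [hc]
        refine h5.append ?_ ?_
        · rw [fr'.var 12 (by decide)]; simp
        · intro k; rw [fr'.nat 8 (by decide)]; simp
      · rw [hc]
        simp only [List.length_append, List.length_singleton]
        omega

end

/-! ### Programs that create the children of a tree -/

/-- Store at the next free cell an inner vertex with a subtree larger by one than the current. -/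
def newInner (f : NExpr) (x : RExpr) : Prog :=
  .setNat 1 (var 4) f ;; .setReal 0 (var 4) x ;; .setNat 0 (var 4) (const 1) ;;
    .setNat 4 (var 4) (add (get 4 (var 9)) (const 1))

/-- Set the children at the next free cell, and use up this cell. -/
def link (l r : NExpr) : Prog := .setNat 2 (var 4) l ;; .setNat 3 (var 4) r ;; inc 4

/-- Store a leaf with the dirty example as witness. -/
def newLeaf : Prog :=
  .setNat 0 (var 4) (const 0) ;; .setNat 1 (var 4) (label (var 13)) ;;
    .setNat 4 (var 4) (const 0) ;; .setNat 5 (var 4) (var 13) ;; inc 4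

/-- Copy the current vertex to a new cell and move on along the path of the dirty example. -/
def copyBody : Prog :=
  newInner (get 1 (var 9)) (get 0 (var 9)) ;;
    .ite (rle (input (var 13) (get 1 (var 9))) (get 0 (var 9)))
      -- The child on the path is the vertex stored next, hence at the following cell; the child off
      -- the path is shared with the old tree.
      (link (add (var 4) (const 1)) (get 3 (var 9)) ;; .setVar 9 (get 2 (var 9)))
      (link (get 2 (var 9)) (add (var 4) (const 1)) ;; .setVar 9 (get 3 (var 9))) ;;
    .setVar 21 (sub (var 21) (const 1))

/-- Store a new vertex with the current cut above the current vertex, and a new leaf. -/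
def insertCut : Prog :=
  newInner (var 16) (get 1 (const 0)) ;;
    .ite (rle (input (var 13) (var 16)) (get 1 (const 0)))
      (link (add (var 4) (const 1)) (var 9)) (link (var 9) (add (var 4) (const 1))) ;;
    newLeaf

/-- Store the tree that arises by inserting the current cut at depth `21` below the current
vertex. -/
def build : Prog := .while (le (const 1) (var 21)) copyBody ;; insertCut

/-- Append to the queue the tree with the current cut at the current candidate. -/
def child : Prog :=
  .setNat 6 (var 1) (var 4) ;; inc 1 ;; .setVar 9 (var 7) ;; .setVar 21 (get 8 (var 20)) ;; build

/-- Append to the queue the trees with the current cut. -/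
def children : Prog :=
  .setVar 20 (const 0) ;; .while (ltT (var 20) (var 12)) (child ;; inc 20)

/-- Compare the next threshold with the value of the current example. -/
def nextBody : Prog :=
  .ite (rle (input (var 8) (var 16)) (get 1 (const 0))) skip
    (.ite (rle (input (var 8) (var 16)) (get 1 (const 2)))
      (.setReal 1 (const 2) (input (var 8) (var 16))) skip) ;; inc 8

/-- Move to the next threshold of the current feature. -/
def nextThreshold : Prog :=
  .setReal 1 (const 2) (get 1 (const 1)) ;; .setVar 8 (const 0) ;;
    .while (ltT (var 8) numExamples) nextBody ;; .setReal 1 (const 0) (get 1 (const 2))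

/-- Append to the queue the trees with cuts in the current feature. -/
def cuts : Prog :=
  .while (.not (rle (get 1 (const 1)) (get 1 (const 0)))) (children ;; nextThreshold)

/-- Process one feature of the list. -/
def featureBody : Prog :=
  .setVar 16 (get 11 (var 15)) ;;
    .ite (rle (input (var 13) (var 16)) (input (var 14) (var 16)))
      (.setReal 1 (const 0) (input (var 13) (var 16)) ;;
        .setReal 1 (const 1) (input (var 14) (var 16)))
      (.setReal 1 (const 0) (input (var 14) (var 16)) ;;
        .setReal 1 (const 1) (input (var 13) (var 16))) ;;
    cuts ;; inc 15

/-- Append to the queue the trees with cuts in the listed features. -/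
def features : Prog := .setVar 15 (const 0) ;; .while (ltT (var 15) (var 5)) featureBody

/-! ### Verification of the list of features and of a single insertion -/

section

variable {n d : ℕ} (E : DataSet n d)

/-- The list `Fl` of non-constant features is stored. -/
structure Listed (σ : State) (Fl : List (Fin d)) : Prop where
  length : σ.var 5 = Fl.length
  get : ∀ k i, Fl[k]? = some i → σ.nat 11 k = (i : Fin d)
  nodup : Fl.Nodup
  flag : ∀ i : Fin d, σ.nat 10 i = if i ∈ Fl then 1 else 0
  nonconst : ∀ i ∈ Fl, ∃ a b, E.ex a i ≠ E.ex b i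

/-- The examples whose features have been listed. -/
def seen (n : ℕ) (σ : State) : Finset (Fin n) := Finset.univ.filter fun a => σ.nat 9 a ≠ 0

/-- Features in which a seen example differs from the first example are in the list. -/
def Covers (σ : State) (Fl : List (Fin d)) : Prop :=
  ∀ a z : Fin n, z.1 = 0 → a ∈ seen n σ → ∀ i, E.ex a i ≠ E.ex z i → i ∈ Fl

/-- The queue consists of the trees in `Q`. -/
def Queue (σ : State) (Q : List (WTree n d)) : Prop :=
  σ.var 1 = Q.length ∧ ∀ m R, Q[m]? = some R → Rep E σ (σ.var 4) (σ.nat 6 m) R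

/-- The tree `R` is current, with a dirty example `e`. -/
structure Current (σ : State) (R : WTree n d) (D : Finset (Fin n)) (e : Fin n) : Prop where
  rep : Rep E σ (σ.var 4) (σ.var 7) R
  dirty : σ.var 13 = e
  wit : σ.var 14 = R.leafOf (E.ex e)
  depths : Depths σ (R.cand E D e)

variable {E}

/-- The time is amortized: a scan of all features marks a new example as seen, and the growth of
`seen` pays for it. For an example seen before the cost is constant. -/
theorem wp_scan {σ : State} {Fl : List (Fin d)} {e : Fin n} (he : σ.var 13 = e)
    (hF : Listed E σ Fl) (hC : Covers E σ Fl) :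
    wp E scan (fun T τ => seen n τ = insert e (seen n σ) ∧
      T + 100 * (d + 1) * (seen n σ).card ≤ 100 + 100 * (d + 1) * (seen n τ).card ∧
      ∃ Fl', Listed E τ Fl' ∧ Covers E τ Fl') σ := by
  simp only [scan, wp_ite, Test.Holds, NExpr.value, he]
  refine ⟨fun h => ?_, fun h => ?_⟩
  · have hes : e ∉ seen n σ := by simpa [seen] using h
    have z : Fin n := ⟨0, e.pos⟩
    simp only [wp_seq, wp_setNat, wp_setVar, NExpr.value, he]
    refine wp_mono (wp_for (fun k τ => τ.var 16 = k ∧ ∃ Fl', Listed E τ Fl' ∧ Fl ⊆ Fl' ∧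
      ∀ z : Fin n, z.1 = 0 → ∀ i : Fin d, i.1 < k → E.ex e i ≠ E.ex z i → i ∈ Fl') d 60
        ?_ ?_ ?_) ?_
    · refine ⟨by simp, Fl, ⟨?_, ?_, hF.nodup, ?_, hF.nonconst⟩, fun _ h => h, by simp⟩
      · simpa using hF.length
      · simpa using hF.get
      · simpa using hF.flag
    · rintro k τ hk fr ⟨h1, Fl', h2, h3, h4⟩
      refine ⟨by rw [ltT_holds]; simpa [NExpr.value, h1] using hk, ?_⟩
      have he' : τ.var 13 = e := by rw [fr.var 13 (by decide)]; simpa using he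
      have hz : (⟨0, e.pos⟩ : Fin n).1 = 0 := rfl
      have v1 : (input (var 13) (var 16)).value E τ = E.ex e ⟨k, hk⟩ := value_input he' h1
      have v2 : (input (const 0) (var 16)).value E τ = E.ex ⟨0, e.pos⟩ ⟨k, hk⟩ :=
        value_input rfl h1
      have hflag : τ.nat 10 k = _ := h2.flag ⟨k, hk⟩
      -- The two outcomes of an iteration are `same`, where the list is kept, and `new`, where the
      -- feature `k` is appended.
      have same : ((⟨k, hk⟩ : Fin d) ∈ Fl' ∨ E.ex e ⟨k, hk⟩ = E.ex ⟨0, e.pos⟩ ⟨k, hk⟩) →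
          ∀ υ : State, υ.var 5 = τ.var 5 → υ.nat = τ.nat → ∃ Fl'', Listed E υ Fl'' ∧ Fl ⊆ Fl'' ∧
          ∀ z : Fin n, z.1 = 0 → ∀ i : Fin d, i.1 < k + 1 → E.ex e i ≠ E.ex z i → i ∈ Fl'' := by
        intro hh υ e1 e2
        refine ⟨Fl', ⟨e1.trans h2.length, e2 ▸ h2.get, h2.nodup, e2 ▸ h2.flag, h2.nonconst⟩, h3,
          fun z hz i hi hne => ?_⟩
        rcases Nat.lt_succ_iff_lt_or_eq.1 hi with h' | h'
        · exact h4 z hz i h' hne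
        · obtain rfl : i = ⟨k, hk⟩ := Fin.ext h'
          obtain rfl : z = ⟨0, e.pos⟩ := Fin.ext hz
          exact hh.resolve_right hne
      have new : (⟨k, hk⟩ : Fin d) ∉ Fl' → E.ex e ⟨k, hk⟩ ≠ E.ex ⟨0, e.pos⟩ ⟨k, hk⟩ →
          ∀ υ : State, υ.var 5 = τ.var 5 + 1 →
          (∀ j, υ.nat 11 j = if j = τ.var 5 then k else τ.nat 11 j) →
          (∀ j, υ.nat 10 j = if j = k then 1 else τ.nat 10 j) → ∃ Fl'', Listed E υ Fl'' ∧
          Fl ⊆ Fl'' ∧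
          ∀ z : Fin n, z.1 = 0 → ∀ i : Fin d, i.1 < k + 1 → E.ex e i ≠ E.ex z i → i ∈ Fl'' := by
        intro hnot hne υ e5 e11 e10
        refine ⟨Fl' ++ [⟨k, hk⟩], ⟨by simp [e5, h2.length], fun m i hm => ?_, ?_, fun i => ?_, ?_⟩,
          fun i hi => List.mem_append_left _ (h3 hi), fun z hz i hi hne' => ?_⟩
        · rw [e11, h2.length]
          rcases lt_trichotomy m Fl'.length with hlt | rfl | hlt
          · rw [List.getElem?_append_left hlt] at hm
            rw [if_neg hlt.ne, h2.get m i hm]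
          · simp at hm
            simp [← hm]
          · rw [List.getElem?_eq_none (by simp; omega)] at hm
            simp at hm
        · rw [List.nodup_append]
          refine ⟨h2.nodup, by simp, fun a ha b hb => ?_⟩
          rintro rfl
          rw [List.mem_singleton] at hb
          exact hnot (hb ▸ ha)
        · rw [e10, h2.flag]
          by_cases hik : (i : ℕ) = k
          · obtain rfl : i = ⟨k, hk⟩ := Fin.ext hik
            simp
          · have : i ≠ ⟨k, hk⟩ := fun h => hik (by rw [h])
            simp [hik, this]
        · intro i hi
          rcases List.mem_append.1 hi with hi | hi
          · exact h2.nonconst i hi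
          · rw [List.mem_singleton] at hi
            exact ⟨_, _, hi ▸ hne⟩
        · rcases Nat.lt_succ_iff_lt_or_eq.1 hi with h' | h'
          · exact List.mem_append_left _ (h4 z hz i h' hne')
          · exact List.mem_append_right _ (by simp [Fin.ext_iff, h'])
      simp only [scanBody, listFeature, wp_seq, wp_ite, wp_setVar, wp_setNat, inc, skip, Test.Holds,
        v1, v2, Test.cost, NExpr.cost, RExpr.cost]
      simp only [NExpr.value, State.setV_var, State.setN_var, h1, hflag]
      by_cases hmem : (⟨k, hk⟩ : Fin d) ∈ Fl'
      · simp only [hmem, if_true]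
        refine ⟨fun h => absurd h (by omega), fun _ => ⟨by omega, by simp, same (.inl hmem) _ ?_ ?_⟩⟩
        · simp
        · simp
      · simp only [hmem, if_false]
        refine ⟨fun _ => ⟨fun hle => ⟨fun hge => ⟨by omega, by simp,
          same (.inr (le_antisymm hle hge)) _ ?_ ?_⟩, fun hge => ⟨by omega, by simp,
          new hmem (fun h => hge h.ge) _ ?_ ?_ ?_⟩⟩, fun hle => ⟨by omega, by simp,
          new hmem (fun h => hle h.le) _ ?_ ?_ ?_⟩⟩, fun h => absurd (le_refl 0) h⟩ <;> simp
    · rintro τ fr ⟨h1, -⟩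
      rw [ltT_holds]
      simp [NExpr.value, h1]
    · rintro T τ ⟨hT, -, Fl', h2, h3, h4⟩ fr
      have hs : seen n τ = insert e (seen n σ) := by
        ext a
        simp only [seen, Finset.mem_filter, Finset.mem_univ, true_and, fr.nat 9 (by decide),
          Finset.mem_insert, State.setV_nat, State.setN_nat, if_true]
        by_cases hae : a = e
        · simp [hae]
        · simp [hae, Fin.val_inj]
      refine ⟨hs, ?_, Fl', h2, fun a z hz ha i hne => ?_⟩
      · rw [hs, Finset.card_insert_of_notMem hes]
        simp only [ltT, Test.cost, NExpr.cost] at hT ⊢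
        nlinarith
      · rw [hs, Finset.mem_insert] at ha
        rcases ha with rfl | ha
        exacts [h4 z hz i i.isLt hne, h3 (hC a z hz ha i hne)]
  · have hes : e ∈ seen n σ := by simpa [seen, Nat.pos_iff_ne_zero] using h
    have hs : seen n (σ.setV 22 0) = seen n σ := rfl
    simp only [skip, wp_setVar, NExpr.value, hs, Test.cost, NExpr.cost]
    refine ⟨(Finset.insert_eq_of_mem hes).symm, by omega, Fl, ⟨?_, hF.get, hF.nodup, hF.flag,
      hF.nonconst⟩, hC⟩
    simpa using hF.length

/-- The memory differs at most in vertices stored at or above `N`. -/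
structure Grows (N : ℕ) (σ τ : State) : Prop where
  agree : Agree N σ τ
  nat : ∀ a, 5 < a → τ.nat a = σ.nat a
  real : ∀ a, 0 < a → τ.real a = σ.real a

theorem Grows.trans {N M : ℕ} {σ τ υ : State} (h : Grows N σ τ) (h' : Grows M τ υ) (hNM : N ≤ M) :
    Grows N σ υ :=
  ⟨h.agree.trans h'.agree hNM, fun a ha => (h'.nat a ha).trans (h.nat a ha),
    fun a ha => (h'.real a ha).trans (h.real a ha)⟩

/-- The expression `x` is evaluated after array `1` has been written, so its value must depend only
on registers and real arrays. -/
theorem wp_newInner {σ : State} {f : NExpr} {x : RExpr} {t : ℝ}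
    (hx : ∀ τ : State, τ.var = σ.var → τ.real = σ.real → x.value E τ = t) (hf : f.cost ≤ 5)
    (hx' : x.cost ≤ 5) :
    wp E (newInner f x) (fun T τ => T ≤ 30 ∧ τ.var = σ.var ∧ Grows (σ.var 4) σ τ ∧
      τ.nat 0 (σ.var 4) = 1 ∧ τ.nat 1 (σ.var 4) = f.value E σ ∧ τ.real 0 (σ.var 4) = t ∧
      τ.nat 4 (σ.var 4) = σ.nat 4 (σ.var 9) + 1) σ := by
  simp only [newInner, wp_seq, wp_setNat, wp_setReal, NExpr.cost]
  simp only [NExpr.value, State.setN_var, State.setR_var]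
  rw [hx (σ.setN 1 (σ.var 4) (f.value E σ)) rfl rfl]
  refine ⟨by omega, trivial, ⟨fun v hv => ⟨fun a ha => ?_, ?_⟩, fun a ha => ?_, fun a ha => ?_⟩,
    ?_, ?_, ?_, ?_⟩
  · simp [hv.ne]
  · simp [hv.ne]
  · funext j
    simp [show a ≠ 0 by omega, show a ≠ 1 by omega, show a ≠ 4 by omega]
  · funext j
    simp [show a ≠ 0 by omega]
  all_goals simp

/-- The right address is computed after array `2` has been written; this dictates the form of `hr`.
-/
theorem wp_link {σ : State} {l r : NExpr} {x y : ℕ} (hl : l.value E σ = x)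
    (hr : ∀ τ : State, τ.var = σ.var → τ.nat 3 = σ.nat 3 → r.value E τ = y) (hl' : l.cost ≤ 5)
    (hr' : r.cost ≤ 5) :
    wp E (link l r) (fun T τ => T ≤ 30 ∧
      (∀ a, τ.var a = if a = 4 then σ.var 4 + 1 else σ.var a) ∧ Grows (σ.var 4) σ τ ∧
      (∀ a, a ≠ 2 → a ≠ 3 → τ.nat a = σ.nat a) ∧ τ.real = σ.real ∧
      τ.nat 2 (σ.var 4) = x ∧ τ.nat 3 (σ.var 4) = y) σ := by
  simp only [link, inc, wp_seq, wp_setNat, wp_setVar, NExpr.cost]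
  simp only [NExpr.value, State.setN_var, hl]
  rw [hr (σ.setN 2 (σ.var 4) x) rfl (by funext j; simp)]
  refine ⟨by omega, by simp, ⟨fun v hv => ⟨fun a ha => ?_, rfl⟩, fun a ha => ?_, fun a ha => rfl⟩,
    fun a h2 h3 => ?_, rfl, ?_, ?_⟩
  · simp [hv.ne]
  · funext j
    simp [show a ≠ 2 by omega, show a ≠ 3 by omega]
  · funext j
    simp [h2, h3]
  all_goals simp

theorem wp_newLeaf {σ : State} {e : Fin n} (he : σ.var 13 = e) :
    wp E newLeaf (fun T τ => T ≤ 30 ∧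
      (∀ a, τ.var a = if a = 4 then σ.var 4 + 1 else σ.var a) ∧ Grows (σ.var 4) σ τ ∧
      Rep E τ (σ.var 4 + 1) (σ.var 4) (.leaf e)) σ := by
  simp only [newLeaf, inc, wp_seq, wp_setNat, wp_setVar, NExpr.cost]
  rw [value_label (E := E) (a := e) (by simpa [NExpr.value] using he)]
  simp only [NExpr.value, State.setN_var, he]
  refine ⟨by omega, by simp, ⟨fun v hv => ⟨fun a ha => ?_, rfl⟩, fun a ha => ?_, fun a ha => rfl⟩,
    ?_, ?_, ?_, ?_, ?_⟩
  · simp [hv.ne]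
  · funext j
    simp [show a ≠ 0 by omega, show a ≠ 1 by omega, show a ≠ 4 by omega, show a ≠ 5 by omega]
  · omega
  all_goals simp

theorem wp_insertCut {σ : State} {R : WTree n d} {i : Fin d} {t : ℝ} {e : Fin n}
    (hR : Rep E σ (σ.var 4) (σ.var 9) R) (he : σ.var 13 = e) (hi : σ.var 16 = i)
    (ht : σ.real 1 0 = t) :
    wp E insertCut (fun T τ => T ≤ 110 ∧ Rep E τ (τ.var 4) (σ.var 4) (R.insAt E i t e 0) ∧
      Grows (σ.var 4) σ τ ∧ σ.var 4 ≤ τ.var 4) σ := by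
  simp only [insertCut, wp_seq]
  refine wp_mono (wp_newInner (t := t) (fun τ _ h => by simp [RExpr.value, NExpr.value, h, ht])
    (by simp [NExpr.cost]) (by simp [RExpr.cost, NExpr.cost])) ?_
  rintro T₁ σ₁ ⟨hT₁, hv₁, hg₁, c0, c1, c2, c3⟩ -
  have hin : (RExpr.input (var 13) (var 16)).value E σ₁ = E.ex e i :=
    value_input (by simp [NExpr.value, hv₁, he]) (by simp [NExpr.value, hv₁, hi])
  have hre : (RExpr.get 1 (const 0)).value E σ₁ = t := by
    simp [RExpr.value, NExpr.value, hg₁.real, ht]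
  -- Common to both orders of the children: after the new vertex has been linked, the leaf goes to
  -- the cell right behind it.
  have leafStep : ∀ (σ₂ : State), (∀ a, σ₂.var a = if a = 4 then σ₁.var 4 + 1 else σ₁.var a) →
      Grows (σ₁.var 4) σ₁ σ₂ → (∀ a, a ≠ 2 → a ≠ 3 → σ₂.nat a = σ₁.nat a) →
      σ₂.real = σ₁.real → wp E newLeaf (fun T τ => T ≤ 30 ∧ Grows (σ.var 4) σ τ ∧
        τ.var 4 = σ.var 4 + 2 ∧ Rep E τ (τ.var 4) (σ.var 4 + 1) (.leaf e) ∧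
        Rep E τ (τ.var 4) (σ.var 9) R ∧ τ.nat 0 (σ.var 4) = 1 ∧ τ.nat 1 (σ.var 4) = i ∧
        τ.real 0 (σ.var 4) = t ∧ τ.nat 4 (σ.var 4) = R.size + 1 ∧
        τ.nat 2 (σ.var 4) = σ₂.nat 2 (σ.var 4) ∧ τ.nat 3 (σ.var 4) = σ₂.nat 3 (σ.var 4)) σ₂ := by
    intro σ₂ h1 h2 h3 h4
    have h24 : σ₂.var 4 = σ.var 4 + 1 := by simp [h1, hv₁]
    refine wp_mono (wp_newLeaf (e := e) (by simp [h1, hv₁, he])) ?_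
    rintro T τ ⟨hT, k1, k2, k3⟩ -
    have h44 : τ.var 4 = σ.var 4 + 2 := by simp [k1, h24]
    have hg : Grows (σ.var 4) σ τ :=
      (hg₁.trans h2 (by rw [hv₁])).trans k2 (by rw [h24]; omega)
    have hk := k2.agree (σ.var 4) (by omega)
    refine ⟨hT, hg, h44, ?_, hR.mono (by omega) hg.agree, ?_, ?_, ?_, ?_, ?_, ?_⟩
    · rw [h24] at k3
      rw [h44]
      exact k3
    · rw [hk.1 0 (by norm_num), h3 0 (by norm_num) (by norm_num), c0]
    · rw [hk.1 1 (by norm_num), h3 1 (by norm_num) (by norm_num), c1]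
      exact hi
    · rw [hk.2, h4, c2]
    · rw [hk.1 4 (by norm_num), h3 4 (by norm_num) (by norm_num), c3, hR.size_eq]
    · rw [hk.1 2 (by norm_num)]
    · rw [hk.1 3 (by norm_num)]
  simp only [wp_ite, Test.Holds, hin, hre, Test.cost, NExpr.cost, RExpr.cost]
  refine ⟨fun hle => ?_, fun hle => ?_⟩
  · refine wp_mono (wp_link (x := σ.var 4 + 1) (y := σ.var 9) (by simp [NExpr.value, hv₁])
      (fun τ h _ => by simp [NExpr.value, h, hv₁]) (by simp [NExpr.cost])
      (by simp [NExpr.cost])) ?_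
    rintro T₂ σ₂ ⟨hT₂, l1, l2, l3, l4, l5, l6⟩ -
    refine wp_mono (leafStep σ₂ l1 l2 l3 l4) ?_
    rintro T τ ⟨hT, k1, k2, k3, k4, k5, k6, k7, k8, k9, k10⟩ -
    rw [hv₁] at l5 l6
    refine ⟨by omega, ?_, k1, by omega⟩
    rw [WTree.insAt, if_pos hle]
    refine ⟨by omega, k5, k6, k7, ?_, ?_, ?_⟩
    · rw [k8, WTree.size]; omega
    · rwa [k9, l5]
    · rwa [k10, l6]
  · refine wp_mono (wp_link (x := σ.var 9) (y := σ.var 4 + 1) (by simp [NExpr.value, hv₁])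
      (fun τ h _ => by simp [NExpr.value, h, hv₁]) (by simp [NExpr.cost])
      (by simp [NExpr.cost])) ?_
    rintro T₂ σ₂ ⟨hT₂, l1, l2, l3, l4, l5, l6⟩ -
    refine wp_mono (leafStep σ₂ l1 l2 l3 l4) ?_
    rintro T τ ⟨hT, k1, k2, k3, k4, k5, k6, k7, k8, k9, k10⟩ -
    rw [hv₁] at l5 l6
    refine ⟨by omega, ?_, k1, by omega⟩
    rw [WTree.insAt, if_neg hle]
    refine ⟨by omega, k5, k6, k7, ?_, ?_, ?_⟩
    · rw [k8, WTree.size]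
    · rwa [k9, l5]
    · rwa [k10, l6]

/-- Only the path above the insertion is copied, in time linear in the size. All that hangs off it
is shared, which is sound because new cells lie above the used ones. -/
theorem wp_build {p : ℕ} : ∀ {σ : State} {R : WTree n d} {D : Finset (Fin n)} {i : Fin d} {t : ℝ}
    {e : Fin n}, Rep E σ (σ.var 4) (σ.var 9) R → σ.var 13 = e → σ.var 16 = i →
    σ.real 1 0 = t → σ.var 21 = p → p ∈ R.cand E D e →
    wp E build (fun T τ => T ≤ 150 * (R.size + 1) ∧
      Rep E τ (τ.var 4) (σ.var 4) (R.insAt E i t e p) ∧ Grows (σ.var 4) σ τ ∧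
      σ.var 4 ≤ τ.var 4) σ := by
  induction p with
  | zero =>
    intro σ R D i t e hR he hi ht hp hc
    rw [build, wp_seq, wp_while_unfold]
    refine ⟨fun h => absurd h (by simp [Test.Holds, NExpr.value, hp]), fun _ => ?_⟩
    refine wp_mono (wp_insertCut hR he hi ht) ?_
    rintro T τ ⟨hT, h⟩ -
    exact ⟨by simp only [Test.cost, NExpr.cost]; omega, h⟩
  | succ p ih =>
    intro σ R D i t e hR he hi ht hp hc
    cases R with
    | leaf w => simp [WTree.cand] at hc
    | node j u l r =>
      rw [build, wp_seq, wp_while_unfold]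
      refine ⟨fun _ => ?_, fun h => absurd (by simp [Test.Holds, NExpr.value, hp]) h⟩
      -- After one iteration the rest of the loop followed by the insertion is again `build`, with
      -- the time `c` already spent. This form fits the induction hypothesis.
      have fuse : ∀ (c B : ℕ) (Q : State → Prop) (τ : State),
          wp E build (fun T υ => c + T + 1 ≤ B ∧ Q υ) τ →
          wp E (.while (le (const 1) (var 21)) copyBody) (fun t' υ => wp E insertCut
            (fun t'' υ => c + t' + 1 + t'' ≤ B ∧ Q υ) υ) τ := by
        intro c B Q τ h
        rw [build, wp_seq] at h
        refine wp_mono h fun t' υ h' _ => wp_mono h' fun t'' υ' h'' _ => ⟨by omega, h''.2⟩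
      obtain ⟨g0, g1, g2, g3, g4, g5, g6⟩ := id hR
      simp only [copyBody] at fuse ⊢
      rw [wp_seq]
      refine wp_mono (wp_newInner (t := u)
        (fun τ h h' => by simp [RExpr.value, NExpr.value, h, h', g3])
        (by simp [NExpr.cost]) (by simp [RExpr.cost, NExpr.cost])) ?_
      rintro T₁ σ₁ ⟨hT₁, hv₁, hg₁, c0, c1, c2, c3⟩ -
      have hk₁ := hg₁.agree _ g0
      have hin : (RExpr.input (var 13) (get 1 (var 9))).value E σ₁ = E.ex e j :=
        value_input (by simp [NExpr.value, hv₁, he])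
          (by simp [NExpr.value, hv₁, hk₁.1 1, g2])
      have hre : (RExpr.get 0 (var 9)).value E σ₁ = u := by
        simp [RExpr.value, NExpr.value, hv₁, hk₁.2, g3]
      simp only [NExpr.value, g2] at c1
      rw [g4] at c3
      simp only [wp_seq, wp_ite, Test.Holds, hin, hre, Test.cost, NExpr.cost, RExpr.cost]
      -- Build the rest below the child `R'` on the path. The copied vertex lies below the new first
      -- free cell, so it is not overwritten.
      have finish : ∀ (R' : WTree n d) (D' : Finset (Fin n)) (σ₂ : State), R'.size < l.size + r.size + 1 →
          p ∈ R'.cand E D' e → (∀ a, σ₂.var a = if a = 4 then σ₁.var 4 + 1 else σ₁.var a) →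
          Grows (σ₁.var 4) σ₁ σ₂ → (∀ a, a ≠ 2 → a ≠ 3 → σ₂.nat a = σ₁.nat a) →
          σ₂.real = σ₁.real → ∀ v, Rep E σ (σ.var 4) v R' →
          wp E build (fun T τ => T ≤ 150 * (R'.size + 1) ∧ Grows (σ.var 4) σ τ ∧
            σ.var 4 < τ.var 4 ∧ Rep E τ (τ.var 4) (σ.var 4 + 1) (R'.insAt E i t e p) ∧
            τ.nat 0 (σ.var 4) = 1 ∧ τ.nat 1 (σ.var 4) = j ∧
            τ.real 0 (σ.var 4) = u ∧ τ.nat 4 (σ.var 4) = l.size + r.size + 1 + 1 ∧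
            τ.nat 2 (σ.var 4) = σ₂.nat 2 (σ.var 4) ∧ τ.nat 3 (σ.var 4) = σ₂.nat 3 (σ.var 4))
            ((σ₂.setV 9 v).setV 21 p) := by
        intro R' D' σ₂ _ hp' h1 h2 h3 h4 v hv
        have h24 : σ₂.var 4 = σ.var 4 + 1 := by simp [h1, hv₁]
        have hg₂ : Grows (σ.var 4) σ σ₂ := hg₁.trans h2 (by rw [hv₁])
        refine wp_mono (ih (R := R') (D := D') (i := i) (t := t) (e := e) ?_ ?_ ?_ ?_ ?_ hp') ?_
        · simp only [rep_setV]
          simpa using hv.mono (by omega) hg₂.agree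
        · simp [h1, hv₁, he]
        · simp [h1, hv₁, hi]
        · simp [hg₂.real, ht]
        · simp
        rintro T τ ⟨hT, k1, k2, k3⟩ -
        simp only [State.setV_var, Nat.reduceEqDiff, if_false, h24] at k1 k2 k3
        have k2' : Grows (σ.var 4 + 1) σ₂ τ := ⟨k2.agree, k2.nat, k2.real⟩
        have hk := k2'.agree (σ.var 4) (by omega)
        refine ⟨hT, hg₂.trans k2' (by omega), by omega, k1, ?_, ?_, ?_, ?_, ?_, ?_⟩
        · rw [hk.1 0 (by norm_num), h3 0 (by norm_num) (by norm_num), c0]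
        · rw [hk.1 1 (by norm_num), h3 1 (by norm_num) (by norm_num), c1]
        · rw [hk.2, h4, c2]
        · rw [hk.1 4 (by norm_num), h3 4 (by norm_num) (by norm_num), c3]
        · rw [hk.1 2 (by norm_num)]
        · rw [hk.1 3 (by norm_num)]
      simp only [WTree.cand] at hc
      refine ⟨fun hle => ?_, fun hle => ?_⟩
      · rw [if_pos hle] at hc
        have hc' : p ∈ l.cand E (D.filter fun a => E.ex a j ≤ u) e := by
          split_ifs at hc <;> simpa using hc
        refine wp_mono (wp_link (x := σ.var 4 + 1) (y := σ.nat 3 (σ.var 9))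
          (by simp [NExpr.value, hv₁])
          (fun τ h h' => by simp [NExpr.value, h, h', hv₁, hk₁.1 3]) (by simp [NExpr.cost])
          (by simp [NExpr.cost])) ?_
        rintro T₂ σ₂ ⟨hT₂, l1, l2, l3, l4, l5, l6⟩ -
        have e9 : σ₂.var 9 = σ.var 9 := by simp [l1, hv₁]
        have e21 : σ₂.var 21 = p + 1 := by simp [l1, hv₁, hp]
        have e2 : σ₂.nat 2 (σ.var 9) = σ.nat 2 (σ.var 9) :=
          (hg₁.trans l2 (by rw [hv₁])).agree _ g0 |>.1 2 (by norm_num)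
        simp only [wp_setVar, NExpr.value, e9, e2, State.setV_var, e21, Nat.reduceEqDiff, if_false,
          Nat.add_sub_cancel, NExpr.cost]
        refine fuse _ _ _ _ (wp_mono (finish l _ σ₂ (by omega) hc' l1 l2 l3 l4 _ g5) ?_)
        rintro T τ ⟨hT, k1, k2, k3, k4, k5, k6, k7, k8, k9⟩ -
        rw [hv₁] at l5 l6
        simp only [WTree.insAt, if_pos hle, WTree.size]
        refine ⟨by omega, ⟨k2, k4, k5, k6, ?_, ?_, ?_⟩, k1, k2.le⟩
        · rw [k7, WTree.size_insAt hc']; omega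
        · rwa [k8, l5]
        · rw [k9, l6]; exact g6.mono k2.le k1.agree
      · rw [if_neg hle] at hc
        have hc' : p ∈ r.cand E (D.filter fun a => u < E.ex a j) e := by
          split_ifs at hc <;> simpa using hc
        refine wp_mono (wp_link (x := σ.nat 2 (σ.var 9)) (y := σ.var 4 + 1)
          (by simp [NExpr.value, hv₁, hk₁.1 2])
          (fun τ h _ => by simp [NExpr.value, h, hv₁]) (by simp [NExpr.cost])
          (by simp [NExpr.cost])) ?_
        rintro T₂ σ₂ ⟨hT₂, l1, l2, l3, l4, l5, l6⟩ -
        have e9 : σ₂.var 9 = σ.var 9 := by simp [l1, hv₁]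
        have e21 : σ₂.var 21 = p + 1 := by simp [l1, hv₁, hp]
        have e3 : σ₂.nat 3 (σ.var 9) = σ.nat 3 (σ.var 9) :=
          (hg₁.trans l2 (by rw [hv₁])).agree _ g0 |>.1 3 (by norm_num)
        simp only [wp_setVar, NExpr.value, e9, e3, State.setV_var, e21, Nat.reduceEqDiff, if_false,
          Nat.add_sub_cancel, NExpr.cost]
        refine fuse _ _ _ _ (wp_mono (finish r _ σ₂ (by omega) hc' l1 l2 l3 l4 _ g6) ?_)
        rintro T τ ⟨hT, k1, k2, k3, k4, k5, k6, k7, k8, k9⟩ -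
        rw [hv₁] at l5 l6
        simp only [WTree.insAt, if_neg hle, WTree.size]
        refine ⟨by omega, ⟨k2, k4, k5, k6, ?_, ?_, ?_⟩, k1, k2.le⟩
        · rw [k7, WTree.size_insAt hc']; omega
        · rw [k8, l5]; exact g5.mono k2.le k1.agree
        · rwa [k9, l6]

end

/-! ### Enumeration of all children of a tree -/

section

variable {n d : ℕ} {E : DataSet n d}

/-- Each threshold yields at least one child, which can be charged for the linear search for the
next threshold. -/
theorem WTree.length_cand_pos (R : WTree n d) (D : Finset (Fin n)) (e : Fin n) :
    0 < (R.cand E D e).length := by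
  induction R generalizing D with
  | leaf w => simp [cand]
  | node j u l r ihl ihr =>
    simp only [cand]
    split_ifs <;> simp only [List.length_append, List.length_map]
    all_goals first
      | exact Nat.add_pos_right _ (ihl _)
      | exact Nat.add_pos_right _ (ihr _)

theorem Queue.of_frame {P : Prog} {σ τ : State} {Q : List (WTree n d)} (hQ : Queue E σ Q)
    (fr : P.Frame σ τ) (h1 : 1 ∉ P.vars) (h4 : 4 ∉ P.vars) (hn : ∀ a ≤ 6, a ∉ P.nats)
    (hr : 0 ∉ P.reals) : Queue E τ Q :=
  ⟨by rw [fr.var 1 h1, hQ.1], fun m R hm => by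
    rw [fr.nat 6 (hn 6 le_rfl), fr.var 4 h4]
    exact (hQ.2 m R hm).mono le_rfl (fr.agree _ (fun a ha => hn a (by omega)) hr)⟩

theorem Current.of_frame {P : Prog} {σ τ : State} {R : WTree n d} {D : Finset (Fin n)} {e : Fin n}
    (h : Current E σ R D e) (fr : P.Frame σ τ)
    (hv : 4 ∉ P.vars ∧ 7 ∉ P.vars ∧ 12 ∉ P.vars ∧ 13 ∉ P.vars ∧ 14 ∉ P.vars)
    (hn : (∀ a ≤ 5, a ∉ P.nats) ∧ 8 ∉ P.nats) (hr : 0 ∉ P.reals) : Current E τ R D e where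
  rep := by
    rw [fr.var 4 hv.1, fr.var 7 hv.2.1]
    exact h.rep.mono le_rfl (fr.agree _ hn.1 hr)
  dirty := by rw [fr.var 13 hv.2.2.2.1, h.dirty]
  wit := by rw [fr.var 14 hv.2.2.2.2, h.wit]
  depths := by
    simpa only [Depths, fr.var 12 hv.2.2.1, fr.nat 8 hn.2] using h.depths

theorem Queue.setV {σ : State} {Q : List (WTree n d)} (hQ : Queue E σ Q) {x k : ℕ} (h1 : 1 ≠ x)
    (h4 : 4 ≠ x) : Queue E (σ.setV x k) Q :=
  ⟨by simpa [h1] using hQ.1, fun m R hm => by simpa [rep_setV, h4] using hQ.2 m R hm⟩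

theorem Current.setV {σ : State} {R : WTree n d} {D : Finset (Fin n)} {e : Fin n}
    (h : Current E σ R D e) {x k : ℕ} (hx : 4 ≠ x ∧ 7 ≠ x ∧ 12 ≠ x ∧ 13 ≠ x ∧ 14 ≠ x) :
    Current E (σ.setV x k) R D e where
  rep := by simpa [rep_setV, hx] using h.rep
  dirty := by simpa [hx] using h.dirty
  wit := by simpa [hx] using h.wit
  depths := ⟨by simpa [hx] using h.depths.1, h.depths.2⟩

theorem wp_child {σ : State} {R : WTree n d} {D : Finset (Fin n)} {e : Fin n} {i : Fin d} {t : ℝ}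
    {Q : List (WTree n d)} {p : ℕ} (hR : Current E σ R D e) (hQ : Queue E σ Q)
    (hi : σ.var 16 = i) (ht : σ.real 1 0 = t)
    (hp : (R.cand E D e)[σ.var 20]? = some p) :
    wp E child (fun T τ => T ≤ 170 * (R.size + 1) ∧ Current E τ R D e ∧
      Queue E τ (Q ++ [R.insAt E i t e p])) σ := by
  simp only [child, wp_seq, wp_setNat, wp_setVar, inc, NExpr.value, State.setV_var, State.setN_var,
    State.setV_nat, State.setN_nat, Nat.reduceEqDiff, if_false, NExpr.cost,
    hR.depths.2 _ _ hp]
  set σ₁ := (((σ.setN 6 (σ.var 1) (σ.var 4)).setV 1 (σ.var 1 + 1)).setV 9 (σ.var 7)).setV 21 p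
    with hσ₁
  have hv : ∀ a, a ≠ 1 → a ≠ 9 → a ≠ 21 → σ₁.var a = σ.var a := by
    intro a h1 h2 h3
    simp [hσ₁, h1, h2, h3]
  have hA : Agree (σ.var 4) σ σ₁ := by
    refine fun v _ => ⟨fun a ha => ?_, rfl⟩
    simp [hσ₁, show a ≠ 6 by omega]
  have h4 : σ₁.var 4 = σ.var 4 := hv 4 (by norm_num) (by norm_num) (by norm_num)
  refine wp_mono (wp_build (R := R) (D := D) (i := i) (t := t) (e := e) (p := p) ?_ ?_ ?_ ?_ ?_
    (List.mem_of_getElem? hp)) ?_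
  · rw [h4, show σ₁.var 9 = σ.var 7 by simp [hσ₁]]
    exact hR.rep.mono le_rfl hA
  · rw [hv 13 (by norm_num) (by norm_num) (by norm_num), hR.dirty]
  · rw [hv 16 (by norm_num) (by norm_num) (by norm_num), hi]
  · simpa [hσ₁] using ht
  · simp [hσ₁]
  rintro T τ ⟨hT, k1, k2, k3⟩ fr
  rw [h4] at k1 k2 k3
  have hA' : Agree (σ.var 4) σ τ := hA.trans k2.agree le_rfl
  refine ⟨by omega, ⟨?_, ?_, ?_, ?_⟩, ?_, fun m R' hm => ?_⟩
  · rw [fr.var 7 (by decide), hv 7 (by norm_num) (by norm_num) (by norm_num)]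
    exact hR.rep.mono k3 hA'
  · rw [fr.var 13 (by decide), hv 13 (by norm_num) (by norm_num) (by norm_num), hR.dirty]
  · rw [fr.var 14 (by decide), hv 14 (by norm_num) (by norm_num) (by norm_num), hR.wit]
  · have h8 : τ.nat 8 = σ.nat 8 := by
      rw [fr.nat 8 (by decide)]
      funext j
      simp [hσ₁]
    simpa only [Depths, h8, fr.var 12 (by decide), hv 12 (by norm_num) (by norm_num)
      (by norm_num)] using hR.depths
  · rw [fr.var 1 (by decide)]
    simp [hσ₁, hQ.1]
  · have h6 : τ.nat 6 m = if m = σ.var 1 then σ.var 4 else σ.nat 6 m := by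
      rw [fr.nat 6 (by decide)]
      simp [hσ₁]
    rw [h6, hQ.1]
    rcases lt_trichotomy m Q.length with hlt | rfl | hlt
    · rw [List.getElem?_append_left hlt] at hm
      rw [if_neg hlt.ne]
      exact (hQ.2 m R' hm).mono k3 hA'
    · simp only [List.getElem?_concat_length, Option.some.injEq] at hm
      rw [if_pos rfl, ← hm]
      exact k1
    · rw [List.getElem?_eq_none (by simp; omega)] at hm
      simp at hm

theorem wp_children {σ : State} {R : WTree n d} {D : Finset (Fin n)} {e : Fin n} {i : Fin d}
    {t : ℝ} {Q : List (WTree n d)} (hR : Current E σ R D e) (hQ : Queue E σ Q)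
    (hi : σ.var 16 = i) (ht : σ.real 1 0 = t) :
    wp E children (fun T τ => T ≤ (R.cand E D e).length * (200 * (R.size + 1)) + 20 ∧
      Current E τ R D e ∧ Queue E τ (Q ++ (R.cand E D e).map fun p => R.insAt E i t e p)) σ := by
  simp only [children, wp_seq, wp_setVar, NExpr.value]
  refine wp_mono (wp_for (fun k τ => τ.var 20 = k ∧ Current E τ R D e ∧
    Queue E τ (Q ++ ((R.cand E D e).take k).map fun p => R.insAt E i t e p))
    (R.cand E D e).length (170 * (R.size + 1) + 6) ?_ ?_ ?_) ?_
  · refine ⟨by simp, ?_, ?_⟩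
    · exact hR.setV (by norm_num)
    · simpa using hQ.setV (by norm_num) (by norm_num)
  · rintro k τ hk fr ⟨h1, h2, h3⟩
    refine ⟨by rw [ltT_holds]; simpa [NExpr.value, h1, h2.depths.1] using hk, ?_⟩
    simp only [wp_seq, inc, wp_setVar]
    refine wp_mono (wp_child (i := i) (t := t) (p := (R.cand E D e)[k]) h2 h3 ?_ ?_ ?_) ?_
    · rw [fr.var 16 (by decide)]; simpa using hi
    · rw [fr.real 1 (by decide)]; simpa using ht
    · rw [h1, List.getElem?_eq_getElem hk]
    rintro T υ ⟨hT, k1, k2⟩ fr'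
    refine ⟨by simp only [NExpr.cost]; omega, ?_, ?_, ?_⟩
    · simp [NExpr.value, fr'.var 20 (by decide), h1]
    · exact k1.setV (by norm_num)
    · rw [List.take_add_one, List.getElem?_eq_getElem hk, List.map_append, ← List.append_assoc]
      exact k2.setV (by norm_num) (by norm_num)
  · rintro τ fr ⟨h1, h2, -⟩
    rw [ltT_holds]
    simp [NExpr.value, h1, h2.depths.1]
  · rintro T τ ⟨hT, -, h1, h2⟩ fr
    refine ⟨?_, h1, by simpa using h2⟩
    simp only [ltT, Test.cost, NExpr.cost] at hT ⊢
    have : (R.cand E D e).length * (170 * (R.size + 1) + 6 + (1 + 1 + 1 + 1 + 1) + 1) ≤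
        (R.cand E D e).length * (200 * (R.size + 1)) := Nat.mul_le_mul_left _ (by omega)
    omega

/-- The minimum over the values above `t` starts from `hi`, itself such a value; so the result is
the successor of `t` among all values of the feature and does not pass `hi`. -/
theorem wp_nextThreshold {σ : State} {i : Fin d} {t hi : ℝ} (h16 : σ.var 16 = i)
    (ht : σ.real 1 0 = t) (hhi : σ.real 1 1 = hi) (hlt : t < hi) (hdom : hi ∈ E.dom i) :
    wp E nextThreshold (fun T τ => T ≤ 100 * (n + 1) ∧ τ.real 1 1 = hi ∧ t < τ.real 1 0 ∧
      τ.real 1 0 ≤ hi ∧ τ.real 1 0 ∈ E.dom i ∧ ∀ v ∈ E.dom i, t < v → τ.real 1 0 ≤ v) σ := by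
  simp only [nextThreshold, wp_seq, wp_setVar, wp_setReal, NExpr.value, RExpr.value]
  refine wp_mono (wp_for (fun k τ => τ.var 8 = k ∧ τ.real 1 0 = t ∧ τ.real 1 1 = hi ∧
    t < τ.real 1 2 ∧ τ.real 1 2 ≤ hi ∧ τ.real 1 2 ∈ E.dom i ∧
    ∀ a : Fin n, a.1 < k → t < E.ex a i → τ.real 1 2 ≤ E.ex a i) n 50 ?_ ?_ ?_) ?_
  · simp [ht, hhi, hlt, hdom]
  · rintro k τ hk fr ⟨h1, h2, h3, h4, h5, h6, h7⟩
    refine ⟨by rw [ltT_holds]; simpa [NExpr.value, h1] using hk, ?_⟩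
    have hin : (RExpr.input (var 8) (var 16)).value E τ = E.ex ⟨k, hk⟩ i :=
      value_input (by simpa [NExpr.value] using h1)
        (by simp only [NExpr.value]; rw [fr.var 16 (by decide)]; simpa using h16)
    have step : ∀ x ≤ τ.real 1 2, (t < E.ex ⟨k, hk⟩ i → x ≤ E.ex ⟨k, hk⟩ i) → ∀ a : Fin n,
        a.1 < k + 1 → t < E.ex a i → x ≤ E.ex a i := by
      intro x hx h a ha hta
      rcases Nat.lt_succ_iff_lt_or_eq.1 ha with h' | h'
      · exact hx.trans (h7 a h' hta)
      · obtain rfl : a = ⟨k, hk⟩ := Fin.ext h'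
        exact h hta
    simp only [nextBody, wp_seq, wp_ite, wp_setVar, wp_setReal, inc, skip, Test.Holds, hin,
      Test.cost, NExpr.cost, RExpr.cost]
    simp only [RExpr.value, NExpr.value, h2]
    refine ⟨fun hle => ⟨by omega, by simp [h1], by simpa using h2, by simpa using h3,
      by simpa using h4, by simpa using h5, by simpa using h6, ?_⟩,
      fun hgt => ⟨fun hle => ⟨by omega, by simp [h1], by simpa using h2, by simpa using h3,
      by simpa using hgt, by simpa using hle.trans h5, by simp [DataSet.dom], ?_⟩,
      fun hge => ⟨by omega, by simp [h1], by simpa using h2, by simpa using h3,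
      by simpa using h4, by simpa using h5, by simpa using h6, ?_⟩⟩⟩
    · simpa using step _ le_rfl (fun h => absurd hle (not_le.2 h))
    · simpa using step _ hle (fun _ => le_rfl)
    · simpa using step _ le_rfl (fun _ => (not_le.1 hge).le)
  · rintro τ fr ⟨h1, -⟩
    rw [ltT_holds]
    simp [NExpr.value, h1]
  · rintro T τ ⟨hT, h1, h2, h3, h4, h5, h6, h7⟩ fr
    simp only [ltT, Test.cost, NExpr.cost, RExpr.cost] at hT ⊢
    refine ⟨by omega, by simpa using h3, by simpa using h4, by simpa using h5, by simpa using h6,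
      fun v hv htv => ?_⟩
    obtain ⟨a, -, rfl⟩ := Finset.mem_image.1 hv
    simpa using h7 a a.isLt htv

/-- The values of feature `i` in the interval `[lo, hi)`. -/
noncomputable def valuesIn (E : DataSet n d) (i : Fin d) (lo hi : ℝ) : Finset ℝ :=
  (E.dom i).filter fun v => lo ≤ v ∧ v < hi

theorem mem_valuesIn {i : Fin d} {lo hi v : ℝ} :
    v ∈ valuesIn E i lo hi ↔ v ∈ E.dom i ∧ lo ≤ v ∧ v < hi := Finset.mem_filter

theorem valuesIn_insert {i : Fin d} {lo t u : ℝ} (ht : t ∈ E.dom i) (hlo : lo ≤ t) (htu : t < u)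
    (hu : ∀ v ∈ E.dom i, t < v → u ≤ v) :
    valuesIn E i lo u = insert t (valuesIn E i lo t) := by
  ext v
  simp only [Finset.mem_insert, mem_valuesIn]
  constructor
  · rintro ⟨h1, h2, h3⟩
    rcases lt_trichotomy v t with h | h | h
    · exact .inr ⟨h1, h2, h⟩
    · exact .inl h
    · exact absurd (hu v h1 h) (not_le.2 h3)
  · rintro (rfl | ⟨h1, h2, h3⟩)
    exacts [⟨ht, hlo, htu⟩, ⟨h1, h2, h3.trans htu⟩]

/-- The loop visits the values from `lo` upwards without sorting and stops at `hi`. Its time is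
charged to the children produced, plus a constant for the last test, so features in which the two
examples agree cost only constant time. -/
theorem wp_cuts {σ : State} {R : WTree n d} {D : Finset (Fin n)} {e : Fin n} {i : Fin d}
    {lo hi : ℝ} {Q : List (WTree n d)} (hR : Current E σ R D e) (hQ : Queue E σ Q)
    (h16 : σ.var 16 = i) (hlo : σ.real 1 0 = lo) (hhi : σ.real 1 1 = hi) (hle : lo ≤ hi)
    (hld : lo ∈ E.dom i) (hhd : hi ∈ E.dom i) :
    wp E cuts (fun T τ => Current E τ R D e ∧ ∃ L, Queue E τ (Q ++ L) ∧
      (∀ R', R' ∈ L ↔ ∃ v ∈ valuesIn E i lo hi, ∃ p ∈ R.cand E D e, R' = R.insAt E i v e p) ∧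
      L.length = (R.cand E D e).length * (valuesIn E i lo hi).card ∧
      T ≤ 1000 * ((n + 1) * (R.size + 1)) * L.length + 20) σ := by
  refine wp_while (fun T τ => Current E τ R D e ∧ τ.real 1 1 = hi ∧ lo ≤ τ.real 1 0 ∧
    τ.real 1 0 ≤ hi ∧ τ.real 1 0 ∈ E.dom i ∧ ∃ L, Queue E τ (Q ++ L) ∧
      (∀ R', R' ∈ L ↔ ∃ v ∈ valuesIn E i lo (τ.real 1 0), ∃ p ∈ R.cand E D e,
        R' = R.insAt E i v e p) ∧
      L.length = (R.cand E D e).length * (valuesIn E i lo (τ.real 1 0)).card ∧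
      T ≤ 1000 * ((n + 1) * (R.size + 1)) * L.length)
    (fun τ => ((E.dom i).filter fun v => τ.real 1 0 ≤ v).card) ?_ ?_ ?_
  · have : valuesIn E i lo lo = ∅ := by
      ext v
      simp only [mem_valuesIn, Finset.notMem_empty, iff_false]
      rintro ⟨-, h1, h2⟩
      exact absurd h2 (not_lt.2 h1)
    refine ⟨hR, hhi, hlo.ge, hlo.le.trans hle, hlo ▸ hld, [], by simpa using hQ, ?_, ?_, by simp⟩
    · simp [hlo, this]
    · simp [hlo, this]
  · rintro T τ fr ⟨h1, h2, h3, h4, h5, L, h6, h7, h8, h9⟩ hb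
    have hlt : τ.real 1 0 < hi := by
      simpa [Test.Holds, RExpr.value, NExpr.value, h2] using hb
    have e16 : τ.var 16 = i := by rw [fr.var 16 (by decide), h16]
    simp only [wp_seq]
    refine wp_mono (wp_children h1 h6 e16 rfl) ?_
    rintro T₁ σ₁ ⟨hT₁, k1, k2⟩ fr₁
    have r1 : σ₁.real 1 = τ.real 1 := fr₁.real 1 (by decide)
    refine wp_mono (wp_nextThreshold (i := i) (t := τ.real 1 0) (hi := hi) ?_ ?_ ?_ hlt hhd) ?_
    · rw [fr₁.var 16 (by decide), e16]
    · rw [r1]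
    · rw [r1, h2]
    rintro T₂ υ ⟨hT₂, m1, m2, m3, m4, m5⟩ fr₂
    have hins := valuesIn_insert h5 h3 m2 m5
    have hnot : τ.real 1 0 ∉ valuesIn E i lo (τ.real 1 0) := by simp [mem_valuesIn]
    refine ⟨⟨k1.of_frame fr₂ (by decide) (by decide) (by decide), m1, h3.trans m2.le, m3, m4,
      L ++ (R.cand E D e).map fun p => R.insAt E i (τ.real 1 0) e p, ?_, fun R' => ?_, ?_, ?_⟩,
      ?_⟩
    · rw [← List.append_assoc]
      exact k2.of_frame fr₂ (by decide) (by decide) (by decide) (by decide)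
    · rw [List.mem_append, h7, hins]
      simp only [Finset.mem_insert, exists_eq_or_imp, List.mem_map]
      rw [or_comm]
      simp only [eq_comm]
    · rw [hins, Finset.card_insert_of_notMem hnot, List.length_append, List.length_map, h8]
      ring
    · have hpos := R.length_cand_pos (E := E) D e
      simp only [List.length_append, List.length_map, Test.cost, RExpr.cost, NExpr.cost]
      have a1 : (R.cand E D e).length * (200 * (R.size + 1)) ≤
          (R.cand E D e).length * (200 * ((n + 1) * (R.size + 1))) := by
        gcongr
        nlinarith
      have a2 : n + 1 ≤ (n + 1) * (R.size + 1) := Nat.le_mul_of_pos_right _ (by omega)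
      have a3 : (n + 1) * (R.size + 1) ≤ (R.cand E D e).length * ((n + 1) * (R.size + 1)) :=
        Nat.le_mul_of_pos_left _ hpos
      nlinarith
    · refine Finset.card_lt_card (Finset.ssubset_iff_of_subset ?_ |>.2 ⟨τ.real 1 0, ?_, ?_⟩)
      · exact fun v hv => by
          rw [Finset.mem_filter] at hv ⊢
          exact ⟨hv.1, m2.le.trans hv.2⟩
      · simp [h5]
      · simp [m2]
  · rintro T τ fr ⟨h1, h2, h3, h4, h5, L, h6, h7, h8, h9⟩ hb
    have heq : τ.real 1 0 = hi := by
      refine le_antisymm h4 ?_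
      simpa [Test.Holds, RExpr.value, NExpr.value, h2] using hb
    rw [heq] at h7 h8
    exact ⟨h1, L, h6, h7, h8, by simp only [Test.cost, RExpr.cost, NExpr.cost]; omega⟩

/-- The values of feature `i` that separate `e` and `w` as a threshold. -/
noncomputable def separators (E : DataSet n d) (e w : Fin n) (i : Fin d) : Finset ℝ :=
  valuesIn E i (min (E.ex e i) (E.ex w i)) (max (E.ex e i) (E.ex w i))

/-- The interval is closed below and open above because an example equal to the threshold goes to
the left. -/
theorem mem_separators {e w : Fin n} {i : Fin d} {v : ℝ} :
    v ∈ separators E e w i ↔ v ∈ E.dom i ∧ WTree.SepCut E e w i v := by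
  rw [separators, mem_valuesIn, WTree.SepCut]
  refine and_congr_right fun _ => ?_
  rcases le_total (E.ex e i) (E.ex w i) with h | h
  · rw [min_eq_left h, max_eq_right h]
    refine ⟨.inl, fun h' => h'.resolve_right fun h'' => ?_⟩
    exact absurd (h''.1.trans_lt h''.2) (not_lt.2 h)
  · rw [min_eq_right h, max_eq_left h]
    refine ⟨.inr, fun h' => h'.resolve_left fun h'' => ?_⟩
    exact absurd (h''.1.trans_lt h''.2) (not_lt.2 h)

theorem wp_features {σ : State} {R : WTree n d} {D : Finset (Fin n)} {e : Fin n}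
    {Fl : List (Fin d)} {Q : List (WTree n d)} (hR : Current E σ R D e) (hQ : Queue E σ Q)
    (hF : Listed E σ Fl) :
    wp E features (fun T τ => ∃ L, Queue E τ (Q ++ L) ∧
      (∀ R', R' ∈ L ↔ ∃ i ∈ Fl, ∃ v ∈ separators E e (R.leafOf (E.ex e)) i,
        ∃ p ∈ R.cand E D e, R' = R.insAt E i v e p) ∧
      L.length = (R.cand E D e).length *
        (Fl.map fun i => (separators E e (R.leafOf (E.ex e)) i).card).sum ∧
      T ≤ 100 * (Fl.length + 1) + 1000 * ((n + 1) * (R.size + 1)) * L.length) σ := by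
  simp only [features, wp_seq, wp_setVar, NExpr.value]
  -- The number of children so far is written as `τ.var 1 - Q.length`, so that the time bound does
  -- not refer to the list `L`.
  refine wp_while (fun T τ => Current E τ R D e ∧ τ.var 15 ≤ Fl.length ∧
    T ≤ 100 * τ.var 15 + 1000 * ((n + 1) * (R.size + 1)) * (τ.var 1 - Q.length) ∧
    ∃ L, Queue E τ (Q ++ L) ∧
      (∀ R', R' ∈ L ↔ ∃ i ∈ Fl.take (τ.var 15), ∃ v ∈ separators E e (R.leafOf (E.ex e)) i,
        ∃ p ∈ R.cand E D e, R' = R.insAt E i v e p) ∧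
      L.length = (R.cand E D e).length *
        ((Fl.take (τ.var 15)).map fun i => (separators E e (R.leafOf (E.ex e)) i).card).sum)
    (fun τ => Fl.length - τ.var 15) ?_ ?_ ?_
  · refine ⟨hR.setV (by norm_num), by simp, by simp, [], ?_, ?_, ?_⟩
    · simpa using hQ.setV (by norm_num) (by norm_num)
    · simp
    · simp
  · rintro T τ fr ⟨h1, h2, h3, L, h4, h5, h6⟩ hb
    have hk : τ.var 15 < Fl.length := by
      rw [ltT_holds] at hb
      simpa [NExpr.value, fr.var 5 (by decide), hF.length] using hb
    set k := τ.var 15 with hkdef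
    have hi := hF.get k Fl[k] (List.getElem?_eq_getElem hk)
    set i := Fl[k] with hidef
    have hi' : (NExpr.get 11 (var 15)).value E τ = i := by
      simp only [NExpr.value]
      rw [fr.nat 11 (by decide)]
      simpa using hi
    have he : τ.var 13 = e := h1.dirty
    have hw := h1.wit
    set w := R.leafOf (E.ex e) with hwdef
    simp only [featureBody, wp_seq, wp_setVar, hi']
    have v1 : ∀ τ' : State, τ'.var = (τ.setV 16 i).var →
        (RExpr.input (var 13) (var 16)).value E τ' = E.ex e i := fun τ' h =>
      value_input (by simp [NExpr.value, h, he]) (by simp [NExpr.value, h])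
    have v2 : ∀ τ' : State, τ'.var = (τ.setV 16 i).var →
        (RExpr.input (var 14) (var 16)).value E τ' = E.ex w i := fun τ' h =>
      value_input (by simp [NExpr.value, h, hw]) (by simp [NExpr.value, h])
    have main : ∀ τ' : State, τ'.var = (τ.setV 16 i).var → τ'.nat = τ.nat → τ'.real 0 = τ.real 0 →
        τ'.real 1 0 = min (E.ex e i) (E.ex w i) → τ'.real 1 1 = max (E.ex e i) (E.ex w i) →
        wp E cuts (fun T' υ => Current E υ R D e ∧ ∃ L', Queue E υ ((Q ++ L) ++ L') ∧
          (∀ R', R' ∈ L' ↔ ∃ v ∈ separators E e w i, ∃ p ∈ R.cand E D e,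
            R' = R.insAt E i v e p) ∧
          L'.length = (R.cand E D e).length * (separators E e w i).card ∧
          T' ≤ 1000 * ((n + 1) * (R.size + 1)) * L'.length + 20 ∧ υ.var 15 = k) τ' := by
      intro τ' e1 e2 e3 e4 e5
      have hA : ∀ N, Agree N τ τ' := fun N v _ => ⟨fun a _ => by rw [e2], by rw [e3]⟩
      have hvar : ∀ a, a ≠ 16 → τ'.var a = τ.var a := fun a ha => by simp [e1, ha]
      have hc : Current E τ' R D e := by
        refine ⟨?_, ?_, ?_, ?_⟩
        · rw [hvar 4 (by norm_num), hvar 7 (by norm_num)]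
          exact h1.rep.mono le_rfl (hA _)
        · rw [hvar 13 (by norm_num), he]
        · rw [hvar 14 (by norm_num), hw]
        · simpa only [Depths, hvar 12 (by norm_num), e2] using h1.depths
      have hq : Queue E τ' (Q ++ L) := by
        refine ⟨by rw [hvar 1 (by norm_num), h4.1], fun m R' hm => ?_⟩
        rw [hvar 4 (by norm_num), e2]
        exact (h4.2 m R' hm).mono le_rfl (hA _)
      have hmem : ∀ a, E.ex a i ∈ E.dom i := fun a => by simp [DataSet.dom]
      refine wp_mono (wp_cuts (i := i) hc hq (by simp [e1]) e4 e5 min_le_max ?_ ?_) ?_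
      · rcases min_choice (E.ex e i) (E.ex w i) with h | h <;> rw [h] <;> exact hmem _
      · rcases max_choice (E.ex e i) (E.ex w i) with h | h <;> rw [h] <;> exact hmem _
      rintro T' υ ⟨g1, L', g2, g3, g4, g5⟩ fr'
      exact ⟨g1, L', g2, g3, g4, g5, by rw [fr'.var 15 (by decide), hvar 15 (by norm_num)]⟩
    have fin : ∀ τ' : State, τ'.var = (τ.setV 16 i).var → τ'.nat = τ.nat →
        τ'.real 0 = τ.real 0 → τ'.real 1 0 = min (E.ex e i) (E.ex w i) →
        τ'.real 1 1 = max (E.ex e i) (E.ex w i) →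
        wp E cuts (fun T' υ => wp E (inc 15) (fun t' υ' => (Current E υ' R D e ∧
          υ'.var 15 ≤ Fl.length ∧
          T + T' + t' + 60 ≤ 100 * υ'.var 15 +
            1000 * ((n + 1) * (R.size + 1)) * (υ'.var 1 - Q.length) ∧
          ∃ L, Queue E υ' (Q ++ L) ∧
            (∀ R', R' ∈ L ↔ ∃ i ∈ Fl.take (υ'.var 15), ∃ v ∈ separators E e w i,
              ∃ p ∈ R.cand E D e, R' = R.insAt E i v e p) ∧
            L.length = (R.cand E D e).length *
              ((Fl.take (υ'.var 15)).map fun i => (separators E e w i).card).sum) ∧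
          Fl.length - υ'.var 15 < Fl.length - k) υ) τ' := by
      intro τ' e1 e2 e3 e4 e5
      refine wp_mono (main τ' e1 e2 e3 e4 e5) ?_
      rintro T' υ ⟨g1, L', g2, g3, g4, g5, g6⟩ -
      rw [List.append_assoc] at g2
      have e15 : (υ.setV 15 (k + 1)).var 15 = k + 1 := by simp
      have hlen : υ.var 1 - Q.length = L.length + L'.length := by rw [g2.1]; simp
      have hlen' : τ.var 1 - Q.length = L.length := by rw [h4.1]; simp
      simp only [inc, wp_setVar, NExpr.value, g6, e15]
      refine ⟨⟨g1.setV (by norm_num), hk, ?_, L ++ L', ?_, fun R' => ?_, ?_⟩, by omega⟩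
      · simp only [State.setV_var, Nat.reduceEqDiff, if_false, hlen, NExpr.cost]
        rw [hlen'] at h3
        have := Nat.mul_add (1000 * ((n + 1) * (R.size + 1))) L.length L'.length
        omega
      · exact g2.setV (by norm_num) (by norm_num)
      · rw [List.mem_append, h5, g3, List.take_add_one, List.getElem?_eq_getElem hk]
        simp only [Option.toList_some, List.mem_append, List.mem_singleton, or_and_right,
          exists_or, exists_eq_left, ← hidef]
      · rw [List.take_add_one, List.getElem?_eq_getElem hk, List.length_append, h6, g4]
        simp only [Option.toList_some, List.map_append, List.sum_append, List.map_cons,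
          List.map_nil, List.sum_cons, List.sum_nil, ← hidef]
        ring
    simp only [wp_ite, wp_setReal, Test.Holds, v1 _ rfl, v2 _ rfl, wp_seq]
    refine ⟨fun hle => ?_, fun hle => ?_⟩
    · refine wp_mono (fin _ rfl rfl ?_ ?_ ?_) (fun T' υ h _ => wp_mono h ?_)
      · ext; simp
      · simp [NExpr.value, min_eq_left hle]
      · simp [NExpr.value, v2 ((τ.setV 16 i).setR 1 0 (E.ex e i)) rfl, max_eq_right hle]
      · rintro t' υ' ⟨⟨g1, g2, g3, g4⟩, g5⟩ -
        refine ⟨⟨g1, g2, ?_, g4⟩, g5⟩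
        simp only [ltT, Test.cost, RExpr.cost, NExpr.cost]
        omega
    · refine wp_mono (fin _ rfl rfl ?_ ?_ ?_) (fun T' υ h _ => wp_mono h ?_)
      · ext; simp
      · simp [NExpr.value, min_eq_right (not_le.1 hle).le]
      · simp [NExpr.value, v1 ((τ.setV 16 i).setR 1 0 (E.ex w i)) rfl,
          max_eq_left (not_le.1 hle).le]
      · rintro t' υ' ⟨⟨g1, g2, g3, g4⟩, g5⟩ -
        refine ⟨⟨g1, g2, ?_, g4⟩, g5⟩
        simp only [ltT, Test.cost, RExpr.cost, NExpr.cost]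
        omega
  · rintro T τ fr ⟨h1, h2, h3, L, h4, h5, h6⟩ hb
    have hk : τ.var 15 = Fl.length := by
      rw [ltT_holds] at hb
      have : Fl.length ≤ τ.var 15 := by
        simpa [NExpr.value, fr.var 5 (by decide), hF.length] using hb
      omega
    have hlen' : τ.var 1 - Q.length = L.length := by rw [h4.1]; simp
    rw [hk, List.take_length] at h5 h6
    rw [hk, hlen'] at h3
    refine ⟨L, h4, h5, h6, ?_⟩
    simp only [ltT, Test.cost, NExpr.cost]
    omega

end

/-! ### Combinatorics of the breadth-first search -/

section

variable {n d : ℕ} {E : DataSet n d}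

/-- The refinement argument only yields a real threshold that separates. That the program tries it
follows because a tree with admissible cuts refines the insertion. -/
theorem WTree.threshold_mem_of_cutsIn_insAt {Thr : Fin d → Finset ℝ} {i : Fin d} {t : ℝ}
    {e : Fin n} {p : ℕ} {R : WTree n d} {D : Finset (Fin n)} (hp : p ∈ R.cand E D e)
    (h : ((R.insAt E i t e p).toTree E).CutsIn Thr) : t ∈ Thr i := by
  induction R generalizing p D with
  | leaf w =>
    simp only [cand, List.mem_singleton] at hp
    subst hp
    simp only [insAt] at h
    split_ifs at h <;> exact h.1
  | node j u l r ihl ihr =>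
    cases p with
    | zero =>
      simp only [insAt] at h
      split_ifs at h <;> exact h.1
    | succ p =>
      simp only [cand] at hp
      simp only [insAt] at h
      by_cases hj : E.ex e j ≤ u
      · rw [if_pos hj] at hp h
        have : p ∈ l.cand E (D.filter fun a => E.ex a j ≤ u) e := by
          split_ifs at hp <;> simpa using hp
        exact ihl this h.2.1
      · rw [if_neg hj] at hp h
        have : p ∈ r.cand E (D.filter fun a => u < E.ex a j) e := by
          split_ifs at hp <;> simpa using hp
        exact ihr this h.2.2

/-- Some tree of size at most `s` that classifies the data set refines `R`. -/
def Promising (E : DataSet n d) (s : ℕ) (R : WTree n d) : Prop :=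
  R.Consistent E ∧ ∃ T, WTree.Ref E R T ∧ E.Classifies T ∧ T.size ≤ s

/-- The bound on the number of children of a tree of size `j`. -/
noncomputable def DataSet.branching (E : DataSet n d) (j : ℕ) : ℕ :=
  E.maxDiff * E.maxDom * (1 + Nat.log 2 (j + 1))

/-- The list `L` is a set of children for `R` that suffices for the search. -/
structure Children (E : DataSet n d) (R : WTree n d) (L : List (WTree n d)) : Prop where
  size : ∀ R' ∈ L, R'.size = R.size + 1
  cuts : (R.toTree E).CutsIn E.thresholds → ∀ R' ∈ L, (R'.toTree E).CutsIn E.thresholds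
  promising : ∀ s, Promising E s R → ∃ R' ∈ L, Promising E s R'
  length : L.length ≤ E.branching R.size

/-- The case of `WTree.ref_extends` where `S` consists of all examples and `D` of exactly the dirty
ones. -/
theorem Promising.exists_insAt {s : ℕ} {R : WTree n d} (h : Promising E s R) {e : Fin n}
    (he : e ∈ dirty E R) :
    ∃ i, ∃ v ∈ separators E e (R.leafOf (E.ex e)) i, ∃ p ∈ R.cand E (dirty E R) e,
      Promising E s (R.insAt E i v e p) := by
  obtain ⟨hR, T, h1, h2, h3⟩ := h
  obtain ⟨i, t, p, T', hp, hs, hc, hr, hsize, hT'⟩ := WTree.ref_extends (S := Set.univ) hR h1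
    ⟨h2.1, fun a _ => h2.2 a⟩ (D := dirty E R) (fun a _ ha => by simpa [dirty] using ha)
    (Set.mem_univ e) (Set.mem_univ _) (by simpa [dirty] using he)
  have ht := WTree.threshold_mem_of_cutsIn_insAt hp (hr.cutsIn hT'.1)
  exact ⟨i, t, mem_separators.2 ⟨Finset.mem_of_mem_filter _ ht, hs⟩, p, hp, hc, T', hr,
    ⟨hT'.1, fun a => hT'.2 a (Set.mem_univ a)⟩, hsize.trans h3⟩

/-- There is room for one more vertex, since an insertion is promising too and a refining tree is at
least as large as it. -/
theorem Promising.size_lt {s : ℕ} {R : WTree n d} (h : Promising E s R)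
    (hd : (dirty E R).Nonempty) : R.size < s := by
  obtain ⟨e, he⟩ := hd
  obtain ⟨i, v, -, p, hp, -, T, hr, -, hs⟩ := h.exists_insAt he
  have := hr.size_le
  rw [WTree.size_insAt hp] at this
  omega

/-- Features in which `e` and `w` agree have no separating threshold, so a long list `Fl` does not
increase the number of children. -/
theorem sum_card_separators_le {e w : Fin n} {Fl : List (Fin d)} (hn : Fl.Nodup) :
    (Fl.map fun i => (separators E e w i).card).sum ≤ E.maxDiff * E.maxDom := by
  have h0 : ∀ i, E.ex e i = E.ex w i → separators E e w i = ∅ := by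
    intro i hi
    ext v
    simp only [mem_separators, WTree.SepCut, hi, Finset.notMem_empty, iff_false]
    rintro ⟨-, h | h⟩ <;> exact absurd (h.1.trans_lt h.2) (lt_irrefl _)
  have h1 : ∀ i, (separators E e w i).card ≤ E.maxDom := fun i =>
    (Finset.card_le_card fun v hv => (mem_separators.1 hv).1).trans
      (Finset.le_sup (f := fun i => (E.dom i).card) (Finset.mem_univ i))
  rw [← List.sum_toFinset _ hn]
  calc ∑ i ∈ Fl.toFinset, (separators E e w i).card
      ≤ ∑ i, (separators E e w i).card :=
        Finset.sum_le_sum_of_subset (Finset.subset_univ _)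
    _ = ∑ i with E.ex e i ≠ E.ex w i, (separators E e w i).card := by
        rw [Finset.sum_filter]
        refine Finset.sum_congr rfl fun i _ => ?_
        split_ifs with h
        · rfl
        · rw [h0 i (not_not.1 h), Finset.card_empty]
    _ ≤ (Finset.univ.filter fun i => E.ex e i ≠ E.ex w i).card * E.maxDom :=
        Finset.sum_le_card_nsmul _ _ _ fun i _ => h1 i
    _ ≤ _ := Nat.mul_le_mul_right _ (Finset.le_sup
        (f := fun p : Fin n × Fin n => (Finset.univ.filter fun i => E.ex p.1 i ≠ E.ex p.2 i).card)
        (Finset.mem_univ (e, w)))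

/-- The list need not be exact: it suffices that it contains all features in which `e` and its
witness differ. -/
theorem children_of_mem_iff {R : WTree n d} {L : List (WTree n d)} {Fl : List (Fin d)} {e : Fin n}
    (he : e ∈ dirty E R) (hn : Fl.Nodup)
    (hFl : ∀ i, E.ex e i ≠ E.ex (R.leafOf (E.ex e)) i → i ∈ Fl)
    (hL : ∀ R', R' ∈ L ↔ ∃ i ∈ Fl, ∃ v ∈ separators E e (R.leafOf (E.ex e)) i,
      ∃ p ∈ R.cand E (dirty E R) e, R' = R.insAt E i v e p)
    (hlen : L.length = (R.cand E (dirty E R) e).length *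
      (Fl.map fun i => (separators E e (R.leafOf (E.ex e)) i).card).sum)
    (hcand : (R.cand E (dirty E R) e).length ≤ 1 + Nat.log 2 (R.size + 1)) :
    Children E R L where
  size R' h := by
    obtain ⟨i, -, v, -, p, hp, rfl⟩ := (hL R').1 h
    exact WTree.size_insAt hp
  cuts hR R' h := by
    obtain ⟨i, -, v, hv, p, -, rfl⟩ := (hL R').1 h
    have := mem_separators.1 hv
    exact WTree.cutsIn_insAt (WTree.mem_thresholds_of_sepCut this.2 this.1) hR
  promising s h := by
    obtain ⟨i, v, hv, p, hp, h'⟩ := h.exists_insAt he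
    refine ⟨_, (hL _).2 ⟨i, hFl i fun heq => ?_, v, hv, p, hp, rfl⟩, h'⟩
    rcases (mem_separators.1 hv).2 with h | h
    · exact absurd (heq ▸ h.1.trans_lt h.2) (lt_irrefl _)
    · exact absurd (heq ▸ h.1.trans_lt h.2) (lt_irrefl _)
  length := by
    rw [hlen, DataSet.branching, mul_comm]
    exact Nat.mul_le_mul (sum_card_separators_le hn) hcand

/-- The number of trees of size `j` in a list. -/
def countSize (j : ℕ) (Q : List (WTree n d)) : ℕ := Q.countP fun R => R.size = j

theorem length_eq_sum_countSize {k : ℕ} {Q : List (WTree n d)} (h : ∀ R ∈ Q, R.size < k) :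
    Q.length = ∑ j ∈ Finset.range k, countSize j Q := by
  induction Q with
  | nil => simp [countSize]
  | cons R Q ih =>
    simp only [countSize, List.countP_cons, decide_eq_true_eq, Finset.sum_add_distrib,
      Finset.sum_ite_eq, Finset.mem_range, h R (by simp), if_true, List.length_cons]
    rw [ih fun R' hR' => h R' (by simp [hR'])]
    rfl

/-- State of the search: `Q` is the queue, whose first `h` entries are expanded, and `s` bounds the
smallest size. -/
structure Search (E : DataSet n d) (s : ℕ) (Q : List (WTree n d)) (h : ℕ) : Prop where
  cuts : ∀ R ∈ Q, (R.toTree E).CutsIn E.thresholds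
  sorted : Q.Pairwise fun R R' => R.size ≤ R'.size
  front : ∀ R, Q[h]? = some R → ∀ R' ∈ Q, R'.size ≤ R.size + 1
  le : ∀ R ∈ Q, R.size ≤ s
  lt : ∀ R ∈ Q.take h, R.size < s
  promising : ∃ R ∈ Q.drop h, Promising E s R
  count_zero : countSize 0 Q ≤ 1
  count_succ : ∀ j, countSize (j + 1) Q ≤ E.branching j * countSize j (Q.take h)

theorem Search.lt_length {s h : ℕ} {Q : List (WTree n d)} (hS : Search E s Q h) :
    h < Q.length := by
  obtain ⟨R, hR, -⟩ := hS.promising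
  by_contra! hc
  simp [List.drop_eq_nil_of_le hc] at hR

theorem search_singleton {s : ℕ} {w : Fin n} (h : Promising E s (.leaf w)) :
    Search E s [.leaf w] 0 where
  cuts := by simp [WTree.toTree, DecisionTree.CutsIn]
  sorted := by simp
  front := by simp
  le := by simp [WTree.size]
  lt := by simp
  promising := ⟨_, by simp, h⟩
  count_zero := by simp [countSize, WTree.size]
  count_succ j := by simp [countSize, WTree.size]

/-- A breadth-first step when no entry of the queue is a solution. The expanded tree is no larger
than the promising one behind it in the queue, which is smaller than `s`; so all children have size
at most `s`. -/
theorem Search.expand {s h : ℕ} {Q L : List (WTree n d)} {R : WTree n d} (hS : Search E s Q h)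
    (hR : Q[h]? = some R) (hd : ∀ R ∈ Q, (dirty E R).Nonempty) (hL : Children E R L) :
    Search E s (Q ++ L) (h + 1) := by
  have hmem : R ∈ Q := List.mem_of_getElem? hR
  obtain ⟨hlt, hRh⟩ := List.getElem?_eq_some_iff.1 hR
  have hdrop : Q.drop h = R :: Q.drop (h + 1) := by rw [List.drop_eq_getElem_cons hlt, hRh]
  have htake : (Q ++ L).take (h + 1) = Q.take h ++ [R] := by
    rw [List.take_append_of_le_length (by omega), List.take_add_one, hR]; rfl
  -- The queue is sorted by size, so its first unexpanded entry is a smallest one among these.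
  have hge : ∀ R' ∈ Q.drop h, R.size ≤ R'.size := by
    have := hS.sorted.sublist (List.drop_sublist h Q)
    rw [hdrop] at this ⊢
    rintro R' (_ | ⟨_, h'⟩)
    · rfl
    · exact (List.pairwise_cons.1 this).1 R' h'
  have hRs : R.size < s := by
    obtain ⟨R', h1, h2⟩ := hS.promising
    exact (hge R' h1).trans_lt (h2.size_lt (hd R' (List.mem_of_mem_drop h1)))
  have hsz : ∀ R' ∈ Q ++ L, R'.size ≤ R.size + 1 := fun R' h' =>
    (List.mem_append.1 h').elim (hS.front R hR R') fun h' => (hL.size R' h').le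
  refine ⟨fun R' h' => ?_, ?_, fun R₁ h₁ R' h' => (hsz R' h').trans ?_, fun R' h' => ?_,
    fun R' h' => ?_, ?_, ?_, fun j => ?_⟩
  · exact (List.mem_append.1 h').elim (hS.cuts R') fun h' => hL.cuts (hS.cuts R hmem) R' h'
  · refine List.pairwise_append.2 ⟨hS.sorted, ?_, fun R₁ h₁ R₂ h₂ => ?_⟩
    · refine List.pairwise_of_forall_mem_list fun R₁ h₁ R₂ h₂ => ?_
      rw [hL.size R₁ h₁, hL.size R₂ h₂]
    · rw [hL.size R₂ h₂]
      exact hS.front R hR R₁ h₁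
  · gcongr
    have : R₁ ∈ (Q ++ L).drop (h + 1) :=
      List.mem_of_getElem? (i := 0) (by rw [List.getElem?_drop]; exact h₁)
    rw [List.drop_append_of_le_length (by omega), List.mem_append] at this
    rcases this with h' | h'
    · exact hge R₁ (by rw [hdrop]; exact List.mem_cons_of_mem _ h')
    · rw [hL.size R₁ h']; omega
  · exact (hsz R' h').trans hRs
  · rw [htake, List.mem_append, List.mem_singleton] at h'
    rcases h' with h' | rfl
    exacts [hS.lt R' h', hRs]
  · rw [List.drop_append_of_le_length (by omega)]
    obtain ⟨R', h1, h2⟩ := hS.promising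
    rw [hdrop, List.mem_cons] at h1
    rcases h1 with rfl | h1
    · obtain ⟨R'', h3, h4⟩ := hL.promising s h2
      exact ⟨R'', by simp [h3], h4⟩
    · exact ⟨R', by simp [h1], h2⟩
  · rw [countSize, List.countP_append, Nat.add_comm, List.countP_eq_zero.2, Nat.zero_add]
    · exact hS.count_zero
    · intro R' h'
      simp [hL.size R' h']
  · rw [htake]
    simp only [countSize, List.countP_append, List.countP_cons, List.countP_nil, Nat.zero_add,
      decide_eq_true_eq]
    have := hS.count_succ j
    simp only [countSize] at this
    rw [Nat.mul_add]
    refine Nat.add_le_add this ?_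
    split_ifs with hj
    · subst hj
      rw [mul_one]
      exact List.countP_le_length.trans hL.length
    · rw [List.countP_eq_zero.2]
      · simp
      · intro R' h'
        simp [hL.size R' h']
        omega

/-- The bound on the number of trees of size `j`. -/
noncomputable def DataSet.levelBound (E : DataSet n d) (j : ℕ) : ℕ := ∏ m ∈ Finset.range j, E.branching m

theorem Search.countSize_le {s h : ℕ} {Q : List (WTree n d)} (hS : Search E s Q h) (j : ℕ) :
    countSize j Q ≤ E.levelBound j := by
  induction j with
  | zero => simpa [DataSet.levelBound] using hS.count_zero
  | succ j ih =>
    rw [DataSet.levelBound, Finset.prod_range_succ, mul_comm]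
    exact (hS.count_succ j).trans
      (Nat.mul_le_mul_left _ (((List.take_sublist h Q).countP_le).trans ih))

theorem Search.length_le {s h : ℕ} {Q : List (WTree n d)} (hS : Search E s Q h) :
    Q.length ≤ ∑ j ∈ Finset.range (s + 1), E.levelBound j := by
  rw [length_eq_sum_countSize fun R hR => Nat.lt_succ_of_le (hS.le R hR)]
  exact Finset.sum_le_sum fun j _ => hS.countSize_le j

/-- The level `s` is missing from the sum since expanded trees are smaller than `s`. This leaves
room for the factor `δ` in the time of an expansion. -/
theorem Search.expanded_le {s h : ℕ} {Q : List (WTree n d)} (hS : Search E s Q h) :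
    h ≤ ∑ j ∈ Finset.range s, E.levelBound j := by
  have h1 : (Q.take h).length = h := by
    rw [List.length_take]
    exact min_eq_left hS.lt_length.le
  rw [← h1, length_eq_sum_countSize hS.lt]
  exact Finset.sum_le_sum fun j _ => ((List.take_sublist h Q).countP_le).trans (hS.countSize_le j)

end

/-! ### The main loop and its invariant -/

/-- Expand the current tree: append its children to the queue. -/
def expand : Prog := descend ;; scan ;; features

/-- Check the next entry of the queue. -/
def checkNext : Prog :=
  .setVar 7 (get 6 (var 2)) ;; eval ;;
    .ite (le (var 10) (const 0)) (.setVar 6 (const 1) ;; .setVar 0 (var 7)) (inc 2)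

/-- Expand the next entry of the queue. -/
def expandNext : Prog := .setVar 7 (get 6 (var 3)) ;; eval ;; expand ;; inc 3

/-- Search until some entry of the queue classifies the data set. -/
def search : Prog :=
  .while (le (var 6) (const 0)) (.ite (ltT (var 2) (var 1)) checkNext expandNext)

/-- Start the search with the leaf of the class of the first example. If there is no example, the
initial memory already holds a leaf at address `0`. -/
def solve : Prog :=
  .ite (le numExamples (const 0)) skip
    (.setNat 1 (const 0) (label (const 0)) ;; .setVar 1 (const 1) ;; .setVar 4 (const 1) ;; search)

section

variable {n d : ℕ} {E : DataSet n d}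

theorem Listed.of_frame {P : Prog} {σ τ : State} {Fl : List (Fin d)} (h : Listed E σ Fl)
    (fr : P.Frame σ τ) (h5 : 5 ∉ P.vars) (hn : 10 ∉ P.nats ∧ 11 ∉ P.nats) : Listed E τ Fl where
  length := by rw [fr.var 5 h5, h.length]
  get k i hk := by rw [fr.nat 11 hn.2, h.get k i hk]
  nodup := h.nodup
  flag i := by rw [fr.nat 10 hn.1, h.flag]
  nonconst := h.nonconst

theorem seen_congr {σ τ : State} (h : τ.nat 9 = σ.nat 9) : seen n τ = seen n σ := by
  simp only [seen, h]

theorem seen_setV {σ : State} {x k : ℕ} : seen n (σ.setV x k) = seen n σ := rfl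

theorem Covers.congr {σ τ : State} {Fl : List (Fin d)} (h : Covers E σ Fl)
    (h9 : τ.nat 9 = σ.nat 9) : Covers E τ Fl := by
  rwa [Covers, seen_congr h9]

/-- The scan precedes the enumeration, so the features of the new dirty example are listed. This
example becomes the witness of every new leaf, which preserves `hwit`. -/
theorem wp_expand {σ : State} {R : WTree n d} {Fl : List (Fin d)} {Q : List (WTree n d)}
    (hR : Rep E σ (σ.var 4) (σ.var 7) R) (hD : Flags σ (dirty E R)) (hne : (dirty E R).Nonempty)
    (hQ : Queue E σ Q) (hF : Listed E σ Fl) (hC : Covers E σ Fl)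
    (hwit : ∀ w, R.HasWit w → w.1 = 0 ∨ w ∈ seen n σ) :
    wp E expand (fun T τ => ∃ L Fl', Queue E τ (Q ++ L) ∧ Listed E τ Fl' ∧ Covers E τ Fl' ∧
      Children E R L ∧ seen n σ ⊆ seen n τ ∧ (seen n τ).card ≤ (seen n σ).card + 1 ∧
      (∀ R' ∈ L, ∀ w, R'.HasWit w → w.1 = 0 ∨ w ∈ seen n τ) ∧
      T + 100 * (d + 1) * (seen n σ).card ≤ 100 * (d + 1) * (seen n τ).card +
        500 * ((n + 1) * (R.size + 1)) + 100 * (Fl'.length + 3) +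
        1000 * ((n + 1) * (R.size + 1)) * L.length) σ := by
  simp only [expand, wp_seq]
  refine wp_mono (wp_descend hR hD hne) ?_
  rintro T₁ σ₁ ⟨hT₁, e, he, h13, h14, hdep, hcand⟩ fr₁
  have hcur : Current E σ₁ R (dirty E R) e := by
    refine ⟨?_, h13, h14, hdep⟩
    rw [fr₁.var 4 (by decide), fr₁.var 7 (by decide)]
    exact hR.mono le_rfl (fr₁.agree _ (by decide) (by decide))
  have h9 : σ₁.nat 9 = σ.nat 9 := fr₁.nat 9 (by decide)
  refine wp_mono (wp_scan h13 (hF.of_frame fr₁ (by decide) (by decide)) (hC.congr h9)) ?_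
  rintro T₂ σ₂ ⟨hseen, hT₂, Fl', hF', hC'⟩ fr₂
  rw [seen_congr h9] at hseen hT₂
  have hQ₂ : Queue E σ₂ Q :=
    (hQ.of_frame fr₁ (by decide) (by decide) (by decide) (by decide)).of_frame fr₂ (by decide)
      (by decide) (by decide) (by decide)
  refine wp_mono (wp_features (hcur.of_frame fr₂ (by decide) (by decide) (by decide)) hQ₂ hF') ?_
  rintro T₃ σ₃ ⟨L, hQ₃, hL, hlen, hT₃⟩ fr₃
  have h9' : σ₃.nat 9 = σ₂.nat 9 := fr₃.nat 9 (by decide)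
  have hseen' : seen n σ₃ = insert e (seen n σ) := by rw [seen_congr h9', hseen]
  refine ⟨L, Fl', hQ₃, hF'.of_frame fr₃ (by decide) (by decide), hC'.congr h9', ?_, ?_, ?_, ?_, ?_⟩
  · refine children_of_mem_iff he hF'.nodup (fun i hi => ?_) hL hlen hcand
    -- If `e` and its witness differ in feature `i`, one of them differs there from the first
    -- example. Both have been seen, unless the witness is the first example itself.
    by_cases hz : E.ex e i = E.ex ⟨0, e.pos⟩ i
    · rcases hwit _ (R.hasWit_leafOf (E.ex e)) with h | h
      · have : (⟨0, e.pos⟩ : Fin n) = R.leafOf (E.ex e) := Fin.ext h.symm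
        exact absurd (this ▸ hz) hi
      · refine hC' _ ⟨0, e.pos⟩ rfl (by rw [hseen]; exact Finset.mem_insert_of_mem h) i ?_
        rw [← hz]
        exact hi.symm
    · exact hC' e ⟨0, e.pos⟩ rfl (by rw [hseen]; exact Finset.mem_insert_self _ _) i hz
  · rw [hseen']
    exact Finset.subset_insert _ _
  · rw [hseen']
    exact Finset.card_insert_le _ _
  · intro R' hR' w hw
    obtain ⟨i, -, v, -, p, -, rfl⟩ := (hL R').1 hR'
    rw [hseen', Finset.mem_insert]
    rcases WTree.hasWit_insAt hw with h | h
    · exact (hwit w h).imp_right .inr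
    · exact .inr (.inl h)
  · rw [seen_congr h9']
    omega

/-- The number of features that are not constant. -/
noncomputable def DataSet.numVar (E : DataSet n d) : ℕ :=
  (Finset.univ.filter fun i : Fin d => ¬ ∀ a b, E.ex a i = E.ex b i).card

theorem Listed.length_le {σ : State} {Fl : List (Fin d)} (h : Listed E σ Fl) :
    Fl.length ≤ E.numVar := by
  rw [← List.toFinset_card_of_nodup h.nodup]
  refine Finset.card_le_card fun i hi => ?_
  obtain ⟨a, b, hab⟩ := h.nonconst i (List.mem_toFinset.1 hi)
  exact Finset.mem_filter.2 ⟨Finset.mem_univ i, fun h' => hab (h' a b)⟩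

/-- Invariant of the search with queue `Q` and list of features `Fl`. The last field bounds the time
`T` spent so far. -/
structure Searching (E : DataSet n d) (s T : ℕ) (σ : State) (Q : List (WTree n d))
    (Fl : List (Fin d)) : Prop where
  queue : Queue E σ Q
  listed : Listed E σ Fl
  covers : Covers E σ Fl
  search : Search E s Q (σ.var 3)
  wit : ∀ R ∈ Q, ∀ w, R.HasWit w → w.1 = 0 ∨ w ∈ seen n σ
  checked_le : σ.var 2 ≤ Q.length
  checked : ∀ m R, m < σ.var 2 → Q[m]? = some R → (dirty E R).Nonempty
  card_seen : (seen n σ).card ≤ σ.var 3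
  time : T ≤ 1000 * ((n + 1) * (s + 1)) * (σ.var 2 + Q.length + σ.var 3) +
    1000 * (E.numVar + 1) * σ.var 3 + 100 * (d + 1) * (seen n σ).card

/-- No comparison with other entries is needed: the size of each tree in the queue is at most the
optimum `s`. -/
theorem Searching.isMinimumTree {s T m : ℕ} {σ : State} {Q : List (WTree n d)}
    {Fl : List (Fin d)} {R : WTree n d} (h : Searching E s T σ Q Fl) (hR : Q[m]? = some R)
    (hd : dirty E R = ∅) (hs : ∀ T, E.Classifies T → s ≤ T.size) :
    E.IsMinimumTree (R.toTree E) ∧ (R.toTree E).size = s := by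
  have hmem := List.mem_of_getElem? hR
  have hcl : E.Classifies (R.toTree E) := by
    refine ⟨h.search.cuts R hmem, fun a => ?_⟩
    rw [WTree.classOf_toTree]
    by_contra hne
    exact Finset.notMem_empty a (hd ▸ Finset.mem_filter.2 ⟨Finset.mem_univ a, hne⟩)
  have hle : (R.toTree E).size ≤ s := by
    rw [WTree.size_toTree]
    exact h.search.le R hmem
  exact ⟨⟨hcl, fun T' hT' => hle.trans (hs T' hT')⟩, hle.antisymm (hs _ hcl)⟩

/-- Bound on the running time of the search, up to a constant, in terms of bounds `M` and `M'` on
the numbers of all entries and of expanded entries of the queue. -/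
noncomputable def DataSet.timeBound (E : DataSet n d) (s M M' : ℕ) : ℕ :=
  (n + 1) * (s + 1) * (M + M' + 1) + (E.numVar + 1) * M' + (d + 1) * min n M'

theorem Searching.setV {s T : ℕ} {σ : State} {Q : List (WTree n d)} {Fl : List (Fin d)}
    (h : Searching E s T σ Q Fl) {x k : ℕ} (hx : 1 ≠ x ∧ 2 ≠ x ∧ 3 ≠ x ∧ 4 ≠ x ∧ 5 ≠ x) :
    Searching E s T (σ.setV x k) Q Fl where
  queue := h.queue.setV hx.1 hx.2.2.2.1
  listed := ⟨by simpa [hx] using h.listed.length, h.listed.get, h.listed.nodup, h.listed.flag,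
    h.listed.nonconst⟩
  covers := h.covers
  search := by simpa [hx] using h.search
  wit := h.wit
  checked_le := by simpa [hx] using h.checked_le
  checked := by simpa [hx] using h.checked
  card_seen := by simpa [hx, seen_setV] using h.card_seen
  time := by simpa [hx, seen_setV] using h.time

theorem Searching.of_frame {P : Prog} {s T : ℕ} {σ τ : State} {Q : List (WTree n d)}
    {Fl : List (Fin d)} (h : Searching E s T σ Q Fl) (fr : P.Frame σ τ)
    (hv : ∀ x ∈ P.vars, 6 ≤ x) (hn : ∀ a ∈ P.nats, a = 7 ∨ a = 8) (hr : 0 ∉ P.reals) :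
    Searching E s T τ Q Fl := by
  have hv' : ∀ x < 6, x ∉ P.vars := fun x hx hx' => absurd (hv x hx') (by omega)
  have hn' : ∀ a, a ≠ 7 → a ≠ 8 → a ∉ P.nats := fun a h7 h8 ha => (hn a ha).elim h7 h8
  have h9 : τ.nat 9 = σ.nat 9 := fr.nat 9 (hn' 9 (by norm_num) (by norm_num))
  have h2 := fr.var 2 (hv' 2 (by norm_num))
  have h3 := fr.var 3 (hv' 3 (by norm_num))
  exact
  { queue := h.queue.of_frame fr (hv' 1 (by norm_num)) (hv' 4 (by norm_num))
      (fun a ha => hn' a (by omega) (by omega)) hr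
    listed := h.listed.of_frame fr (hv' 5 (by norm_num))
      ⟨hn' 10 (by norm_num) (by norm_num), hn' 11 (by norm_num) (by norm_num)⟩
    covers := h.covers.congr h9
    search := by rw [h3]; exact h.search
    wit := by rw [seen_congr h9]; exact h.wit
    checked_le := by rw [h2]; exact h.checked_le
    checked := by rw [h2]; exact h.checked
    card_seen := by rw [seen_congr h9, h3]; exact h.card_seen
    time := by rw [seen_congr h9, h2, h3]; exact h.time }

theorem wp_checkNext {s T : ℕ} {σ : State} {Q : List (WTree n d)} {Fl : List (Fin d)}
    (h : Searching E s T σ Q Fl) (h6 : σ.var 6 = 0) (hg : σ.var 2 < Q.length) :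
    wp E checkNext (fun t τ => t ≤ 200 * ((n + 1) * (s + 1)) ∧
      ((τ.var 6 = 1 ∧ τ.var 2 = σ.var 2 ∧ ∃ R, dirty E R = ∅ ∧ Q[σ.var 2]? = some R ∧
        τ.Outputs (R.toTree E)) ∨
      (τ.var 6 = 0 ∧ τ.var 2 = σ.var 2 + 1 ∧ τ.var 3 = σ.var 3 ∧
        ∀ T', T' ≤ T + 1000 * ((n + 1) * (s + 1)) → Searching E s T' τ Q Fl))) σ := by
  obtain ⟨R, hR⟩ : ∃ R, Q[σ.var 2]? = some R := ⟨_, List.getElem?_eq_getElem hg⟩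
  have hsize : (n + 1) * (R.size + 1) ≤ (n + 1) * (s + 1) :=
    Nat.mul_le_mul_left _ (Nat.succ_le_succ (h.search.le R (List.mem_of_getElem? hR)))
  have hpos : 1 ≤ (n + 1) * (s + 1) := Nat.mul_pos (by omega) (by omega)
  simp only [checkNext, wp_seq, wp_setVar, NExpr.value]
  have hRep := h.queue.2 _ R hR
  have h' := h.setV (x := 7) (k := σ.nat 6 (σ.var 2)) (by norm_num)
  refine wp_mono (wp_eval (N := σ.var 4) (R := R) (by simpa [rep_setV] using hRep)) ?_
  rintro t τ ⟨ht, hfl, hiff⟩ fr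
  have hS := h'.of_frame fr (by decide) (by decide) (by decide)
  have h6' : τ.var 6 = 0 := by rw [fr.var 6 (by decide)]; simpa using h6
  have h2' : τ.var 2 = σ.var 2 := by rw [fr.var 2 (by decide)]; simp
  have h3' : τ.var 3 = σ.var 3 := by rw [fr.var 3 (by decide)]; simp
  have h7' : τ.var 7 = σ.nat 6 (σ.var 2) := by rw [fr.var 7 (by decide)]; simp
  simp only [wp_ite, wp_seq, inc, wp_setVar, Test.Holds, NExpr.value, Nat.le_zero, hiff,
    Test.cost, NExpr.cost]
  refine ⟨fun hd => ⟨by omega, .inl ⟨by simp, by simp [h2'], R, hd, hR, ?_⟩⟩,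
    fun hd => ⟨by omega, .inr ⟨by simpa using h6', by simp [h2'], by simp [h3'], fun T' hT' => ?_⟩⟩⟩
  · have : Rep E τ (σ.var 4) (τ.var 7) R := by
      rw [h7']
      exact (rep_setV.2 hRep).mono le_rfl (fr.agree _ (by decide) (by decide))
    simpa [State.Outputs, rep_setV] using ((rep_setV.2 (rep_setV.2 this)).storesAt :
      ((τ.setV 6 1).setV 0 (τ.var 7)).StoresAt (τ.var 7) (R.toTree E))
  · refine ⟨hS.queue.setV (by norm_num) (by norm_num),
      ⟨by simpa using hS.listed.length, hS.listed.get, hS.listed.nodup, hS.listed.flag,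
        hS.listed.nonconst⟩, hS.covers, by simpa using hS.search, hS.wit, ?_, ?_, ?_, ?_⟩
    · simp [h2']; omega
    · intro m R' hm hR'
      simp only [State.setV_var, if_true, h2'] at hm
      rcases Nat.lt_succ_iff_lt_or_eq.1 hm with hm | rfl
      · exact hS.checked m R' (by rwa [h2']) hR'
      · obtain rfl : R = R' := Option.some_injective _ (hR.symm.trans hR')
        exact Finset.nonempty_iff_ne_empty.2 hd
    · simpa [seen_setV] using hS.card_seen
    · have ht := hS.time
      simp only [State.setV_var, Nat.reduceEqDiff, if_true, if_false, seen_setV]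
      have := Nat.mul_succ (1000 * ((n + 1) * (s + 1))) (τ.var 2 + Q.length + τ.var 3)
      rw [show τ.var 2 + 1 + Q.length + τ.var 3 = (τ.var 2 + Q.length + τ.var 3).succ by omega]
      omega

/-- The condition `hg` says that all entries have been checked, hence are dirty, as `Search.expand`
requires. The margin in the time leaves room for the test of the outer loop. -/
theorem wp_expandNext {s T : ℕ} {σ : State} {Q : List (WTree n d)} {Fl : List (Fin d)}
    (h : Searching E s T σ Q Fl) (h6 : σ.var 6 = 0) (hg : σ.var 2 = Q.length) :
    wp E expandNext (fun t τ => τ.var 6 = 0 ∧ τ.var 2 = σ.var 2 ∧ τ.var 3 = σ.var 3 + 1 ∧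
      ∃ Q' Fl', ∀ T', T' ≤ T + t + 50 → Searching E s T' τ Q' Fl') σ := by
  have hall : ∀ R ∈ Q, (dirty E R).Nonempty := fun R hR => by
    obtain ⟨m, hm⟩ := List.mem_iff_getElem?.1 hR
    exact h.checked m R (by rw [hg]; exact (List.getElem?_eq_some_iff.1 hm).1) hm
  obtain ⟨R, hR⟩ : ∃ R, Q[σ.var 3]? = some R := ⟨_, List.getElem?_eq_getElem h.search.lt_length⟩
  have hmem := List.mem_of_getElem? hR
  have hsize : (n + 1) * (R.size + 1) ≤ (n + 1) * (s + 1) :=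
    Nat.mul_le_mul_left _ (Nat.succ_le_succ (h.search.le R hmem))
  have hpos : 1 ≤ (n + 1) * (s + 1) := Nat.mul_pos (by omega) (by omega)
  simp only [expandNext, wp_seq, wp_setVar, NExpr.value]
  have hRep := h.queue.2 _ R hR
  have h' := h.setV (x := 7) (k := σ.nat 6 (σ.var 3)) (by norm_num)
  refine wp_mono (wp_eval (N := σ.var 4) (R := R) (by simpa [rep_setV] using hRep)) ?_
  rintro t τ ⟨ht, hfl, -⟩ fr
  have hS := h'.of_frame fr (by decide) (by decide) (by decide)
  have h6' : τ.var 6 = 0 := by rw [fr.var 6 (by decide)]; simpa using h6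
  have h2' : τ.var 2 = σ.var 2 := by rw [fr.var 2 (by decide)]; simp
  have h3' : τ.var 3 = σ.var 3 := by rw [fr.var 3 (by decide)]; simp
  have h4' : τ.var 4 = σ.var 4 := by rw [fr.var 4 (by decide)]; simp
  have h7' : τ.var 7 = σ.nat 6 (σ.var 3) := by rw [fr.var 7 (by decide)]; simp
  have hRep' : Rep E τ (τ.var 4) (τ.var 7) R := by
    rw [h7', h4']
    exact (rep_setV.2 hRep).mono le_rfl (fr.agree _ (by decide) (by decide))
  refine wp_mono (wp_expand hRep' hfl (hall R hmem) hS.queue hS.listed hS.covers (hS.wit R hmem)) ?_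
  rintro t' υ ⟨L, Fl', k1, k2, k3, k4, k5, k6, k7, k8⟩ fr'
  have g2 : υ.var 2 = σ.var 2 := by rw [fr'.var 2 (by decide), h2']
  have g3 : υ.var 3 = σ.var 3 := by rw [fr'.var 3 (by decide), h3']
  simp only [inc, wp_setVar, NExpr.value]
  refine ⟨?_, by simp [g2], by simp [g3], Q ++ L, Fl', fun T' hT' => ⟨k1.setV (by norm_num)
    (by norm_num), ⟨by simpa using k2.length, k2.get, k2.nodup, k2.flag, k2.nonconst⟩, k3, ?_, ?_,
    ?_, ?_, ?_, ?_⟩⟩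
  · simpa [fr'.var 6 (by decide)] using h6'
  · simpa [g3] using h.search.expand hR hall k4
  · intro R' hR' w hw
    rcases List.mem_append.1 hR' with hR' | hR'
    · exact (hS.wit R' hR' w hw).imp_right fun h => k5 h
    · exact k7 R' hR' w hw
  · simp [g2, hg]
  · intro m R' hm hR'
    simp only [State.setV_var, Nat.reduceEqDiff, if_false, g2, hg] at hm
    rw [List.getElem?_append_left hm] at hR'
    exact hall R' (List.mem_of_getElem? hR')
  · have := hS.card_seen
    simp only [State.setV_var, if_true, g3]
    rw [h3'] at this
    exact k6.trans (by omega)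
  · have ht := hS.time
    have hFl := k2.length_le
    have e1 : ((υ.setV 3 (υ.var 3 + 1)).var 2 + (Q ++ L).length + (υ.setV 3 (υ.var 3 + 1)).var 3)
        = τ.var 2 + Q.length + τ.var 3 + (L.length + 1) := by
      simp only [State.setV_var, Nat.reduceEqDiff, if_true, if_false, g2, g3, h2', h3',
        List.length_append]
      omega
    have e2 : (υ.setV 3 (υ.var 3 + 1)).var 3 = τ.var 3 + 1 := by simp [g3, h3']
    rw [e1, e2, seen_setV]
    have k9 : 1000 * ((n + 1) * (R.size + 1)) * L.length ≤
        1000 * ((n + 1) * (s + 1)) * L.length := by gcongr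
    simp only [NExpr.cost] at hT'
    generalize (n + 1) * (s + 1) = U at *
    generalize 100 * (d + 1) * (seen n υ).card = S' at *
    generalize 100 * (d + 1) * (seen n τ).card = S at *
    rw [Nat.mul_add, Nat.mul_add _ L.length 1, Nat.mul_add _ (τ.var 3) 1]
    generalize 1000 * (E.numVar + 1) * τ.var 3 = V at *
    omega

end

/-! ### Correctness and running time of the whole program -/

section

variable {n d : ℕ} {E : DataSet n d}

/-- Bound on the number of all entries of the queue. -/
noncomputable def DataSet.queueBound (E : DataSet n d) (s : ℕ) : ℕ :=
  ∑ j ∈ Finset.range s, E.levelBound j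

/-- The number of scans is bounded both by `n` and by the number of expansions. The summand on the
left pays for one more check, after which the program halts. -/
theorem Searching.time_le {s T : ℕ} {σ : State} {Q : List (WTree n d)} {Fl : List (Fin d)}
    (h : Searching E s T σ Q Fl) :
    T + 1000 * ((n + 1) * (s + 1)) ≤
      2000 * E.timeBound s (E.queueBound (s + 1)) (E.queueBound s) := by
  have hM : Q.length ≤ E.queueBound (s + 1) := h.search.length_le
  have hM' : σ.var 3 ≤ E.queueBound s := h.search.expanded_le
  have hg := h.checked_le
  have hsn : (seen n σ).card ≤ min n (E.queueBound s) :=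
    le_min ((Finset.card_le_univ _).trans_eq (Fintype.card_fin n)) (h.card_seen.trans hM')
  have e1 : 1000 * ((n + 1) * (s + 1)) * (σ.var 2 + Q.length + σ.var 3) ≤
      1000 * ((n + 1) * (s + 1)) * (2 * E.queueBound (s + 1) + E.queueBound s) := by
    gcongr
    omega
  have e2 : 1000 * (E.numVar + 1) * σ.var 3 ≤ 1000 * (E.numVar + 1) * E.queueBound s := by
    gcongr
  have e3 : 100 * (d + 1) * (seen n σ).card ≤ 100 * (d + 1) * min n (E.queueBound s) := by
    gcongr
  have := h.time
  rw [DataSet.timeBound]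
  nlinarith [Nat.zero_le ((n + 1) * (s + 1) * E.queueBound s),
    Nat.zero_le ((E.numVar + 1) * E.queueBound s), Nat.zero_le ((d + 1) * min n (E.queueBound s))]

theorem wp_search {s : ℕ} {σ : State} {Q : List (WTree n d)} {Fl : List (Fin d)}
    (h : Searching E s 0 σ Q Fl) (h6 : σ.var 6 = 0) (hs : ∀ T, E.Classifies T → s ≤ T.size) :
    wp E search (fun t τ => t ≤ 2000 * E.timeBound s (E.queueBound (s + 1)) (E.queueBound s) ∧
      ∃ T : DecisionTree d, τ.Outputs T ∧ E.IsMinimumTree T ∧ T.size = s) σ := by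
  have hpos : 1 ≤ (n + 1) * (s + 1) := Nat.mul_pos (by omega) (by omega)
  refine wp_while (fun T τ => (τ.var 6 = 0 ∧ ∃ Q Fl, Searching E s T τ Q Fl) ∨
    (τ.var 6 = 1 ∧ T + 10 ≤ 2000 * E.timeBound s (E.queueBound (s + 1)) (E.queueBound s) ∧
      ∃ T : DecisionTree d, τ.Outputs T ∧ E.IsMinimumTree T ∧ T.size = s))
    -- Each iteration sets the flag, checks an entry or expands one, and the two counters are
    -- bounded by the size of the search tree.
    (fun τ => (1 - τ.var 6) + (E.queueBound (s + 1) - τ.var 2) + (E.queueBound s - τ.var 3))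
    (.inl ⟨h6, Q, Fl, h⟩) ?_ ?_
  · rintro T τ - (⟨k6, Q, Fl, hS⟩ | ⟨k6, -⟩) hb
    swap
    · simp [Test.Holds, NExpr.value, k6] at hb
    have hlt : (ltT (var 2) (var 1)).Holds E τ ↔ τ.var 2 < Q.length := by
      rw [ltT_holds]
      simp only [NExpr.value, hS.queue.1]
    simp only [wp_ite, hlt]
    simp only [ltT, Test.cost, NExpr.cost]
    refine ⟨fun hg => wp_mono (wp_checkNext hS k6 hg) ?_, fun hg =>
      wp_mono (wp_expandNext hS k6 (by have := hS.checked_le; omega)) ?_⟩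
    · rintro t υ ⟨ht, ⟨g6, g2, R, hd, hR, hout⟩ | ⟨g6, g2, g3, hS'⟩⟩ fr
      · have g3 : υ.var 3 = τ.var 3 := fr.var 3 (by decide)
        have := hS.time_le
        refine ⟨.inr ⟨g6, by omega, R.toTree E, hout, hS.isMinimumTree hR hd hs⟩, by omega⟩
      · have : τ.var 2 < E.queueBound (s + 1) := hg.trans_le hS.search.length_le
        exact ⟨.inl ⟨g6, Q, Fl, hS' _ (by omega)⟩, by omega⟩
    · rintro t υ ⟨g6, g2, g3, Q', Fl', hS'⟩ -
      have h' := hS' 0 (by omega)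
      have : υ.var 3 ≤ E.queueBound s := h'.search.expanded_le
      exact ⟨.inl ⟨g6, Q', Fl', hS' _ (by omega)⟩, by omega⟩
  · rintro T τ - (⟨k6, -⟩ | ⟨-, hT, hout⟩) hb
    · simp [Test.Holds, NExpr.value, k6] at hb
    · refine ⟨?_, hout⟩
      simp only [Test.cost, NExpr.cost]
      omega

theorem wp_solve {T : DecisionTree d} (hT : E.IsMinimumTree T) :
    wp E solve (fun t τ =>
      t ≤ 2000 * E.timeBound T.size (E.queueBound (T.size + 1)) (E.queueBound T.size) + 20 ∧
      ∃ T' : DecisionTree d, τ.Outputs T' ∧ E.IsMinimumTree T' ∧ T'.size = T.size)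
      State.init := by
  simp only [solve, wp_ite, Test.Holds, NExpr.value, Nat.le_zero]
  refine ⟨?_, fun hn => ?_⟩
  · rintro rfl
    simp only [skip, wp_setVar, Test.cost, NExpr.cost]
    have hmin : E.IsMinimumTree (.leaf false) :=
      ⟨⟨trivial, fun a => a.elim0⟩, fun T' _ => Nat.zero_le _⟩
    exact ⟨by omega, .leaf false, by simp [State.Outputs, State.StoresAt, State.init], hmin,
      (hmin.2 T hT.1).antisymm (hT.2 _ hmin.1)⟩
  · obtain ⟨z, hz⟩ : ∃ z : Fin n, z.1 = 0 := ⟨⟨0, Nat.pos_of_ne_zero hn⟩, rfl⟩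
    simp only [wp_seq, wp_setNat, wp_setVar,
      value_label (E := E) (σ := State.init) (e := const 0) (a := z) hz.symm]
    -- Zero memory already describes a leaf at cell `0` with size `0` and the first example as
    -- witness, and the first queue entry points to it. Only the class, the queue length and the
    -- number of used cells had to be written.
    have hS : Searching E T.size 0 (((State.init.setN 1 0 (if E.label z then 1 else 0)).setV 1 1).setV
        4 1) [.leaf z] [] := by
      refine ⟨⟨by simp, fun m R hm => ?_⟩, ⟨by simp [State.init], by simp, by simp,
        by simp [State.init], by simp⟩, ?_, ?_, ?_, by simp [State.init], by simp [State.init], ?_, ?_⟩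
      · obtain ⟨rfl, rfl⟩ : m = 0 ∧ R = .leaf z := by
          rcases m with _ | m <;> simp_all
        simp [Rep, State.init, hz]
      · intro a z' _ ha
        simp [seen, State.init] at ha
      · exact search_singleton ⟨trivial, T, .leaf _ _, hT.1, le_rfl⟩
      · simp [WTree.HasWit, hz]
      · simp [seen, State.init]
      · simp
    refine wp_mono (wp_search hS (by simp [State.init]) hT.2) ?_
    rintro t τ ⟨ht, h⟩ -
    refine ⟨?_, h⟩
    simp only [Test.cost, NExpr.cost]
    omega

theorem DataSet.numConst_add_numVar (E : DataSet n d) : E.numConst + E.numVar = d := by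
  rw [numConst, numVar, Finset.card_filter_add_card_filter_not, Finset.card_univ, Fintype.card_fin]

/-- A feature that is not constant takes, at some example, a value other than that of the first
example; each example accounts for at most `δ` such features. -/
theorem DataSet.numVar_le (E : DataSet n d) : E.numVar ≤ n * E.maxDiff := by
  rcases Nat.eq_zero_or_pos n with rfl | hn
  · simp [numVar]
  · calc E.numVar ≤ (Finset.univ.biUnion fun a : Fin n =>
          Finset.univ.filter fun i => E.ex a i ≠ E.ex ⟨0, hn⟩ i).card := by
          refine Finset.card_le_card fun i hi => ?_
          simp only [Finset.mem_filter, Finset.mem_univ, true_and, Finset.mem_biUnion] at hi ⊢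
          by_contra! h
          exact hi fun a b => (h a).trans (h b).symm
      _ ≤ n * E.maxDiff := by
          refine (Finset.card_biUnion_le_card_mul _ _ E.maxDiff fun a _ => ?_).trans (by simp)
          exact Finset.le_sup (f := fun p : Fin n × Fin n =>
            (Finset.univ.filter fun i => E.ex p.1 i ≠ E.ex p.2 i).card)
            (Finset.mem_univ (a, ⟨0, hn⟩))

/-- If no tree of size `0` is a solution, then two examples differ. -/
theorem DataSet.IsMinimumTree.pos {T : DecisionTree d} (hT : E.IsMinimumTree T)
    (hs : 1 ≤ T.size) : 1 ≤ n ∧ 1 ≤ E.maxDiff ∧ 1 ≤ E.maxDom := by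
  obtain ⟨a, b, i, hi⟩ : ∃ (a b : Fin n) (i : Fin d), E.ex a i ≠ E.ex b i := by
    by_contra! h
    rcases Nat.eq_zero_or_pos n with rfl | hn
    · have := hT.2 (.leaf false) ⟨trivial, fun a => a.elim0⟩
      simp only [DecisionTree.size] at this
      omega
    · have := hT.2 (.leaf (E.label ⟨0, hn⟩))
        ⟨trivial, fun a => E.consistent _ _ (funext fun i => h _ _ i)⟩
      simp only [DecisionTree.size] at this
      omega
  refine ⟨a.pos, le_trans ?_ (Finset.le_sup (f := fun p : Fin n × Fin n =>
      (Finset.univ.filter fun i => E.ex p.1 i ≠ E.ex p.2 i).card) (Finset.mem_univ (a, b))),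
    le_trans ?_ (Finset.le_sup (f := fun i => (E.dom i).card) (Finset.mem_univ i))⟩
  · exact Finset.card_pos.2 ⟨i, by simpa using hi⟩
  · exact Finset.card_pos.2 ⟨E.ex a i, by simp [DataSet.dom]⟩

end

/-! ### Arithmetic of the running time -/

section

variable {n d : ℕ} {E : DataSet n d}

/-- Each branching factor is at least `δ`, so going one level deeper absorbs the factor `δ`. -/
theorem DataSet.maxDiff_mul_levelBound_le (hδ : 1 ≤ E.maxDiff) (hD : 1 ≤ E.maxDom) {j s : ℕ}
    (hj : j < s) : E.maxDiff * E.levelBound j ≤ E.levelBound s := by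
  have h1 : ∀ j, E.maxDiff ≤ E.branching j := fun j => by
    rw [branching, mul_assoc]
    exact Nat.le_mul_of_pos_right _ (Nat.mul_pos hD (by omega))
  have hmono : Monotone E.levelBound := monotone_nat_of_le_succ fun j => by
    rw [levelBound, levelBound, Finset.prod_range_succ]
    exact Nat.le_mul_of_pos_right _ (hδ.trans (h1 j))
  calc E.maxDiff * E.levelBound j ≤ E.levelBound (j + 1) := by
        rw [levelBound, levelBound, Finset.prod_range_succ, mul_comm]
        exact Nat.mul_le_mul_left _ (h1 j)
    _ ≤ _ := hmono hj

/-- The features that vary cost `n * δ` per expansion, and `δ` times the number of expansions is at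
most `s * E.levelBound s`. -/
theorem DataSet.timeBound_le (hn : 1 ≤ n) (hδ : 1 ≤ E.maxDiff) (hD : 1 ≤ E.maxDom) (s : ℕ) :
    E.timeBound s (E.queueBound (s + 1)) (E.queueBound s) ≤
      8 * (n * (s + 1) ^ 2 * E.levelBound s) + n * E.numConst := by
  have h1 : E.maxDiff * E.queueBound s ≤ s * E.levelBound s := by
    rw [queueBound, Finset.mul_sum]
    refine (Finset.sum_le_card_nsmul _ _ (E.levelBound s) fun j hj => ?_).trans (by simp)
    exact maxDiff_mul_levelBound_le hδ hD (Finset.mem_range.1 hj)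
  have h2 : E.queueBound s ≤ E.maxDiff * E.queueBound s := Nat.le_mul_of_pos_left _ hδ
  have h3 : E.queueBound (s + 1) = E.queueBound s + E.levelBound s := Finset.sum_range_succ _ _
  have h4 : 1 ≤ E.levelBound s := Finset.prod_pos fun m _ =>
    Nat.mul_pos (Nat.mul_pos hδ hD) (by omega)
  have h5 := E.numVar_le
  have h6 := E.numConst_add_numVar
  have h7 : E.queueBound (s + 1) + E.queueBound s + 1 ≤ 2 * ((s + 1) * E.levelBound s) := by
    nlinarith
  have h8 : (E.numVar + 1) * E.queueBound s ≤ 2 * (n * (s * E.levelBound s)) := by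
    calc (E.numVar + 1) * E.queueBound s ≤ (n * E.maxDiff + n * E.maxDiff) * E.queueBound s := by
          gcongr
          exact Nat.mul_pos hn hδ
      _ = 2 * (n * (E.maxDiff * E.queueBound s)) := by ring
      _ ≤ _ := by gcongr
  -- Split `d` into constant and other features, and bound the minimum by `n` for the former and by
  -- the number of expansions for the latter.
  have h9 : (d + 1) * min n (E.queueBound s) ≤ n * E.numConst + (E.numVar + 1) * E.queueBound s := by
    have e : d + 1 = E.numConst + (E.numVar + 1) := by omega
    rw [e, add_mul, mul_comm n]
    gcongr
    exacts [min_le_left _ _, min_le_right _ _]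
  calc E.timeBound s (E.queueBound (s + 1)) (E.queueBound s)
      ≤ (n + n) * (s + 1) * (2 * ((s + 1) * E.levelBound s)) + 2 * (n * (s * E.levelBound s)) +
        (n * E.numConst + 2 * (n * (s * E.levelBound s))) := by
        rw [timeBound]
        gcongr
        exact h9.trans (Nat.add_le_add_left h8 _)
    _ = 4 * (n * (s + 1) * (s + 1) * E.levelBound s) + 4 * (n * s * 1 * E.levelBound s) +
        n * E.numConst := by ring
    _ ≤ 4 * (n * (s + 1) * (s + 1) * E.levelBound s) + 4 * (n * (s + 1) * (s + 1) * E.levelBound s) +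
        n * E.numConst := by gcongr <;> omega
    _ = _ := by ring

theorem DataSet.levelBound_eq (E : DataSet n d) (s : ℕ) : (E.levelBound s : ℝ) =
    ((E.maxDiff : ℝ) * E.maxDom) ^ s * ∏ m ∈ Finset.range s, (1 + Nat.log 2 (m + 1) : ℝ) := by
  simp only [levelBound, branching]
  push_cast
  rw [Finset.prod_mul_distrib, Finset.prod_const, Finset.card_range]

end

end MSDT

theorem mainTheorem1 :
    ∃ (P : MSDT.Prog) (C : ℝ), ∀ (n d : ℕ) (E : MSDT.DataSet n d),
      ∃ (time : ℕ) (σ : MSDT.State) (T : MSDT.DecisionTree d),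
        MSDT.Runs E P MSDT.State.init time σ ∧ σ.Outputs T ∧ E.IsMinimumTree T ∧
        (time : ℝ) ≤ C * (((E.maxDiff : ℝ) * E.maxDom * max 1 (Real.logb 2 T.size)) ^ T.size *
          T.size * n + (n * E.numConst + n + 1)) := by
  obtain ⟨C, hC, hprod⟩ := MSDT.exists_prod_one_add_log_le
  -- `16000` is the `2000` of `wp_solve` times the `8` of `timeBound_le`; `5000` covers the term
  -- with constant features, the additive constants and the case `s = 0`.
  refine ⟨MSDT.solve, 16000 * C + 5000, fun n d E => ?_⟩
  obtain ⟨T₀, hT₀⟩ := E.exists_isMinimumTree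
  obtain ⟨time, σ, hrun, htime, T, hout, hT, hsize⟩ := MSDT.wp_solve hT₀
  refine ⟨time, σ, T, hrun, hout, hT, ?_⟩
  rw [← hsize] at htime
  generalize hs : T.size = s at *
  have hmax : (0 : ℝ) ≤ max 1 (Real.logb 2 s) := zero_le_one.trans (le_max_left _ _)
  -- For `s = 0` the main term vanishes, and the program only checks a single leaf, in time linear
  -- in `n`.
  rcases Nat.eq_zero_or_pos s with rfl | hpos
  · have h : time ≤ 4000 * (n + 1) + 20 := by
      refine htime.trans ?_
      simp [MSDT.DataSet.timeBound, MSDT.DataSet.queueBound, MSDT.DataSet.levelBound]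
      omega
    have h' : (time : ℝ) ≤ 4000 * (n + 1) + 20 := by exact_mod_cast h
    have hc : (0 : ℝ) ≤ n * E.numConst := by positivity
    have : 0 ≤ C * (n * E.numConst + n + 1) := by positivity
    simp only [Nat.cast_zero, mul_zero, zero_mul, zero_add]
    nlinarith
  · obtain ⟨hn, hδ, hD⟩ := hT.pos (hs ▸ hpos)
    have h : (time : ℝ) ≤ 2000 * (8 * (n * (s + 1) ^ 2 * E.levelBound s) + n * E.numConst) + 20 := by
      exact_mod_cast htime.trans
        (Nat.add_le_add_right (Nat.mul_le_mul_left _ (MSDT.DataSet.timeBound_le hn hδ hD s)) _)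
    have hs1 : (1 : ℝ) ≤ s := by exact_mod_cast hpos
    set L := max 1 (Real.logb 2 s) with hL
    -- The polynomial factor disappears in `hprod`; the factor `s` of the stated bound is not needed
    -- and is simply at least `1`.
    have key : (n : ℝ) * (s + 1) ^ 2 * E.levelBound s ≤
        C * ((E.maxDiff * E.maxDom * L) ^ s * s * n) := by
      rw [E.levelBound_eq]
      have hp : (0 : ℝ) ≤ ∏ m ∈ Finset.range s, (1 + Nat.log 2 (m + 1) : ℝ) :=
        Finset.prod_nonneg fun m _ => by positivity
      set p := ∏ m ∈ Finset.range s, (1 + Nat.log 2 (m + 1) : ℝ) with hpdef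
      calc (n : ℝ) * (s + 1) ^ 2 * ((E.maxDiff * E.maxDom) ^ s * p)
          = n * (E.maxDiff * E.maxDom) ^ s * ((s + 1) ^ 2 * p) := by ring
        _ ≤ n * (E.maxDiff * E.maxDom) ^ s * ((s + 1) ^ 3 * p) := by
          gcongr <;> linarith
        _ ≤ n * (E.maxDiff * E.maxDom) ^ s * (C * L ^ s) := by
          exact mul_le_mul_of_nonneg_left (hprod s hpos) (by positivity)
        _ = n * (E.maxDiff * E.maxDom) ^ s * (C * L ^ s) * 1 := by ring
        _ ≤ n * (E.maxDiff * E.maxDom) ^ s * (C * L ^ s) * s := by gcongr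
        _ = _ := by ring
    have h1 : (0 : ℝ) ≤ (E.maxDiff * E.maxDom * L) ^ s * s * n := by positivity
    have h2 : (0 : ℝ) ≤ n * E.numConst := by positivity
    have h3 : 0 ≤ C * (n * E.numConst + n + 1) := by positivity
    have h4 : (0 : ℝ) ≤ n := by positivity
    nlinarith
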